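/- **Theorem 4.1.** Let $G$ be a compact connected semisimple Lie group with Lie algebra $\mathfrak g$ and Killing form $B$, and let $H<G$ be a closed connected subgroup with Lie algebra $\mathfrak h$. Suppose $M=G/H$ is a generalised Wallach space, i.e. the $B$-orthogonal complement $\mathfrak m$ of $\mathfrak h$ in $\mathfrak g$ is a $B$-orthogonal sum $\mathfrak m=\mathfrak m_1\oplus\mathfrak m_2\oplus\mathfrak m_3$ of non-zero $\mathrm{Ad}(H)$-invariant, $\mathrm{Ad}(H)$-irreducible subspaces such that $[\mathfrak m_i,\mathfrak m_i]\subset\mathfrak h$ for $i=1,2,3$. Assume that the representations $\mathrm{Ad}(H)|_{\mathfrak m_1}$, $\mathrm{Ad}(H)|_{\mathfrak m_2}$, $\mathrm{Ad}(H)|_{\mathfrak m_3}$ are pairwise inequivalent. Put $d_i=\dim\mathfrak m_i$ and $d=d_1+d_2+d_3=\dim M$. Let $[123]$ be the squared norm, with respect to the scalar product $-B$, of the tensor $\mathfrak m_2\times\mathfrak m_3\to\mathfrak m_1$, $(X,Y)\mapsto\pi_{\mathfrak m_1}[X,Y]$, where $\pi_{\mathfrak m_i}$ denotes the $(-B)$-orthogonal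 projection onto $\mathfrak m_i$; that is, $[123]=\sum_{a,b,c}B([e^2_b,e^3_c],e^1_a)^2$ for $(-B)$-orthonormal bases $(e^i_a)_a$ of $\mathfrak m_i$. Assume $[123]>0$. Let $T$ be a $G$-invariant Riemannian metric on $M$ which, under the identification of $\mathfrak m$ with the tangent space of $M$ at $H$, is given by $$T=-z_1\pi_{\mathfrak m_1}^*B-z_2\pi_{\mathfrak m_2}^*B-z_3\pi_{\mathfrak m_3}^*B,\qquad z_1,z_2,z_3>0.$$ Suppose $p\in\{1,2,3\}$ is such that $$\frac{d_p-2[123]}{2d_pz_p}=\max_{i=1,2,3}\frac{d_i-2[123]}{2d_iz_i}.$$ If $$(d_p-2[123])\sum_{i\in\{1,2,3\}\setminus\{p\}}d_iz_i<(d-d_p)\,d_pz_p,$$ then there exists a $G$-invariant Riemannian metric $g$ on $M$ with $\operatorname{tr}_gT=1$ whose Ricci curvature equals $cT$ for some $c>0$. -/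

import Mathlib

open Bundle
open scoped Manifold ContDiff

/-- Over the reals the smoothness needed for the Lie bracket is at most `∞`. -/
instance lEInfty_minSmoothness_three : ENat.LEInfty (minSmoothness ℝ 3) :=
  ⟨by
    rw [minSmoothness_of_isRCLikeNormedField]
    exact ENat.LEInfty.out⟩

/-! ### Levi-Civita connection and Ricci curvature -/

section Riemannian

variable {k : ℕ} {M : Type*} [TopologicalSpace M] [ChartedSpace (EuclideanSpace ℝ (Fin k)) M]

/-- Smooth Riemannian metrics on the manifold `M`. -/
abbrev SmoothMetric (k : ℕ) (M : Type*) [TopologicalSpace M]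
    [ChartedSpace (EuclideanSpace ℝ (Fin k)) M] [IsManifold (𝓡 k) ∞ M] :=
  ContMDiffRiemannianMetric (𝓡 k) ∞ (EuclideanSpace ℝ (Fin k))
    (TangentSpace (𝓡 k) : M → Type _)

/-- Affine connections on `M`; `cov Y x (X x)` is the value of `∇_X Y` at `x`. -/
abbrev AffineConnection (k : ℕ) (M : Type*) [TopologicalSpace M]
    [ChartedSpace (EuclideanSpace ℝ (Fin k)) M] [IsManifold (𝓡 k) ∞ M] :=
  CovariantDerivative (𝓡 k) (EuclideanSpace ℝ (Fin k)) (TangentSpace (𝓡 k) : M → Type _)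

variable [IsManifold (𝓡 k) ∞ M]

/-- `cov` is torsion-free and compatible with `g`.  On differentiable vector fields such a
connection is unique. -/
def IsLeviCivita (g : SmoothMetric k M) (cov : AffineConnection k M) : Prop :=
  cov.torsion = 0 ∧
    ∀ (Y Z : Π x : M, TangentSpace (𝓡 k) x) (x : M) (v : TangentSpace (𝓡 k) x),
      MDifferentiableAt (𝓡 k) (𝓡 k).tangent (fun y ↦ (⟨y, Y y⟩ : TangentBundle (𝓡 k) M)) x →
      MDifferentiableAt (𝓡 k) (𝓡 k).tangent (fun y ↦ (⟨y, Z y⟩ : TangentBundle (𝓡 k) M)) x →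
      mvfderiv (𝓡 k) (fun y : M ↦ g.inner y (Y y) (Z y)) x v =
        g.inner x (cov Y x v) (Z x) + g.inner x (Y x) (cov Z x v)

/-- `R(X, Y) Z = ∇_X ∇_Y Z - ∇_Y ∇_X Z - ∇_[X, Y] Z` for vector fields smooth near `x`. -/
noncomputable def curvature (cov : AffineConnection k M)
    (X Y Z : Π x : M, TangentSpace (𝓡 k) x) (x : M) : TangentSpace (𝓡 k) x :=
  cov (fun y ↦ cov Z y (Y y)) x (X x) - cov (fun y ↦ cov Z y (X y)) x (Y x)
    - cov Z x (VectorField.mlieBracket (𝓡 k) X Y x)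

/-- Extension of a tangent vector to a vector field with constant components in the preferred
coordinates around `x` (in particular, smooth near `x`). -/
noncomputable def extendVector {x : M} (v : TangentSpace (𝓡 k) x) :
    Π y : M, TangentSpace (𝓡 k) y :=
  FiberBundle.extend (EuclideanSpace ℝ (Fin k)) v

/-- A basis of the tangent space `T_x M`. -/
noncomputable def tangentBasis (x : M) : Module.Basis (Fin k) ℝ (TangentSpace (𝓡 k) x) :=
  (EuclideanSpace.basisFun (Fin k) ℝ).toBasis

/-- The Ricci tensor `Ric(v, w) = tr (u ↦ R(u, v) w)` of a connection; the curvature being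
tensorial, it does not depend on the basis and on the extensions used. -/
noncomputable def ricci (cov : AffineConnection k M) (x : M) (v w : TangentSpace (𝓡 k) x) : ℝ :=
  ∑ i, (tangentBasis x).repr
    (curvature cov (extendVector (tangentBasis x i)) (extendVector v) (extendVector w) x) i

/-- The Ricci curvature of the metric `g` is the field `ρ` of `(0, 2)`-tensors. -/
def HasRicciCurvature (g : SmoothMetric k M)
    (ρ : ∀ x : M, TangentSpace (𝓡 k) x → TangentSpace (𝓡 k) x → ℝ) : Prop :=
  ∃ cov : AffineConnection k M, IsLeviCivita g cov ∧ ∀ x v w, ricci cov x v w = ρ x v w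

/-- The trace `tr_g T = ∑ g^{ij} T_{ij}` of `T` with respect to `g`, at the point `x`. -/
noncomputable def metricTrace (g T : SmoothMetric k M) (x : M) : ℝ :=
  ((Matrix.of fun i j ↦ g.inner x (tangentBasis x i) (tangentBasis x j))⁻¹ *
    Matrix.of fun i j ↦ T.inner x (tangentBasis x i) (tangentBasis x j)).trace

/-- The metric `g` is invariant under the action of `G` on `M`. -/
def IsInvariantMetric (G : Type*) [SMul G M] (g : SmoothMetric k M) : Prop :=
  ∀ (a : G) (x : M) (v w : TangentSpace (𝓡 k) x),
    g.inner (a • x) (mfderiv (𝓡 k) (𝓡 k) (fun y : M ↦ a • y) x v)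
      (mfderiv (𝓡 k) (𝓡 k) (fun y : M ↦ a • y) x w) = g.inner x v w

end Riemannian

/-! ### Structure constants -/

section StructureConstants

variable {L : Type*} [LieRing L] [LieAlgebra ℝ L]

/-- `e` is a basis of the subspace `U`, orthonormal with respect to minus the Killing form. -/
def IsOrthonormalBasisOf (U : Submodule ℝ L) {r : ℕ} (e : Fin r → L) : Prop :=
  Submodule.span ℝ (Set.range e) = U ∧
    ∀ a b, -killingForm ℝ L (e a) (e b) = if a = b then 1 else 0

/-- With `Q = -B` and `e i` a `Q`-orthonormal basis of `𝔪 i`, this is the squared norm `[123]`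
of the tensor `(X, Y) ↦ π_{𝔪 0} ⁅X, Y⁆`, `X ∈ 𝔪 1`, `Y ∈ 𝔪 2`. -/
noncomputable def structureConstant123 {d : Fin 3 → ℕ} (e : ∀ i, Fin (d i) → L) : ℝ :=
  ∑ a, ∑ b, ∑ c, (-killingForm ℝ L ⁅e 1 b, e 2 c⁆ (e 0 a)) ^ 2

end StructureConstants

/-! ### Generalised Wallach spaces -/

section Homogeneous

variable {n : ℕ} {G : Type*} [TopologicalSpace G] [ChartedSpace (EuclideanSpace ℝ (Fin n)) G]
  [Group G]

/-- The adjoint representation `Ad a = d(x ↦ a x a⁻¹)` at the identity. -/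
noncomputable def adjointRep (a : G) (X : GroupLieAlgebra (𝓡 n) G) : GroupLieAlgebra (𝓡 n) G :=
  (mfderiv (𝓡 n) (𝓡 n) (fun x : G ↦ a * x * a⁻¹) 1 :
    EuclideanSpace ℝ (Fin n) →L[ℝ] EuclideanSpace ℝ (Fin n)) X

/-- `U` is invariant under `Ad(H)`. -/
def IsAdInvariant (H : Subgroup G) (U : Submodule ℝ (GroupLieAlgebra (𝓡 n) G)) : Prop :=
  ∀ a ∈ H, ∀ X ∈ U, adjointRep a X ∈ U

/-- `U` is a non-zero `Ad(H)`-invariant subspace on which `Ad(H)` acts irreducibly. -/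
def IsAdIrreducible (H : Subgroup G) (U : Submodule ℝ (GroupLieAlgebra (𝓡 n) G)) : Prop :=
  IsAdInvariant H U ∧ U ≠ ⊥ ∧ ∀ V ≤ U, IsAdInvariant H V → V = ⊥ ∨ V = U

/-- The representations `Ad(H)|_U` and `Ad(H)|_V` are equivalent. -/
def AreAdEquivalent (H : Subgroup G) (U V : Submodule ℝ (GroupLieAlgebra (𝓡 n) G)) : Prop :=
  ∃ φ : U ≃ₗ[ℝ] V, ∀ a ∈ H, ∀ X Y : U, adjointRep a (X : GroupLieAlgebra (𝓡 n) G) = Y →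
    adjointRep a (φ X : GroupLieAlgebra (𝓡 n) G) = φ Y

/-- The differential at the identity of the projection `G → G ⧸ H`. -/
noncomputable def dproj {k : ℕ} (H : Subgroup G)
    [ChartedSpace (EuclideanSpace ℝ (Fin k)) (G ⧸ H)] :
    GroupLieAlgebra (𝓡 n) G →L[ℝ] TangentSpace (𝓡 k) ((1 : G) : G ⧸ H) :=
  mfderiv (𝓡 n) (𝓡 k) (fun a : G ↦ (a : G ⧸ H)) 1

/-- The Lie algebra `𝔥` of `H`, that is, the tangent space at the identity of the fibre `H` of the
submersion `G → G ⧸ H`. -/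
noncomputable def subgroupLieAlgebra (k : ℕ) (H : Subgroup G)
    [ChartedSpace (EuclideanSpace ℝ (Fin k)) (G ⧸ H)] :
    Submodule ℝ (GroupLieAlgebra (𝓡 n) G) :=
  LinearMap.ker (dproj (n := n) (k := k) H).toLinearMap

/-- `G ⧸ H` is a generalised Wallach space with isotropy summands `𝔪 0`, `𝔪 1`, `𝔪 2`: the compact
connected Lie group `G` is semisimple, `H` is closed and connected, and the complement of `𝔥`
orthogonal with respect to the Killing form is the orthogonal sum of three `Ad(H)`-invariant
`Ad(H)`-irreducible subspaces with `⁅𝔪 i, 𝔪 i⁆ ⊆ 𝔥`.  The smooth structure on `G ⧸ H` is the usual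
one, i.e. the unique one for which the projection is a smooth submersion. -/
structure IsGeneralisedWallachSpace {k : ℕ} [LieGroup (𝓡 n) ∞ G] (H : Subgroup G)
    [ChartedSpace (EuclideanSpace ℝ (Fin k)) (G ⧸ H)] [IsManifold (𝓡 k) ∞ (G ⧸ H)]
    (𝔪 : Fin 3 → Submodule ℝ (GroupLieAlgebra (𝓡 n) G)) : Prop where
  hausdorff : T2Space G
  compact : CompactSpace G
  connected : ConnectedSpace G
  semisimple : LieAlgebra.IsSemisimple ℝ (GroupLieAlgebra (𝓡 n) G)
  isClosed : IsClosed (H : Set G)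
  isConnected : IsConnected (H : Set G)
  submersion : Manifold.IsSubmersion (𝓡 n) (𝓡 k) ∞ (fun a : G ↦ (a : G ⧸ H))
  irreducible : ∀ i, IsAdIrreducible H (𝔪 i)
  orthogonal : ∀ i j, i ≠ j → ∀ X ∈ 𝔪 i, ∀ Y ∈ 𝔪 j,
    killingForm ℝ (GroupLieAlgebra (𝓡 n) G) X Y = 0
  iSup_eq : ∀ X, X ∈ ⨆ i, 𝔪 i ↔
    ∀ Y ∈ subgroupLieAlgebra k H, killingForm ℝ (GroupLieAlgebra (𝓡 n) G) X Y = 0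
  lie_mem : ∀ i, ∀ X ∈ 𝔪 i, ∀ Y ∈ 𝔪 i, ⁅X, Y⁆ ∈ subgroupLieAlgebra k H

end Homogeneous

/-!
The solution is sought among the diagonal invariant metrics, which are given by
`x 0 * Q ⊕ x 1 * Q ⊕ x 2 * Q` on `m 0 ⊕ m 1 ⊕ m 2`, where `Q` is minus the Killing form and
`x i > 0`.  On a compact group with semisimple Lie algebra `Q` is positive definite, by averaging an inner
product over the group (`negKilling_pos`).

*The Ricci tensor.*  A vector field on `G ⧸ H` is represented by an `H`-equivariant function on `G`
with values in `m = m 0 ⊕ m 1 ⊕ m 2` (`liftField`).  In these terms the Levi-Civita connection of a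
diagonal metric is the derivative along left-invariant vector fields, corrected by Nomizu's bilinear
map (`nomizuMap`, `isLeviCivita_diagonalConnection`).  Its curvature is then an algebraic expression
in the Nomizu map and the Lie bracket (`curvature_diagonalConnection`), because derivatives of
equivariant functions in the directions of the Lie algebra `h` of `H` are Lie brackets
(`leftDeriv_of_equivariant`).  The decomposition of the Lie algebra into `h`, `m 0`, `m 1`, `m 2` is
a grading by the Klein four-group, which makes the Ricci tensor diagonal (`nomizuRicci_of_ne`).  On
each summand the bilinear forms occurring in it are multiples of `Q` by Schur's lemma
(`casimirForm_schur`), and a trace computation identifies the factors (`nomizuRicci_eq`): with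
`A = [123]`, the Ricci tensor is, on `m i`, the multiple
`1 / 2 + A / d i * (x i ^ 2 - x (i + 1) ^ 2 - x (i + 2) ^ 2) / (2 * x (i + 1) * x (i + 2))` of `Q`.

*The algebraic system.*  In the variables `y i = 1 / x i`, the trace condition is the equation
`∑ d i * z i * y i = 1` of a simplex, and the equation `Ric = c T` says that `y` is a critical point
on this simplex of the scalar curvature (`wallachScalar`) with Lagrange multiplier `c`.  As the
scalar curvature is homogeneous of degree one, `c` is its value at `y`.  Near the boundary of the
simplex, the scalar curvature tends to `-∞` except at the vertices, where its upper limits are the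
numbers `(d i - 2 * A) / (2 * d i * z i)`.  The inequality of the theorem expresses that it
increases from the vertex with the largest of these numbers into the interior
(`exists_vertex_lt_wallachScalar`).  Hence it exceeds all of its limits at the boundary somewhere,
and attains its maximum (`exists_max_wallachScalar`).  This maximum is positive since `2 * A ≤ d i`
(`two_mul_structureConstant_le`), again from the trace formula for the Killing form.
-/

/-! ### The scalar curvature of diagonal metrics as a function of the parameters -/

/-- The scalar curvature of a diagonal metric on a generalised Wallach space, as a function of the
inverses `y i` of the metric parameters; `A` stands for the structure constant `[123]`. -/
noncomputable def wallachScalar (d : Fin 3 → ℝ) (A : ℝ) (y : Fin 3 → ℝ) : ℝ :=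
  1 / 2 * ∑ i, d i * y i - A / 2 * ∑ i, y (i + 1) * y (i + 2) / y i

lemma sum_fin_three_cyclic (f : Fin 3 → ℝ) (i : Fin 3) :
    ∑ j, f j = f i + f (i + 1) + f (i + 2) := by
  rw [Fin.sum_univ_three]
  fin_cases i <;> simp <;> ring_nf

lemma wallachScalar_eq (d : Fin 3 → ℝ) (A : ℝ) (y : Fin 3 → ℝ) (i : Fin 3) :
    wallachScalar d A y = 1 / 2 * (d i * y i + d (i + 1) * y (i + 1) + d (i + 2) * y (i + 2)) -
      A / 2 * (y (i + 1) * y (i + 2) / y i + y (i + 2) * y i / y (i + 1) +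
        y i * y (i + 1) / y (i + 2)) := by
  have h1 : i + 1 + 1 = i + 2 := by rw [add_assoc]; rfl
  have h2 : i + 1 + 2 = i := by rw [add_assoc]; exact add_zero i
  have h3 : i + 2 + 1 = i := by rw [add_assoc]; exact add_zero i
  have h4 : i + 2 + 2 = i + 1 := by rw [add_assoc]; rfl
  rw [wallachScalar, sum_fin_three_cyclic _ i, sum_fin_three_cyclic _ i, h1, h2, h3, h4]

/-- Homogeneity of degree one. -/
lemma wallachScalar_smul (d : Fin 3 → ℝ) (A : ℝ) (y : Fin 3 → ℝ) {t : ℝ} (ht : t ≠ 0) :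
    wallachScalar d A (fun i ↦ t * y i) = t * wallachScalar d A y := by
  simp only [wallachScalar, mul_sub, Finset.mul_sum]
  congr 1
  · exact Finset.sum_congr rfl fun i _ ↦ by ring
  · refine Finset.sum_congr rfl fun i _ ↦ ?_
    rw [show t * y (i + 1) * (t * y (i + 2)) = t * (t * (y (i + 1) * y (i + 2))) by ring,
      mul_div_mul_left _ _ ht]
    ring

lemma two_le_div_add_div {a b : ℝ} (ha : 0 < a) (hb : 0 < b) : 2 ≤ a / b + b / a := by
  rw [div_add_div _ _ hb.ne' ha.ne', le_div_iff₀ (by positivity)]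
  nlinarith [sq_nonneg (a - b)]

/-- Near the `i`-th vertex of the simplex `∑ d i * z i * y i = 1` the scalar curvature is at most
about `(d i - 2 * A) / (2 * d i * z i)`, the largest limit which it can have there. -/
lemma wallachScalar_le_vertex {d z y : Fin 3 → ℝ} {A V : ℝ} (hd : ∀ i, 0 < d i)
    (hz : ∀ i, 0 < z i) (hA : 0 < A) (hV0 : 0 ≤ V) (hV : ∀ i, (d i - 2 * A) / (2 * d i * z i) ≤ V)
    (hy : ∀ i, 0 < y i) (hy1 : ∑ i, d i * z i * y i = 1) (i : Fin 3) :
    wallachScalar d A y ≤ V + 1 / 2 * (d (i + 1) * y (i + 1) + d (i + 2) * y (i + 2)) := by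
  have h1 : 2 * y i ≤ y (i + 2) * y i / y (i + 1) + y i * y (i + 1) / y (i + 2) := by
    have := mul_le_mul_of_nonneg_left (two_le_div_add_div (hy (i + 2)) (hy (i + 1))) (hy i).le
    calc 2 * y i = y i * 2 := by ring
      _ ≤ _ := this
      _ = _ := by ring
  have h2 : 0 < y (i + 1) * y (i + 2) / y i :=
    div_pos (mul_pos (hy _) (hy _)) (hy _)
  have h3 : d i * z i * y i ≤ 1 := by
    rw [← hy1]
    exact Finset.single_le_sum (f := fun i ↦ d i * z i * y i)
      (fun j _ ↦ (mul_pos (mul_pos (hd j) (hz j)) (hy j)).le) (Finset.mem_univ i)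
  have h4 : d i - 2 * A ≤ V * (2 * d i * z i) :=
    (div_le_iff₀ (mul_pos (mul_pos two_pos (hd i)) (hz i))).1 (hV i)
  have h5 : 1 / 2 * (d i - 2 * A) * y i ≤ V := by
    calc 1 / 2 * (d i - 2 * A) * y i ≤ 1 / 2 * (V * (2 * d i * z i)) * y i := by
          have := (hy i).le
          gcongr
      _ = V * (d i * z i * y i) := by ring
      _ ≤ V * 1 := by gcongr
      _ = V := mul_one V
  rw [wallachScalar_eq d A y i]
  nlinarith [mul_le_mul_of_nonneg_left h1 hA.le, mul_pos hA h2]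

/-- The scalar curvature tends to `-∞` if `y i` tends to zero while the two other parameters stay
away from zero. -/
lemma wallachScalar_le_face {d y : Fin 3 → ℝ} {A : ℝ} (hA : 0 < A) (hy : ∀ i, 0 < y i)
    (i : Fin 3) :
    wallachScalar d A y ≤ 1 / 2 * ∑ j, d j * y j - A / 2 * (y (i + 1) * y (i + 2) / y i) := by
  rw [wallachScalar]
  have := Finset.single_le_sum (f := fun i ↦ y (i + 1) * y (i + 2) / y i)
      (fun j _ ↦ (div_pos (mul_pos (hy _) (hy _)) (hy j)).le) (Finset.mem_univ i)
  gcongr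

/-- The inequality of the theorem says that the scalar curvature increases from the best vertex
of the simplex into its interior. -/
lemma exists_vertex_lt_wallachScalar {d z : Fin 3 → ℝ} {A : ℝ} (hd : ∀ i, 0 < d i)
    (hz : ∀ i, 0 < z i) (hA : 0 < A) (p : Fin 3)
    (hcond : (d p - 2 * A) * (d (p + 1) * z (p + 1) + d (p + 2) * z (p + 2)) <
      (d (p + 1) + d (p + 2)) * (d p * z p)) :
    ∃ y : Fin 3 → ℝ, (∀ i, 0 < y i) ∧ ∑ i, d i * z i * y i = 1 ∧
      (d p - 2 * A) / (2 * d p * z p) < wallachScalar d A y := by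
  set V := (d p - 2 * A) / (2 * d p * z p) with hV
  set m := d (p + 1) * z (p + 1) + d (p + 2) * z (p + 2) with hm
  set D := d (p + 1) + d (p + 2)
  have hw : 0 < d p * z p := mul_pos (hd p) (hz p)
  have hdp := (hd p).ne'
  have hzp := (hz p).ne'
  have hm0 : 0 < m := add_pos (mul_pos (hd _) (hz _)) (mul_pos (hd _) (hz _))
  have hVw : V * (2 * (d p * z p)) = d p - 2 * A := by
    rw [hV]; field_simp
  have hδ : 0 < D / 2 - V * m := by
    have : 0 < (D / 2 - V * m) * (2 * (d p * z p)) := by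
      calc 0 < D * (d p * z p) - (d p - 2 * A) * m := by linarith
        _ = _ := by rw [← hVw]; ring
    exact pos_of_mul_pos_left this (by positivity)
  obtain ⟨t, ht0, ht1, ht2⟩ : ∃ t : ℝ, 0 < t ∧ t * m ≤ 1 / 2 ∧
      t * (A * (d p * z p)) < D / 2 - V * m := by
    refine ⟨min (1 / (2 * m)) ((D / 2 - V * m) / (2 * (A * (d p * z p)))), by positivity, ?_, ?_⟩
    · calc _ ≤ 1 / (2 * m) * m := by gcongr; exact min_le_left _ _
        _ = 1 / 2 := by field_simp
    · calc _ ≤ (D / 2 - V * m) / (2 * (A * (d p * z p))) * (A * (d p * z p)) := by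
            gcongr; exact min_le_right _ _
        _ = (D / 2 - V * m) / 2 := by field_simp
        _ < _ := by linarith
  -- The point with `p`-th coordinate `u` and the two others equal to `t`: moving away from the
  -- vertex, the scalar curvature is `V + t * (D / 2 - V * m) + O(t ^ 2)`.
  set u := (1 - t * m) / (d p * z p) with hu
  have hu0 : 0 < u := div_pos (by linarith) hw
  have huw : d p * z p * u = 1 - t * m := by rw [hu]; field_simp
  let y : Fin 3 → ℝ := fun i ↦ if i = p then u else t
  have e0 : y p = u := by simp [y]
  have e1 : y (p + 1) = t := by simp [y]
  have e2 : y (p + 2) = t := by simp [y]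
  refine ⟨y, fun i ↦ ?_, ?_, ?_⟩
  · dsimp only [y]; split_ifs <;> assumption
  · rw [sum_fin_three_cyclic _ p, e0, e1, e2, huw, hm]; ring
  · have hA2 : A / 2 * (t * t / u) ≤ t * (t * (A * (d p * z p))) := by
      have : 1 / u ≤ 2 * (d p * z p) := by
        rw [div_le_iff₀ hu0]
        nlinarith
      calc A / 2 * (t * t / u) = A / 2 * t * t * (1 / u) := by ring
        _ ≤ A / 2 * t * t * (2 * (d p * z p)) := by gcongr
        _ = _ := by ring
    have hS : wallachScalar d A y = V + t * (D / 2 - V * m) - A / 2 * (t * t / u) := by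
      rw [wallachScalar_eq d A y p, e0, e1, e2]
      have : 1 / 2 * (d p - 2 * A) * u = V * (1 - t * m) := by
        rw [← hVw, ← huw]; ring
      have h3 : t * u / t = u := by field_simp
      have h4 : u * t / t = u := by field_simp
      rw [h3, h4]
      linear_combination this
    rw [hS]
    nlinarith [mul_lt_mul_of_pos_left ht2 ht0]

/-- The scalar curvature attains its maximum over the open simplex `∑ d i * z i * y i = 1`. -/
lemma exists_max_wallachScalar {d z : Fin 3 → ℝ} {A V : ℝ} (hd : ∀ i, 0 < d i)
    (hz : ∀ i, 0 < z i) (hA : 0 < A) (hV0 : 0 ≤ V) (hV : ∀ i, (d i - 2 * A) / (2 * d i * z i) ≤ V)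
    {y₀ : Fin 3 → ℝ} (hy₀ : ∀ i, 0 < y₀ i) (hy₀1 : ∑ i, d i * z i * y₀ i = 1)
    (hy₀V : V < wallachScalar d A y₀) :
    ∃ y : Fin 3 → ℝ, (∀ i, 0 < y i) ∧ ∑ i, d i * z i * y i = 1 ∧ V < wallachScalar d A y ∧
      ∀ w : Fin 3 → ℝ, (∀ i, 0 < w i) → ∑ i, d i * z i * w i = 1 →
        wallachScalar d A w ≤ wallachScalar d A y := by
  set σ := wallachScalar d A y₀
  set D := ∑ i, d i with hD
  have hD0 : 0 < D := Finset.sum_pos (fun i _ ↦ hd i) Finset.univ_nonempty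
  set C := 1 / 2 * ∑ i, 1 / z i with hC
  have hC0 : 0 < C := mul_pos (by norm_num)
    (Finset.sum_pos (fun i _ ↦ one_div_pos.2 (hz i)) Finset.univ_nonempty)
  set η := 2 * (σ - V) / D with hη
  have hη0 : 0 < η := div_pos (by linarith) hD0
  set ε := min η (A * η ^ 2 / (2 * C)) with hε
  have hε0 : 0 < ε := lt_min hη0 (by positivity)
  have upper : ∀ y : Fin 3 → ℝ, (∀ i, 0 < y i) → ∑ i, d i * z i * y i = 1 →
      ∀ i, y i ≤ 1 / (d i * z i) := fun y hy hy1 i ↦ by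
    rw [le_div_iff₀ (mul_pos (hd i) (hz i)), ← hy1, mul_comm]
    exact Finset.single_le_sum (f := fun i ↦ d i * z i * y i)
      (fun j _ ↦ (mul_pos (mul_pos (hd j) (hz j)) (hy j)).le) (Finset.mem_univ i)
  -- superlevel sets stay away from the boundary of the simplex
  have lower : ∀ y : Fin 3 → ℝ, (∀ i, 0 < y i) → ∑ i, d i * z i * y i = 1 →
      σ ≤ wallachScalar d A y → ∀ i, ε ≤ y i := by
    intro y hy hy1 hσ
    -- away from the vertices, two coordinates cannot both be small
    have two : ∀ i, η ≤ y (i + 1) ∨ η ≤ y (i + 2) := by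
      intro i
      by_contra! hcon
      have h1 := wallachScalar_le_vertex hd hz hA hV0 hV hy hy1 i
      have h2 : d (i + 1) * y (i + 1) + d (i + 2) * y (i + 2) < D * η := by
        rw [hD, sum_fin_three_cyclic _ i]
        nlinarith [mul_lt_mul_of_pos_left hcon.1 (hd (i + 1)),
          mul_lt_mul_of_pos_left hcon.2 (hd (i + 2)), mul_pos (hd i) hη0]
      have h3 : D * η = 2 * (σ - V) := by rw [hη]; field_simp
      linarith
    intro i
    by_cases hi : η ≤ y i
    · exact (min_le_left _ _).trans hi
    have h1 : η ≤ y (i + 1) := by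
      have := two (i + 2)
      rw [show i + 2 + 1 = i by rw [add_assoc]; exact add_zero i,
        show i + 2 + 2 = i + 1 by rw [add_assoc]; rfl] at this
      exact this.resolve_left hi
    have h2 : η ≤ y (i + 2) := by
      have := two (i + 1)
      rw [show i + 1 + 2 = i by rw [add_assoc]; exact add_zero i,
        show i + 1 + 1 = i + 2 by rw [add_assoc]; rfl] at this
      exact this.resolve_right hi
    -- if only the `i`-th coordinate is small, the term with denominator `y i` dominates
    have h3 := wallachScalar_le_face (d := d) hA hy i
    have h4 : 1 / 2 * ∑ j, d j * y j ≤ C := by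
      rw [hC]
      gcongr with j
      rw [le_div_iff₀ (hz j)]
      have := upper y hy hy1 j
      rw [le_div_iff₀ (mul_pos (hd j) (hz j))] at this
      linarith
    have h5 : A / 2 * (η * η / y i) ≤ C := by
      have : η * η / y i ≤ y (i + 1) * y (i + 2) / y i := by
        have := (hy i).le
        have := (hy (i + 1)).le
        gcongr
      nlinarith
    refine (min_le_right _ _).trans ?_
    rw [div_le_iff₀ (by positivity)]
    rw [← mul_div_assoc, div_le_iff₀ (hy i)] at h5
    nlinarith
  let K : Set (Fin 3 → ℝ) := Set.Icc (fun _ ↦ ε) (fun i ↦ 1 / (d i * z i)) ∩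
    {y | ∑ i, d i * z i * y i = 1}
  have hK : IsCompact K := by
    refine isCompact_Icc.inter_right ?_
    refine isClosed_eq ?_ continuous_const
    fun_prop
  have hKpos : ∀ y ∈ K, ∀ i, 0 < y i := fun y hy i ↦ hε0.trans_le (hy.1.1 i)
  have hcont : ContinuousOn (wallachScalar d A) K := by
    unfold wallachScalar
    refine ContinuousOn.sub (by fun_prop) (ContinuousOn.mul continuousOn_const ?_)
    refine continuousOn_finsetSum _ fun i _ ↦ ?_
    exact ContinuousOn.div (by fun_prop) (by fun_prop) fun y hy ↦ (hKpos y hy i).ne'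
  have mem : ∀ y : Fin 3 → ℝ, (∀ i, 0 < y i) → ∑ i, d i * z i * y i = 1 →
      σ ≤ wallachScalar d A y → y ∈ K := fun y hy hy1 hσ ↦
    ⟨⟨fun i ↦ lower y hy hy1 hσ i, fun i ↦ upper y hy hy1 i⟩, hy1⟩
  obtain ⟨y, hyK, hy⟩ := hK.exists_isMaxOn ⟨y₀, mem y₀ hy₀ hy₀1 le_rfl⟩ hcont
  have hσy : σ ≤ wallachScalar d A y := hy (mem y₀ hy₀ hy₀1 le_rfl)
  refine ⟨y, hKpos y hyK, hyK.2, hy₀V.trans_le hσy, fun w hw hw1 ↦ ?_⟩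
  by_cases hσw : σ ≤ wallachScalar d A w
  · exact hy (mem w hw hw1 hσw)
  · exact (not_le.1 hσw).le.trans hσy

/-- A critical point of the scalar curvature on the simplex solves the algebraic form of the
prescribed Ricci curvature equation; the Lagrange multiplier is the maximal value. -/
lemma wallachScalar_crit {d z y : Fin 3 → ℝ} {A : ℝ} (hd : ∀ i, 0 < d i)
    (hz : ∀ i, 0 < z i) (hy : ∀ i, 0 < y i) (hy1 : ∑ i, d i * z i * y i = 1)
    (hmax : ∀ w : Fin 3 → ℝ, (∀ i, 0 < w i) → ∑ i, d i * z i * w i = 1 →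
        wallachScalar d A w ≤ wallachScalar d A y) (i : Fin 3) :
    d i / 2 + A / 2 * (y (i + 1) * y (i + 2) / y i ^ 2 - y (i + 2) / y (i + 1) -
      y (i + 1) / y (i + 2)) = wallachScalar d A y * (d i * z i) := by
  set c := wallachScalar d A y
  -- By homogeneity the maximum over the simplex gives an inequality for all positive vectors, with
  -- equality at `y`, so that single coordinates can be varied.
  have hom : ∀ w : Fin 3 → ℝ, (∀ i, 0 < w i) →
      wallachScalar d A w ≤ c * ∑ i, d i * z i * w i := by
    intro w hw
    set l := ∑ i, d i * z i * w i with hl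
    have hl0 : 0 < l := Finset.sum_pos (fun i _ ↦ mul_pos (mul_pos (hd i) (hz i)) (hw i))
      Finset.univ_nonempty
    have := hmax (fun i ↦ l⁻¹ * w i) (fun i ↦ mul_pos (inv_pos.2 hl0) (hw i)) (by
      simp only [mul_left_comm _ l⁻¹, ← Finset.mul_sum]
      exact inv_mul_cancel₀ hl0.ne')
    rw [wallachScalar_smul _ _ _ (inv_ne_zero hl0.ne'), inv_mul_le_iff₀ hl0] at this
    linarith
  let φ : ℝ → ℝ := fun t ↦
    1 / 2 * (d i * t + d (i + 1) * y (i + 1) + d (i + 2) * y (i + 2)) -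
      A / 2 * (y (i + 1) * y (i + 2) * t⁻¹ + y (i + 2) * t / y (i + 1) +
        t * y (i + 1) / y (i + 2)) - c * (d i * z i * t + d (i + 1) * z (i + 1) * y (i + 1) +
        d (i + 2) * z (i + 2) * y (i + 2))
  have hφ : ∀ t, 0 < t → φ t ≤ 0 := by
    intro t ht
    let w : Fin 3 → ℝ := fun j ↦ if j = i then t else y j
    have e0 : w i = t := by simp [w]
    have e1 : w (i + 1) = y (i + 1) := by simp [w]
    have e2 : w (i + 2) = y (i + 2) := by simp [w]
    have := hom w fun j ↦ by dsimp only [w]; split_ifs; exacts [ht, hy j]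
    rw [wallachScalar_eq _ _ _ i, sum_fin_three_cyclic _ i, e0, e1, e2] at this
    simp only [φ, ← div_eq_mul_inv]
    linarith
  have hφ0 : φ (y i) = 0 := by
    have h1 := wallachScalar_eq d A y i
    have h2 := sum_fin_three_cyclic (fun i ↦ d i * z i * y i) i
    rw [hy1] at h2
    simp only [φ, ← div_eq_mul_inv]
    rw [← h1, ← h2]
    simp [c]
  have hloc : IsLocalMax φ (y i) := by
    filter_upwards [lt_mem_nhds (hy i)] with t ht
    rw [hφ0]
    exact hφ t ht
  have hder : HasDerivAt φ (1 / 2 * (d i * 1) -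
      A / 2 * (y (i + 1) * y (i + 2) * -((y i) ^ 2)⁻¹ + y (i + 2) * 1 / y (i + 1) +
        1 * y (i + 1) / y (i + 2)) - c * (d i * z i * 1)) (y i) := by
    have hid := hasDerivAt_id' (y i)
    have h1 := (((hid.const_mul (d i)).add_const (d (i + 1) * y (i + 1))).add_const
      (d (i + 2) * y (i + 2))).const_mul (1 / 2)
    have h2 := ((((hasDerivAt_inv (hy i).ne').const_mul (y (i + 1) * y (i + 2))).add
      ((hid.const_mul (y (i + 2))).div_const (y (i + 1)))).add
      ((hid.mul_const (y (i + 1))).div_const (y (i + 2)))).const_mul (A / 2)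
    have h3 := (((hid.const_mul (d i * z i)).add_const
      (d (i + 1) * z (i + 1) * y (i + 1))).add_const
      (d (i + 2) * z (i + 2) * y (i + 2))).const_mul c
    exact (h1.sub h2).sub h3
  have := hloc.hasDerivAt_eq_zero hder
  rw [div_eq_mul_inv (y (i + 1) * y (i + 2))]
  linear_combination this

/-- Solvability of the algebraic system to which the prescribed Ricci curvature problem reduces.
The solution is `x i = 1 / y i` for a maximum point `y` of the scalar curvature on the simplex
`∑ d i * z i * y i = 1`, and `c` is the maximal value. -/
theorem exists_wallach_parameters {d z : Fin 3 → ℝ} {A : ℝ} (hd : ∀ i, 0 < d i)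
    (hz : ∀ i, 0 < z i) (hA : 0 < A) (hAd : ∀ i, 2 * A ≤ d i) (p : Fin 3)
    (hp : ∀ i, (d i - 2 * A) / (2 * d i * z i) ≤ (d p - 2 * A) / (2 * d p * z p))
    (hcond : (d p - 2 * A) * ∑ i ∈ Finset.univ.erase p, d i * z i <
      ((∑ i, d i) - d p) * (d p * z p)) :
    ∃ x : Fin 3 → ℝ, (∀ i, 0 < x i) ∧ ∑ i, d i * (z i / x i) = 1 ∧ ∃ c : ℝ, 0 < c ∧
      ∀ i, 1 / 2 + A / d i * ((x i ^ 2 - x (i + 1) ^ 2 - x (i + 2) ^ 2) /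
        (2 * x (i + 1) * x (i + 2))) = c * z i := by
  have hV0 : 0 ≤ (d p - 2 * A) / (2 * d p * z p) :=
    div_nonneg (by linarith [hAd p]) (mul_pos (mul_pos two_pos (hd p)) (hz p)).le
  have hsum : ∑ i ∈ Finset.univ.erase p, d i * z i =
      d (p + 1) * z (p + 1) + d (p + 2) * z (p + 2) := by
    have h1 := Finset.add_sum_erase Finset.univ (fun i ↦ d i * z i) (Finset.mem_univ p)
    have h2 := sum_fin_three_cyclic (fun i ↦ d i * z i) p
    linarith
  rw [hsum, sum_fin_three_cyclic _ p, add_assoc, add_sub_cancel_left] at hcond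
  obtain ⟨y₀, hy₀, hy₀1, hy₀V⟩ := exists_vertex_lt_wallachScalar hd hz hA p hcond
  obtain ⟨y, hy, hy1, hyV, hmax⟩ := exists_max_wallachScalar hd hz hA hV0 hp hy₀ hy₀1 hy₀V
  refine ⟨fun i ↦ (y i)⁻¹, fun i ↦ inv_pos.2 (hy i), ?_, wallachScalar d A y,
    hV0.trans_lt hyV, fun i ↦ ?_⟩
  · rw [← hy1]
    refine Finset.sum_congr rfl fun i _ ↦ ?_
    rw [div_inv_eq_mul, mul_assoc]
  · have h := wallachScalar_crit hd hz hy hy1 hmax i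
    have h0 := (hy i).ne'
    have h1 := (hy (i + 1)).ne'
    have h2 := (hy (i + 2)).ne'
    have h3 := (hd i).ne'
    have e : ((y i)⁻¹ ^ 2 - (y (i + 1))⁻¹ ^ 2 - (y (i + 2))⁻¹ ^ 2) /
        (2 * (y (i + 1))⁻¹ * (y (i + 2))⁻¹) = 1 / 2 * (y (i + 1) * y (i + 2) / y i ^ 2 -
        y (i + 2) / y (i + 1) - y (i + 1) / y (i + 2)) := by
      field_simp
    rw [e, ← mul_right_inj' h3]
    calc _ = d i / 2 + A / 2 * (y (i + 1) * y (i + 2) / y i ^ 2 - y (i + 2) / y (i + 1) -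
      y (i + 1) / y (i + 2)) := by field_simp
      _ = _ := by rw [h]; ring

/-! ### Wallach decompositions of a Lie algebra -/

section WallachAlgebra

variable {L : Type*} [LieRing L] [LieAlgebra ℝ L]

/-- Minus the Killing form of a real Lie algebra. -/
noncomputable def negKilling (L : Type*) [LieRing L] [LieAlgebra ℝ L] :
    LinearMap.BilinForm ℝ L := -killingForm ℝ L

lemma negKilling_apply (X Y : L) : negKilling L X Y = -killingForm ℝ L X Y := rfl

lemma negKilling_comm (X Y : L) : negKilling L X Y = negKilling L Y X := by
  rw [negKilling_apply, negKilling_apply, LieModule.traceForm_comm]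

lemma negKilling_lie (X Y Z : L) : negKilling L ⁅X, Y⁆ Z = negKilling L X ⁅Y, Z⁆ := by
  rw [negKilling_apply, negKilling_apply, LieModule.traceForm_apply_lie_apply]

lemma negKilling_lie' (X Y Z : L) : negKilling L ⁅X, Y⁆ Z = -negKilling L Y ⁅X, Z⁆ := by
  rw [negKilling_apply, negKilling_apply, LieModule.traceForm_apply_lie_apply']

/-- The algebraic content of a generalised Wallach space: `L = h ⊕ m 0 ⊕ m 1 ⊕ m 2` is an
orthogonal decomposition for minus the Killing form, which is positive definite, `⁅h, m i⁆ ⊆ m i`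
and `⁅m i, m i⁆ ⊆ h`; orthonormal bases `e i` of the `m i` are part of the data. -/
structure IsWallachDecomposition (h : Submodule ℝ L) (m : Fin 3 → Submodule ℝ L) {d : Fin 3 → ℕ}
    (e : ∀ i, Fin (d i) → L) : Prop where
  pos : ∀ X, X ≠ 0 → 0 < negKilling L X X
  basis : ∀ i, IsOrthonormalBasisOf (m i) (e i)
  orthogonal : ∀ i j, i ≠ j → ∀ X ∈ m i, ∀ Y ∈ m j, negKilling L X Y = 0
  mem_iSup : ∀ X, X ∈ ⨆ i, m i ↔ ∀ Y ∈ h, negKilling L X Y = 0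
  lie_mem : ∀ i, ∀ X ∈ m i, ∀ Y ∈ m i, ⁅X, Y⁆ ∈ h
  lie_h_mem : ∀ i, ∀ X ∈ h, ∀ Y ∈ m i, ⁅X, Y⁆ ∈ m i

/-- The orthogonal projection onto the span of the orthonormal vectors `e i`. -/
noncomputable def wallachProj {d : Fin 3 → ℕ} (e : ∀ i, Fin (d i) → L) (i : Fin 3) : L →ₗ[ℝ] L :=
  ∑ a, (negKilling L (e i a)).smulRight (e i a)

/-- The orthogonal projection onto `m 0 ⊕ m 1 ⊕ m 2`. -/
noncomputable def wallachProjM {d : Fin 3 → ℕ} (e : ∀ i, Fin (d i) → L) : L →ₗ[ℝ] L :=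
  ∑ i, wallachProj e i

lemma wallachProj_apply {d : Fin 3 → ℕ} (e : ∀ i, Fin (d i) → L) (i : Fin 3) (X : L) :
    wallachProj e i X = ∑ a, negKilling L (e i a) X • e i a := by
  simp [wallachProj]

lemma wallachProjM_apply {d : Fin 3 → ℕ} (e : ∀ i, Fin (d i) → L) (X : L) :
    wallachProjM e X = ∑ i, wallachProj e i X := by
  simp [wallachProjM]

/-- In `Fin 3` the index different from `i` and `j` is `-(i + j)`. -/
lemma eq_or_eq_of_ne_third : ∀ i j l : Fin 3, i ≠ j → l ≠ -(i + j) → l = i ∨ l = j := by decide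

namespace IsWallachDecomposition

variable {h : Submodule ℝ L} {m : Fin 3 → Submodule ℝ L} {d : Fin 3 → ℕ}
  {e : ∀ i, Fin (d i) → L} (W : IsWallachDecomposition h m e)

include W

lemma mem_basis (i : Fin 3) (a : Fin (d i)) : e i a ∈ m i := by
  rw [← (W.basis i).1]
  exact Submodule.subset_span ⟨a, rfl⟩

omit W in
lemma mem_iSup_of_mem (i : Fin 3) {X : L} (hX : X ∈ m i) : X ∈ ⨆ i, m i :=
  Submodule.mem_iSup_of_mem i hX

lemma orthogonal_h {i : Fin 3} {X Y : L} (hX : X ∈ m i) (hY : Y ∈ h) : negKilling L X Y = 0 :=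
  (W.mem_iSup X).1 (mem_iSup_of_mem i hX) Y hY

lemma orthogonal_h' {i : Fin 3} {X Y : L} (hX : X ∈ h) (hY : Y ∈ m i) : negKilling L X Y = 0 := by
  rw [negKilling_comm]
  exact W.orthogonal_h hY hX

lemma eq_zero_of_self {X : L} (hX : negKilling L X X = 0) : X = 0 := by
  by_contra h0
  exact (W.pos X h0).ne' hX

lemma proj_mem (i : Fin 3) (X : L) : wallachProj e i X ∈ m i := by
  rw [wallachProj_apply]
  exact Submodule.sum_mem _ fun a _ ↦ Submodule.smul_mem _ _ (W.mem_basis i a)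

lemma proj_of_mem {i : Fin 3} {X : L} (hX : X ∈ m i) : wallachProj e i X = X := by
  rw [← (W.basis i).1] at hX
  refine Submodule.span_induction ?_ (map_zero _) (fun x y _ _ hx hy ↦ by rw [map_add, hx, hy])
    (fun t x _ hx ↦ by rw [map_smul, hx]) hX
  rintro _ ⟨a, rfl⟩
  rw [wallachProj_apply]
  have : ∀ b, negKilling L (e i b) (e i a) = if b = a then 1 else 0 := fun b ↦ (W.basis i).2 b a
  simp [this]

lemma proj_of_mem_ne {i j : Fin 3} (hij : i ≠ j) {X : L} (hX : X ∈ m j) :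
    wallachProj e i X = 0 := by
  rw [wallachProj_apply]
  exact Finset.sum_eq_zero fun a _ ↦ by
    rw [W.orthogonal i j hij _ (W.mem_basis i a) X hX, zero_smul]

lemma proj_of_mem_h {i : Fin 3} {X : L} (hX : X ∈ h) : wallachProj e i X = 0 := by
  rw [wallachProj_apply]
  exact Finset.sum_eq_zero fun a _ ↦ by
    rw [W.orthogonal_h (W.mem_basis i a) hX, zero_smul]

omit W in
lemma negKilling_proj (i : Fin 3) (X Y : L) :
    negKilling L (wallachProj e i X) Y = negKilling L X (wallachProj e i Y) := by
  simp only [wallachProj_apply, map_sum, map_smul, LinearMap.sum_apply, LinearMap.smul_apply,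
    smul_eq_mul]
  exact Finset.sum_congr rfl fun a _ ↦ by rw [negKilling_comm X, mul_comm]

lemma projM_of_mem {X : L} (hX : X ∈ ⨆ i, m i) : wallachProjM e X = X := by
  induction hX using Submodule.iSup_induction' with
  | mem i x hx =>
    rw [wallachProjM_apply, Finset.sum_eq_single i, W.proj_of_mem hx]
    · intro j _ hj
      exact W.proj_of_mem_ne hj hx
    · simp
  | zero => simp
  | add x y _ _ hx hy => rw [map_add, hx, hy]

lemma projM_mem (X : L) : wallachProjM e X ∈ ⨆ i, m i := by
  rw [wallachProjM_apply]
  exact Submodule.sum_mem _ fun i _ ↦ mem_iSup_of_mem i (W.proj_mem i X)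

lemma projM_of_mem_h {X : L} (hX : X ∈ h) : wallachProjM e X = 0 := by
  rw [wallachProjM_apply]
  exact Finset.sum_eq_zero fun i _ ↦ W.proj_of_mem_h hX

/-- `h` is the orthogonal complement of `m 0 ⊕ m 1 ⊕ m 2`, by nondegeneracy. -/
lemma mem_h_of_orthogonal [Module.Finite ℝ L] {X : L}
    (hX : ∀ i a, negKilling L (e i a) X = 0) : X ∈ h := by
  have hnd : (negKilling L).Nondegenerate := by
    refine ⟨fun x hx ↦ W.eq_zero_of_self (hx x), fun x hx ↦ W.eq_zero_of_self (hx x)⟩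
  have hrefl : (negKilling L).IsRefl := fun x y hxy ↦ by rw [negKilling_comm]; exact hxy
  rw [← LinearMap.BilinForm.orthogonal_orthogonal hnd hrefl h]
  intro Y hY
  have hYm : Y ∈ ⨆ i, m i := (W.mem_iSup Y).2 fun Z hZ ↦ by
    rw [negKilling_comm]; exact hY Z hZ
  change negKilling L Y X = 0
  rw [← W.projM_of_mem hYm]
  simp only [wallachProjM_apply, wallachProj_apply, map_sum, map_smul, LinearMap.sum_apply,
    LinearMap.smul_apply, hX, smul_zero, Finset.sum_const_zero]

lemma projM_eq_zero_iff [Module.Finite ℝ L] {X : L} : wallachProjM e X = 0 ↔ X ∈ h := by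
  refine ⟨fun hX ↦ W.mem_h_of_orthogonal fun i a ↦ ?_, W.projM_of_mem_h⟩
  rw [negKilling_comm, ← W.projM_of_mem (mem_iSup_of_mem i (W.mem_basis i a))]
  have : negKilling L (wallachProjM e X) (e i a) = negKilling L X (wallachProjM e (e i a)) := by
    simp only [wallachProjM_apply, map_sum, LinearMap.sum_apply, negKilling_proj]
  rw [← this, hX, map_zero, LinearMap.zero_apply]

lemma sub_projM_mem [Module.Finite ℝ L] (X : L) : X - wallachProjM e X ∈ h := by
  rw [← W.projM_eq_zero_iff, map_sub, W.projM_of_mem (W.projM_mem X), sub_self]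

lemma lie_h_h_mem [Module.Finite ℝ L] {X Y : L} (hX : X ∈ h) (hY : Y ∈ h) : ⁅X, Y⁆ ∈ h :=
  W.mem_h_of_orthogonal fun i a ↦ by
    rw [negKilling_comm, negKilling_lie']
    rw [W.orthogonal_h' hY (W.lie_h_mem i X hX _ (W.mem_basis i a)), neg_zero]

/-- Two distinct summands bracket into the third one: by invariance of the Killing form the bracket
is orthogonal to `h`, `m i` and `m j`.  The third index is `-(i + j)` in `Fin 3`. -/
lemma lie_mem_third {i j : Fin 3} (hij : i ≠ j) {X Y : L} (hX : X ∈ m i) (hY : Y ∈ m j) :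
    ⁅X, Y⁆ ∈ m (-(i + j)) := by
  have hM : ⁅X, Y⁆ ∈ ⨆ i, m i := (W.mem_iSup _).2 fun Z hZ ↦ by
    rw [negKilling_lie]
    refine W.orthogonal i j hij X hX _ ?_
    rw [← lie_skew]
    exact Submodule.neg_mem _ (W.lie_h_mem j Z hZ Y hY)
  have hi : ∀ Z ∈ m i, negKilling L Z ⁅X, Y⁆ = 0 := fun Z hZ ↦ by
    rw [← negKilling_lie]
    exact W.orthogonal_h' (W.lie_mem i Z hZ X hX) hY
  have hj : ∀ Z ∈ m j, negKilling L Z ⁅X, Y⁆ = 0 := fun Z hZ ↦ by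
    rw [negKilling_comm, negKilling_lie]
    exact W.orthogonal_h hX (W.lie_mem j Y hY Z hZ)
  have hp : ∀ l, l ≠ -(i + j) → wallachProj e l ⁅X, Y⁆ = 0 := fun l hl ↦ by
    have : l = i ∨ l = j := eq_or_eq_of_ne_third i j l hij hl
    rw [wallachProj_apply]
    refine Finset.sum_eq_zero fun a _ ↦ ?_
    rcases this with rfl | rfl
    · rw [hi _ (W.mem_basis _ a), zero_smul]
    · rw [hj _ (W.mem_basis _ a), zero_smul]
  rw [← W.projM_of_mem hM, wallachProjM_apply,
    Finset.sum_eq_single (-(i + j)) (fun l _ hl ↦ hp l hl) (by simp)]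
  exact W.proj_mem _ _

end IsWallachDecomposition

end WallachAlgebra

/-! ### The grading by the Klein four-group and the Nomizu map -/

section WallachRicci

variable {L : Type*} [LieRing L] [LieAlgebra ℝ L]

/-- The degree of `m i` in the grading of `L` by the Klein four-group; `h` has degree zero. -/
def wallachDegree : Fin 3 → ZMod 2 × ZMod 2 := ![(1, 0), (0, 1), (1, 1)]

/-- The homogeneous components of the grading of `L = h ⊕ m 0 ⊕ m 1 ⊕ m 2` by the Klein
four-group. -/
def wallachGrade (h : Submodule ℝ L) (m : Fin 3 → Submodule ℝ L) (v : ZMod 2 × ZMod 2) :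
    Submodule ℝ L :=
  if v = 0 then h else if v = (1, 0) then m 0 else if v = (0, 1) then m 1 else m 2

lemma wallachDegree_ne_zero : ∀ i, wallachDegree i ≠ 0 := by decide

lemma wallachDegree_surjective : ∀ v, v ≠ 0 → ∃ i, v = wallachDegree i := by decide

lemma wallachDegree_add_self : ∀ v : ZMod 2 × ZMod 2, v + v = 0 := by decide

lemma wallachDegree_add : ∀ i j, i ≠ j →
    wallachDegree i + wallachDegree j = wallachDegree (-(i + j)) := by decide

lemma wallachGrade_zero (h : Submodule ℝ L) (m : Fin 3 → Submodule ℝ L) :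
    wallachGrade h m 0 = h := by simp [wallachGrade]

lemma wallachGrade_degree (h : Submodule ℝ L) (m : Fin 3 → Submodule ℝ L) (i : Fin 3) :
    wallachGrade h m (wallachDegree i) = m i := by
  fin_cases i <;> simp [wallachGrade, wallachDegree, Prod.ext_iff]

lemma third_ne : ∀ i j : Fin 3, i ≠ j → -(i + j) ≠ i := by decide

lemma third_eq_iff : ∀ i j k : Fin 3, i ≠ j → i ≠ k → (-(i + j) = k ↔ j = -(i + k)) := by decide

/-- The coefficients of the Levi-Civita connection of the diagonal metric with parameters `x`:
`∇_X Y = leviCivitaCoeff x i j • ⁅X, Y⁆` for `X` in `m i` and `Y` in `m j`.  If `i = j` the bracket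
lies in `h` and does not contribute. -/
noncomputable def leviCivitaCoeff (x : Fin 3 → ℝ) (i j : Fin 3) : ℝ :=
  if i = j then 0 else (x (-(i + j)) + x j - x i) / (2 * x (-(i + j)))

/-- The bilinear map `Λ` describing the Levi-Civita connection, in Nomizu's sense, of the diagonal
invariant metric with parameters `x`. -/
noncomputable def nomizuMap {d : Fin 3 → ℕ} (e : ∀ i, Fin (d i) → L) (x : Fin 3 → ℝ) :
    L →ₗ[ℝ] L →ₗ[ℝ] L :=
  ∑ i, ∑ j, leviCivitaCoeff x i j •
    (LinearMap.mk₂ ℝ (fun X Y : L ↦ ⁅X, Y⁆) add_lie smul_lie lie_add lie_smul).compl₁₂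
      (wallachProj e i) (wallachProj e j)

lemma nomizuMap_apply {d : Fin 3 → ℕ} (e : ∀ i, Fin (d i) → L) (x : Fin 3 → ℝ) (X Y : L) :
    nomizuMap e x X Y =
      ∑ i, ∑ j, leviCivitaCoeff x i j • ⁅wallachProj e i X, wallachProj e j Y⁆ := by
  simp [nomizuMap]

/-- The curvature tensor at the base point of the metric with Nomizu map `nomizuMap e x`. -/
noncomputable def nomizuCurvature {d : Fin 3 → ℕ} (e : ∀ i, Fin (d i) → L) (x : Fin 3 → ℝ)
    (X Y Z : L) : L :=
  nomizuMap e x X (nomizuMap e x Y Z) - nomizuMap e x Y (nomizuMap e x X Z) -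
    nomizuMap e x (wallachProjM e ⁅X, Y⁆) Z - ⁅⁅X, Y⁆ - wallachProjM e ⁅X, Y⁆, Z⁆

/-- The diagonal scalar product with parameters `x` on `m 0 ⊕ m 1 ⊕ m 2`. -/
noncomputable def diagForm {d : Fin 3 → ℕ} (e : ∀ i, Fin (d i) → L) (x : Fin 3 → ℝ) :
    LinearMap.BilinForm ℝ L :=
  ∑ i, x i • (negKilling L).compl₁₂ (wallachProj e i) (wallachProj e i)

lemma diagForm_apply {d : Fin 3 → ℕ} (e : ∀ i, Fin (d i) → L) (x : Fin 3 → ℝ) (X Y : L) :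
    diagForm e x X Y = ∑ i, x i * negKilling L (wallachProj e i X) (wallachProj e i Y) := by
  simp [diagForm]

/-- The Ricci tensor at the base point, as a trace over the orthonormal bases `e i`. -/
noncomputable def nomizuRicci {d : Fin 3 → ℕ} (e : ∀ i, Fin (d i) → L) (x : Fin 3 → ℝ)
    (Y Z : L) : ℝ :=
  ∑ i, ∑ a, negKilling L (nomizuCurvature e x (e i a) Y Z) (e i a)

/-- The partial Casimir form `(Y, Z) ↦ ∑ ⟨⁅e, Y⁆, ⁅e, Z⁆⟩`, `e` in the orthonormal basis of the
`j`-th summand. -/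
noncomputable def casimirForm {d : Fin 3 → ℕ} (e : ∀ i, Fin (d i) → L) (j : Fin 3) (Y Z : L) : ℝ :=
  ∑ a, negKilling L ⁅e j a, Y⁆ ⁅e j a, Z⁆

namespace IsWallachDecomposition

variable {h : Submodule ℝ L} {m : Fin 3 → Submodule ℝ L} {d : Fin 3 → ℕ}
  {e : ∀ i, Fin (d i) → L} (W : IsWallachDecomposition h m e)

include W

/-- The Lie bracket respects the grading. -/
lemma lie_mem_grade [Module.Finite ℝ L] {v w : ZMod 2 × ZMod 2} {X Y : L}
    (hX : X ∈ wallachGrade h m v) (hY : Y ∈ wallachGrade h m w) :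
    ⁅X, Y⁆ ∈ wallachGrade h m (v + w) := by
  by_cases hv : v = 0
  · subst hv
    rw [wallachGrade_zero] at hX
    rw [zero_add]
    by_cases hw : w = 0
    · subst hw
      rw [wallachGrade_zero] at hY ⊢
      exact W.lie_h_h_mem hX hY
    · obtain ⟨j, rfl⟩ := wallachDegree_surjective w hw
      rw [wallachGrade_degree] at hY ⊢
      exact W.lie_h_mem j X hX Y hY
  · obtain ⟨i, rfl⟩ := wallachDegree_surjective v hv
    rw [wallachGrade_degree] at hX
    by_cases hw : w = 0
    · subst hw
      rw [wallachGrade_zero] at hY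
      rw [add_zero, wallachGrade_degree, ← lie_skew]
      exact Submodule.neg_mem _ (W.lie_h_mem i Y hY X hX)
    · obtain ⟨j, rfl⟩ := wallachDegree_surjective w hw
      rw [wallachGrade_degree] at hY
      by_cases hij : i = j
      · subst hij
        rw [wallachDegree_add_self, wallachGrade_zero]
        exact W.lie_mem i X hX Y hY
      · rw [wallachDegree_add i j hij, wallachGrade_degree]
        exact W.lie_mem_third hij hX hY

lemma proj_mem_grade (i : Fin 3) {v : ZMod 2 × ZMod 2} {X : L} (hX : X ∈ wallachGrade h m v) :
    wallachProj e i X ∈ wallachGrade h m v := by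
  by_cases hv : v = 0
  · subst hv
    rw [wallachGrade_zero] at hX ⊢
    rw [W.proj_of_mem_h hX]
    exact Submodule.zero_mem _
  · obtain ⟨j, rfl⟩ := wallachDegree_surjective v hv
    rw [wallachGrade_degree] at hX ⊢
    by_cases hij : i = j
    · subst hij
      exact W.proj_mem i X
    · rw [W.proj_of_mem_ne hij hX]
      exact Submodule.zero_mem _

lemma projM_mem_grade {v : ZMod 2 × ZMod 2} {X : L} (hX : X ∈ wallachGrade h m v) :
    wallachProjM e X ∈ wallachGrade h m v := by
  rw [wallachProjM_apply]
  exact Submodule.sum_mem _ fun i _ ↦ W.proj_mem_grade i hX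

lemma nomizuMap_mem_grade [Module.Finite ℝ L] (x : Fin 3 → ℝ) {v w : ZMod 2 × ZMod 2} {X Y : L}
    (hX : X ∈ wallachGrade h m v) (hY : Y ∈ wallachGrade h m w) :
    nomizuMap e x X Y ∈ wallachGrade h m (v + w) := by
  rw [nomizuMap_apply]
  exact Submodule.sum_mem _ fun i _ ↦ Submodule.sum_mem _ fun j _ ↦ Submodule.smul_mem _ _
    (W.lie_mem_grade (W.proj_mem_grade i hX) (W.proj_mem_grade j hY))

lemma nomizuCurvature_mem_grade [Module.Finite ℝ L] (x : Fin 3 → ℝ) {u v w : ZMod 2 × ZMod 2}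
    {X Y Z : L} (hX : X ∈ wallachGrade h m u) (hY : Y ∈ wallachGrade h m v)
    (hZ : Z ∈ wallachGrade h m w) :
    nomizuCurvature e x X Y Z ∈ wallachGrade h m (u + v + w) := by
  have hXY := W.lie_mem_grade hX hY
  refine Submodule.sub_mem _ (Submodule.sub_mem _ (Submodule.sub_mem _ ?_ ?_) ?_) ?_
  · rw [add_assoc]
    exact W.nomizuMap_mem_grade x hX (W.nomizuMap_mem_grade x hY hZ)
  · rw [add_comm u v, add_assoc]
    exact W.nomizuMap_mem_grade x hY (W.nomizuMap_mem_grade x hX hZ)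
  · exact W.nomizuMap_mem_grade x (W.projM_mem_grade hXY) hZ
  · exact W.lie_mem_grade (Submodule.sub_mem _ hXY (W.projM_mem_grade hXY)) hZ

lemma grade_orthogonal {v w : ZMod 2 × ZMod 2} (hvw : v ≠ w) {X Y : L}
    (hX : X ∈ wallachGrade h m v) (hY : Y ∈ wallachGrade h m w) : negKilling L X Y = 0 := by
  by_cases hv : v = 0
  · subst hv
    obtain ⟨j, rfl⟩ := wallachDegree_surjective w hvw.symm
    rw [wallachGrade_zero] at hX
    rw [wallachGrade_degree] at hY
    exact W.orthogonal_h' hX hY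
  · obtain ⟨i, rfl⟩ := wallachDegree_surjective v hv
    rw [wallachGrade_degree] at hX
    by_cases hw : w = 0
    · subst hw
      rw [wallachGrade_zero] at hY
      exact W.orthogonal_h hX hY
    · obtain ⟨j, rfl⟩ := wallachDegree_surjective w hw
      rw [wallachGrade_degree] at hY
      exact W.orthogonal i j (fun h ↦ hvw (h ▸ rfl)) X hX Y hY

/-- Between two summands the Nomizu map is a multiple of the Lie bracket. -/
lemma nomizuMap_of_mem (x : Fin 3 → ℝ) {i j : Fin 3} {X Y : L} (hX : X ∈ m i) (hY : Y ∈ m j) :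
    nomizuMap e x X Y = leviCivitaCoeff x i j • ⁅X, Y⁆ := by
  rw [nomizuMap_apply, Finset.sum_eq_single i, Finset.sum_eq_single j, W.proj_of_mem hX,
    W.proj_of_mem hY]
  · intro l _ hl
    rw [W.proj_of_mem_ne hl hY, lie_zero, smul_zero]
  · simp
  · intro l _ hl
    rw [W.proj_of_mem_ne hl hX]
    simp
  · simp

lemma nomizuMap_mem (x : Fin 3 → ℝ) (X Y : L) : nomizuMap e x X Y ∈ ⨆ i, m i := by
  rw [nomizuMap_apply]
  refine Submodule.sum_mem _ fun i _ ↦ Submodule.sum_mem _ fun j _ ↦ ?_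
  by_cases hij : i = j
  · simp [leviCivitaCoeff, hij]
  · exact Submodule.smul_mem _ _ (mem_iSup_of_mem _
      (W.lie_mem_third hij (W.proj_mem i X) (W.proj_mem j Y)))

lemma projM_lie_of_mem {i j : Fin 3} {X Y : L} (hX : X ∈ m i) (hY : Y ∈ m j) :
    wallachProjM e ⁅X, Y⁆ = if i = j then 0 else ⁅X, Y⁆ := by
  split_ifs with hij
  · subst hij
    exact W.projM_of_mem_h (W.lie_mem i X hX Y hY)
  · exact W.projM_of_mem (mem_iSup_of_mem _ (W.lie_mem_third hij hX hY))

/-- The Nomizu map is torsion-free. -/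
lemma nomizuMap_sub_swap {x : Fin 3 → ℝ} (hx : ∀ i, 0 < x i) {X Y : L} (hX : X ∈ ⨆ i, m i)
    (hY : Y ∈ ⨆ i, m i) :
    nomizuMap e x X Y - nomizuMap e x Y X = wallachProjM e ⁅X, Y⁆ := by
  induction hX using Submodule.iSup_induction' with
  | zero => simp
  | add X X' _ _ h1 h2 =>
    simp only [map_add, LinearMap.add_apply, add_lie, ← h1, ← h2]
    abel
  | mem i X hX =>
    induction hY using Submodule.iSup_induction' with
    | zero => simp
    | add Y Y' _ _ h1 h2 =>
      simp only [map_add, LinearMap.add_apply, lie_add, ← h1, ← h2]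
      abel
    | mem j Y hY =>
      rw [W.nomizuMap_of_mem x hX hY, W.nomizuMap_of_mem x hY hX, W.projM_lie_of_mem hX hY,
        ← lie_skew Y X, smul_neg, sub_neg_eq_add, ← add_smul]
      split_ifs with hij
      · simp [leviCivitaCoeff, hij]
      · have : leviCivitaCoeff x i j + leviCivitaCoeff x j i = 1 := by
          have := (hx (-(i + j))).ne'
          rw [leviCivitaCoeff, leviCivitaCoeff, if_neg hij, if_neg (Ne.symm hij), add_comm j i]
          field_simp
          ring
        rw [this, one_smul]

lemma diagForm_of_mem (x : Fin 3 → ℝ) {i j : Fin 3} {X Y : L} (hX : X ∈ m i) (hY : Y ∈ m j) :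
    diagForm e x X Y = if i = j then x i * negKilling L X Y else 0 := by
  rw [diagForm_apply]
  split_ifs with hij
  · subst hij
    rw [Finset.sum_eq_single i, W.proj_of_mem hX, W.proj_of_mem hY]
    · intro l _ hl
      rw [W.proj_of_mem_ne hl hX, map_zero, LinearMap.zero_apply, mul_zero]
    · simp
  · refine Finset.sum_eq_zero fun l _ ↦ ?_
    by_cases hl : l = i
    · rw [W.proj_of_mem_ne (hl ▸ hij) hY, map_zero, mul_zero]
    · rw [W.proj_of_mem_ne hl hX, map_zero, LinearMap.zero_apply, mul_zero]

/-- The Nomizu map is compatible with the metric. -/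
lemma diagForm_nomizuMap {x : Fin 3 → ℝ} (hx : ∀ i, 0 < x i) {X Y Z : L} (hX : X ∈ ⨆ i, m i)
    (hY : Y ∈ ⨆ i, m i) (hZ : Z ∈ ⨆ i, m i) :
    diagForm e x (nomizuMap e x X Y) Z + diagForm e x Y (nomizuMap e x X Z) = 0 := by
  induction hX using Submodule.iSup_induction' with
  | zero => simp
  | add X X' _ _ h1 h2 =>
    simp only [map_add, LinearMap.add_apply]
    linear_combination h1 + h2
  | mem i X hX =>
  induction hY using Submodule.iSup_induction' with
  | zero => simp
  | add Y Y' _ _ h1 h2 =>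
    simp only [map_add, LinearMap.add_apply]
    linear_combination h1 + h2
  | mem j Y hY =>
  induction hZ using Submodule.iSup_induction' with
  | zero => simp
  | add Z Z' _ _ h1 h2 =>
    simp only [map_add]
    linear_combination h1 + h2
  | mem k Z hZ =>
    rw [W.nomizuMap_of_mem x hX hY, W.nomizuMap_of_mem x hX hZ, map_smul, LinearMap.smul_apply,
      map_smul, smul_eq_mul, smul_eq_mul]
    by_cases hij : i = j
    · have h1 : leviCivitaCoeff x i j = 0 := if_pos hij
      rw [h1, zero_mul, zero_add]
      by_cases hik : i = k
      · have h2 : leviCivitaCoeff x i k = 0 := if_pos hik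
        rw [h2, zero_mul]
      · rw [W.diagForm_of_mem x hY (W.lie_mem_third hik hX hZ), if_neg, mul_zero]
        subst hij
        exact (third_ne i k hik).symm
    · by_cases hik : i = k
      · have h2 : leviCivitaCoeff x i k = 0 := if_pos hik
        rw [h2, zero_mul, add_zero,
          W.diagForm_of_mem x (W.lie_mem_third hij hX hY) hZ, if_neg, mul_zero]
        subst hik
        exact third_ne i j hij
      · rw [W.diagForm_of_mem x hY (W.lie_mem_third hik hX hZ),
          W.diagForm_of_mem x (W.lie_mem_third hij hX hY) hZ]
        by_cases hk : -(i + j) = k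
        · have hj := (third_eq_iff i j k hij hik).1 hk
          rw [if_pos hk, if_pos hj, negKilling_lie', leviCivitaCoeff, leviCivitaCoeff,
            if_neg hij, if_neg hik, hk, ← hj]
          have h1 := (hx k).ne'
          have h2 := (hx j).ne'
          field_simp
          ring
        · rw [if_neg hk, if_neg (fun hj ↦ hk ((third_eq_iff i j k hij hik).2 hj)), mul_zero,
            mul_zero, add_zero]

end IsWallachDecomposition

end WallachRicci

/-! ### The Ricci tensor on the Lie algebra -/

section WallachRicci

variable {L : Type*} [LieRing L] [LieAlgebra ℝ L]

/-- The index identities in `Fin 3` behind the cyclic notation `i`, `i + 1`, `i + 2`, where the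
index different from `i` and `j` is `-(i + j)`. -/
lemma succ_ne_self_three : ∀ i : Fin 3, i + 1 ≠ i ∧ i + 2 ≠ i ∧ -(i + 1 + i) = i + 2 ∧
    -(i + 2 + i) = i + 1 ∧ -(i + (i + 2)) = i + 1 ∧ -(i + (i + 1)) = i + 2 ∧
    -(i + 1 + (i + 2)) = i ∧ -(i + 2 + (i + 1)) = i ∧ i + 1 ≠ i + 2 := by decide

lemma casimirForm_comm {d : Fin 3 → ℕ} (e : ∀ i, Fin (d i) → L) (j : Fin 3) (Y Z : L) :
    casimirForm e j Y Z = casimirForm e j Z Y :=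
  Finset.sum_congr rfl fun _ _ ↦ negKilling_comm _ _

namespace IsWallachDecomposition

variable {h : Submodule ℝ L} {m : Fin 3 → Submodule ℝ L} {d : Fin 3 → ℕ}
  {e : ∀ i, Fin (d i) → L} (W : IsWallachDecomposition h m e)

include W

lemma casimirForm_self_nonneg (j : Fin 3) (Y : L) : 0 ≤ casimirForm e j Y Y := by
  refine Finset.sum_nonneg fun a _ ↦ ?_
  by_cases h0 : ⁅e j a, Y⁆ = 0
  · rw [h0, map_zero]
  · exact (W.pos _ h0).le

omit W in
lemma trace_comp_wallachProj [Module.Finite ℝ L] (f : L →ₗ[ℝ] L) (i : Fin 3) :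
    LinearMap.trace ℝ L (f ∘ₗ wallachProj e i) = ∑ a, negKilling L (e i a) (f (e i a)) := by
  have : f ∘ₗ wallachProj e i = ∑ a, (negKilling L (e i a)).smulRight (f (e i a)) := by
    ext X
    simp [wallachProj_apply]
  rw [this, map_sum]
  exact Finset.sum_congr rfl fun a _ ↦ LinearMap.trace_smulRight _ _

omit W in
/-- The partial Casimir form as a trace, which shows that it does not depend on the basis. -/
lemma casimirForm_eq_trace [Module.Finite ℝ L] (j : Fin 3) (Y Z : L) :
    casimirForm e j Y Z = -LinearMap.trace ℝ L
      ((LieAlgebra.ad ℝ L Y ∘ₗ LieAlgebra.ad ℝ L Z) ∘ₗ wallachProj e j) := by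
  rw [trace_comp_wallachProj, casimirForm, ← Finset.sum_neg_distrib]
  refine Finset.sum_congr rfl fun a _ ↦ ?_
  rw [LinearMap.comp_apply, LieAlgebra.ad_apply, LieAlgebra.ad_apply, negKilling_lie,
    ← lie_skew (e j a) Z, lie_neg, map_neg]

/-- Parseval's identity in the summand `m i`. -/
lemma negKilling_eq_sum {i : Fin 3} {X Y : L} (hX : X ∈ m i) :
    negKilling L X Y = ∑ c, negKilling L X (e i c) * negKilling L Y (e i c) := by
  conv_lhs => rw [← W.proj_of_mem hX, wallachProj_apply]
  simp only [map_sum, map_smul, LinearMap.sum_apply, LinearMap.smul_apply, smul_eq_mul]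
  exact Finset.sum_congr rfl fun c _ ↦ by rw [negKilling_comm X, negKilling_comm Y]

lemma casimirForm_eq_sum {i j : Fin 3} (hij : j ≠ i) {Y Z : L} (hY : Y ∈ m i) :
    casimirForm e j Y Z = ∑ a, ∑ c, negKilling L ⁅e j a, Y⁆ (e (-(j + i)) c) *
      negKilling L ⁅e j a, Z⁆ (e (-(j + i)) c) :=
  Finset.sum_congr rfl fun a _ ↦ W.negKilling_eq_sum (W.lie_mem_third hij (W.mem_basis j a) hY)

omit W in
lemma negKilling_lie_swap (X Y Z : L) : negKilling L ⁅X, Y⁆ Z = -negKilling L ⁅Z, Y⁆ X := by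
  rw [negKilling_lie, negKilling_comm, ← lie_skew Y Z, map_neg, LinearMap.neg_apply]

/-- On `m i` the Casimir forms of the two other summands agree. -/
lemma casimirForm_succ (i : Fin 3) {Y Z : L} (hY : Y ∈ m i) :
    casimirForm e (i + 1) Y Z = casimirForm e (i + 2) Y Z := by
  obtain ⟨h1, h2, h3, h4, -⟩ := succ_ne_self_three i
  rw [W.casimirForm_eq_sum h1 hY, W.casimirForm_eq_sum h2 hY, h3, h4, Finset.sum_comm]
  refine Finset.sum_congr rfl fun a _ ↦ Finset.sum_congr rfl fun c _ ↦ ?_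
  rw [negKilling_lie_swap (e (i + 1) c) Y, negKilling_lie_swap (e (i + 1) c) Z, neg_mul_neg]

/-- Minus the Killing form on `m i`, expressed by the Casimir forms.  In the trace of `ad Y ∘ ad Z`
the summands `m (i + 1)` and `m (i + 2)` contribute equally, and so do `h` and `m i`, which `ad Z`
interchanges. -/
lemma negKilling_eq_casimir [Module.Finite ℝ L] (i : Fin 3) {Y Z : L} (hY : Y ∈ m i)
    (hZ : Z ∈ m i) :
    negKilling L Y Z = 2 * casimirForm e i Y Z + 2 * casimirForm e (i + 1) Y Z := by
  set A := LieAlgebra.ad ℝ L Y with hA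
  set B := LieAlgebra.ad ℝ L Z with hB
  set P : L →ₗ[ℝ] L := LinearMap.id - wallachProjM e with hP
  have hsplit : A ∘ₗ B = ∑ j, (A ∘ₗ B) ∘ₗ wallachProj e j + A ∘ₗ (wallachProj e i ∘ₗ B ∘ₗ P) := by
    ext X
    have h1 : wallachProj e i ⁅Z, X - wallachProjM e X⁆ = ⁅Z, X - wallachProjM e X⁆ := by
      refine W.proj_of_mem ?_
      rw [← lie_skew]
      exact Submodule.neg_mem _ (W.lie_h_mem i _ (W.sub_projM_mem X) Z hZ)
    simp only [LinearMap.add_apply, LinearMap.sum_apply, LinearMap.comp_apply, hP,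
      LinearMap.sub_apply, LinearMap.id_apply, hA, hB, LieAlgebra.ad_apply, h1]
    rw [lie_sub, lie_sub, wallachProjM_apply, lie_sum, lie_sum]
    abel
  have h2 : LinearMap.trace ℝ L (A ∘ₗ (wallachProj e i ∘ₗ B ∘ₗ P)) =
      LinearMap.trace ℝ L ((B ∘ₗ A) ∘ₗ wallachProj e i) := by
    rw [LinearMap.trace_comp_comm', LinearMap.comp_assoc, LinearMap.trace_comp_comm']
    congr 1
    ext X
    simp only [LinearMap.comp_apply, hP, LinearMap.sub_apply, LinearMap.id_apply, hA, hB,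
      LieAlgebra.ad_apply]
    rw [W.projM_of_mem_h (W.lie_mem i Y hY _ (W.proj_mem i X)), sub_zero]
  rw [negKilling_apply, killingForm_apply_apply, ← hA, ← hB, hsplit, map_add, map_sum, h2, neg_add,
    ← casimirForm_eq_trace, casimirForm_comm e i Z Y, ← Finset.sum_neg_distrib]
  simp only [hA, hB, ← casimirForm_eq_trace]
  rw [sum_fin_three_cyclic _ i, ← W.casimirForm_succ i hY]
  ring

/-- The trace over `m i` of the Casimir form of another summand is `[123]`, whose summands are
invariant under permutations of the three vectors. -/
lemma sum_casimirForm (i : Fin 3) :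
    ∑ a, casimirForm e (i + 1) (e i a) (e i a) = structureConstant123 e := by
  have key : ∀ i, ∑ a, casimirForm e (i + 1) (e i a) (e i a) =
      ∑ a, ∑ b, ∑ c, negKilling L ⁅e (i + 1) b, e i a⁆ (e (i + 2) c) ^ 2 := fun i ↦ by
    obtain ⟨h1, h2, h3, h4, -⟩ := succ_ne_self_three i
    refine Finset.sum_congr rfl fun a _ ↦ ?_
    rw [W.casimirForm_eq_sum h1 (W.mem_basis i a), h3]
    exact Finset.sum_congr rfl fun b _ ↦ Finset.sum_congr rfl fun c _ ↦ (sq _).symm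
  rw [key, structureConstant123]
  have e0 : ∀ a b c, negKilling L ⁅e 1 b, e 0 a⁆ (e 2 c) ^ 2 =
      (-killingForm ℝ L ⁅e 1 b, e 2 c⁆ (e 0 a)) ^ 2 := fun a b c ↦ by
    rw [← negKilling_apply, negKilling_lie, negKilling_lie, ← lie_skew, map_neg, neg_sq]
  have e1 : ∀ a b c, negKilling L ⁅e 2 c, e 1 b⁆ (e 0 a) ^ 2 =
      (-killingForm ℝ L ⁅e 1 b, e 2 c⁆ (e 0 a)) ^ 2 := fun a b c ↦ by
    rw [← negKilling_apply, ← lie_skew, map_neg, LinearMap.neg_apply, neg_sq]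
  have e2 : ∀ a b c, negKilling L ⁅e 0 a, e 2 c⁆ (e 1 b) ^ 2 =
      (-killingForm ℝ L ⁅e 1 b, e 2 c⁆ (e 0 a)) ^ 2 := fun a b c ↦ by
    rw [← negKilling_apply, negKilling_lie_swap, neg_sq]
  fin_cases i
  · exact Finset.sum_congr rfl fun a _ ↦ Finset.sum_congr rfl fun b _ ↦
      Finset.sum_congr rfl fun c _ ↦ e0 a b c
  · calc _ = ∑ b, ∑ c, ∑ a, (-killingForm ℝ L ⁅e 1 b, e 2 c⁆ (e 0 a)) ^ 2 :=
        Finset.sum_congr rfl fun b _ ↦ Finset.sum_congr rfl fun c _ ↦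
          Finset.sum_congr rfl fun a _ ↦ e1 a b c
      _ = ∑ b, ∑ a, ∑ c, (-killingForm ℝ L ⁅e 1 b, e 2 c⁆ (e 0 a)) ^ 2 :=
        Finset.sum_congr rfl fun b _ ↦ Finset.sum_comm
      _ = _ := Finset.sum_comm
  · calc _ = ∑ c, ∑ a, ∑ b, (-killingForm ℝ L ⁅e 1 b, e 2 c⁆ (e 0 a)) ^ 2 :=
        Finset.sum_congr rfl fun c _ ↦ Finset.sum_congr rfl fun a _ ↦
          Finset.sum_congr rfl fun b _ ↦ e2 a b c
      _ = ∑ a, ∑ c, ∑ b, (-killingForm ℝ L ⁅e 1 b, e 2 c⁆ (e 0 a)) ^ 2 := Finset.sum_comm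
      _ = _ := Finset.sum_congr rfl fun a _ ↦ Finset.sum_comm

/-- The structure constant is at most half of the dimension of each summand: take the trace over
`m i` in `negKilling_eq_casimir`. -/
lemma two_mul_structureConstant_le [Module.Finite ℝ L] (i : Fin 3) :
    2 * structureConstant123 e ≤ d i := by
  have h1 : ∑ a, negKilling L (e i a) (e i a) = d i := by
    have : ∀ a, negKilling L (e i a) (e i a) = 1 := fun a ↦ by
      have := (W.basis i).2 a a
      rwa [if_pos rfl] at this
    simp [this]
  have h2 : 0 ≤ ∑ a, casimirForm e i (e i a) (e i a) :=
    Finset.sum_nonneg fun a _ ↦ W.casimirForm_self_nonneg i _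
  rw [← h1, ← W.sum_casimirForm i, Finset.mul_sum]
  refine Finset.sum_le_sum fun a _ ↦ ?_
  rw [W.negKilling_eq_casimir i (W.mem_basis i a) (W.mem_basis i a)]
  linarith [W.casimirForm_self_nonneg i (e i a)]

/-- A diagonal entry of the curvature operator `E ↦ R(E, Y) Z` for `E` in the summand of `Y` and
`Z`.  All three lie in `m i`, and only the term with `⁅⁅E, Y⁆, Z⁆`, `⁅E, Y⁆ ∈ h`, remains. -/
lemma negKilling_curvature_of_eq (x : Fin 3 → ℝ) {i : Fin 3} {E Y Z : L} (hE : E ∈ m i)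
    (hY : Y ∈ m i) (hZ : Z ∈ m i) :
    negKilling L (nomizuCurvature e x E Y Z) E = negKilling L ⁅E, Y⁆ ⁅E, Z⁆ := by
  have h1 : leviCivitaCoeff x i i = 0 := if_pos rfl
  rw [nomizuCurvature, W.nomizuMap_of_mem x hY hZ, W.nomizuMap_of_mem x hE hZ,
    W.projM_lie_of_mem hE hY, if_pos rfl, h1]
  simp only [zero_smul, map_zero, LinearMap.zero_apply, sub_zero, zero_sub, map_neg,
    LinearMap.neg_apply]
  rw [negKilling_lie, ← lie_skew Z E, map_neg, neg_neg]

/-- A diagonal entry of the curvature operator `E ↦ R(E, Y) Z` for `E` in another summand than `Y`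
and `Z`.  Here `⁅E, Y⁆` lies in the third summand, so that the term with values in `ad h` vanishes. -/
lemma negKilling_curvature_of_ne [Module.Finite ℝ L] (x : Fin 3 → ℝ) {i j : Fin 3} (hij : j ≠ i)
    {E Y Z : L} (hE : E ∈ m j) (hY : Y ∈ m i) (hZ : Z ∈ m i) :
    negKilling L (nomizuCurvature e x E Y Z) E =
      (leviCivitaCoeff x (-(j + i)) i - leviCivitaCoeff x i (-(j + i)) * leviCivitaCoeff x j i) *
        negKilling L ⁅E, Y⁆ ⁅E, Z⁆ := by
  have h1 : leviCivitaCoeff x i i = 0 := if_pos rfl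
  rw [nomizuCurvature, W.nomizuMap_of_mem x hY hZ, W.nomizuMap_of_mem x hE hZ,
    W.projM_lie_of_mem hE hY, if_neg hij, h1,
    map_smul (nomizuMap e x Y),
    W.nomizuMap_of_mem x hY (W.lie_mem_third hij hE hZ),
    W.nomizuMap_of_mem x (W.lie_mem_third hij hE hY) hZ]
  simp only [zero_smul, map_zero, sub_zero, zero_sub, map_neg, sub_self, zero_lie, map_sub,
    LinearMap.neg_apply, LinearMap.sub_apply, map_smul, LinearMap.smul_apply, smul_eq_mul]
  have h2 : negKilling L ⁅Y, ⁅E, Z⁆⁆ E = negKilling L ⁅E, Y⁆ ⁅E, Z⁆ := by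
    rw [negKilling_lie', ← lie_skew E Y, map_neg, LinearMap.neg_apply, negKilling_comm]
  have h3 : negKilling L ⁅⁅E, Y⁆, Z⁆ E = -negKilling L ⁅E, Y⁆ ⁅E, Z⁆ := by
    rw [negKilling_lie, ← lie_skew Z E, map_neg]
  rw [h2, h3]
  ring

/-- Different summands are orthogonal for the Ricci tensor, by the grading. -/
lemma nomizuRicci_of_ne [Module.Finite ℝ L] (x : Fin 3 → ℝ) {i j : Fin 3} (hij : i ≠ j) {Y Z : L}
    (hY : Y ∈ m i) (hZ : Z ∈ m j) : nomizuRicci e x Y Z = 0 := by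
  refine Finset.sum_eq_zero fun l _ ↦ Finset.sum_eq_zero fun a _ ↦ ?_
  have h0 := W.mem_basis l a
  rw [← wallachGrade_degree h m] at h0 hY hZ
  refine W.grade_orthogonal ?_ (W.nomizuCurvature_mem_grade x h0 hY hZ) h0
  rw [add_assoc, Ne, add_eq_left, wallachDegree_add i j hij]
  exact wallachDegree_ne_zero _

/-- The Ricci tensor on `m i`, by summing the diagonal entries of the curvature operator; the
Casimir form of `m i` itself is eliminated with `negKilling_eq_casimir`. -/
lemma nomizuRicci_of_eq [Module.Finite ℝ L] {x : Fin 3 → ℝ} (hx : ∀ i, 0 < x i) (i : Fin 3)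
    {Y Z : L} (hY : Y ∈ m i) (hZ : Z ∈ m i) :
    nomizuRicci e x Y Z = 1 / 2 * negKilling L Y Z +
      (x i ^ 2 - x (i + 1) ^ 2 - x (i + 2) ^ 2) / (2 * x (i + 1) * x (i + 2)) *
        casimirForm e (i + 1) Y Z := by
  obtain ⟨n1, n2, n3, n4, n5, n6, n7, n8, n9⟩ := succ_ne_self_three i
  have h0 : ∑ a, negKilling L (nomizuCurvature e x (e i a) Y Z) (e i a) = casimirForm e i Y Z :=
    Finset.sum_congr rfl fun a _ ↦ W.negKilling_curvature_of_eq x (W.mem_basis i a) hY hZ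
  have hne : ∀ j, j ≠ i → ∑ a, negKilling L (nomizuCurvature e x (e j a) Y Z) (e j a) =
      (leviCivitaCoeff x (-(j + i)) i - leviCivitaCoeff x i (-(j + i)) * leviCivitaCoeff x j i) *
        casimirForm e j Y Z := fun j hj ↦ by
    rw [casimirForm, Finset.mul_sum]
    exact Finset.sum_congr rfl fun a _ ↦
      W.negKilling_curvature_of_ne x hj (W.mem_basis j a) hY hZ
  rw [nomizuRicci, sum_fin_three_cyclic _ i, h0, hne _ n1, hne _ n2, n3, n4,
    ← W.casimirForm_succ i hY, W.negKilling_eq_casimir i hY hZ]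
  simp only [leviCivitaCoeff, if_neg n1, if_neg n2, if_neg n1.symm, if_neg n2.symm, n3, n4, n5, n6]
  have h1 := (hx (i + 1)).ne'
  have h2 := (hx (i + 2)).ne'
  field_simp
  ring

/-- The Ricci tensor when the Casimir forms are multiples of the Killing form, with the factors
forced by the total. -/
lemma nomizuRicci_eq [Module.Finite ℝ L] {x : Fin 3 → ℝ} (hx : ∀ i, 0 < x i)
    (hschur : ∀ i, ∃ s : ℝ, ∀ Y ∈ m i, ∀ Z ∈ m i,
      casimirForm e (i + 1) Y Z = s * negKilling L Y Z)
    (hd : ∀ i, 0 < d i)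
    {Y Z : L} (hY : Y ∈ ⨆ i, m i) (hZ : Z ∈ ⨆ i, m i) :
    nomizuRicci e x Y Z = diagForm e (fun i ↦ 1 / 2 + structureConstant123 e / d i *
      ((x i ^ 2 - x (i + 1) ^ 2 - x (i + 2) ^ 2) / (2 * x (i + 1) * x (i + 2)))) Y Z := by
  induction hY using Submodule.iSup_induction' with
  | zero => simp [nomizuRicci, nomizuCurvature]
  | add Y Y' _ _ h1 h2 =>
    rw [map_add, LinearMap.add_apply, ← h1, ← h2]
    simp only [nomizuRicci, nomizuCurvature, ← Finset.sum_add_distrib]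
    refine Finset.sum_congr rfl fun i _ ↦ Finset.sum_congr rfl fun a _ ↦ ?_
    rw [← LinearMap.add_apply, ← map_add]
    congr 2
    simp only [map_add, LinearMap.add_apply, lie_add, add_lie, sub_lie]
    abel
  | mem i Y hY =>
  induction hZ using Submodule.iSup_induction' with
  | zero => simp [nomizuRicci, nomizuCurvature]
  | add Z Z' _ _ h1 h2 =>
    rw [map_add, ← h1, ← h2]
    simp only [nomizuRicci, nomizuCurvature, ← Finset.sum_add_distrib]
    refine Finset.sum_congr rfl fun i _ ↦ Finset.sum_congr rfl fun a _ ↦ ?_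
    rw [← LinearMap.add_apply, ← map_add]
    congr 2
    simp only [map_add, lie_add]
    abel
  | mem j Z hZ =>
    rw [W.diagForm_of_mem _ hY hZ]
    split_ifs with hij
    · subst hij
      obtain ⟨s, hs⟩ := hschur i
      have hsd : s * d i = structureConstant123 e := by
        rw [← W.sum_casimirForm i]
        have : ∀ a, casimirForm e (i + 1) (e i a) (e i a) = s := fun a ↦ by
          rw [hs _ (W.mem_basis i a) _ (W.mem_basis i a)]
          have := (W.basis i).2 a a
          rw [if_pos rfl] at this
          rw [negKilling_apply, this, mul_one]
        simp [this, mul_comm]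
      have hdi : (d i : ℝ) ≠ 0 := by exact_mod_cast (hd i).ne'
      rw [W.nomizuRicci_of_eq hx i hY hZ, hs Y hY Z hZ, ← hsd]
      field_simp
    · exact W.nomizuRicci_of_ne x hij hY hZ

end IsWallachDecomposition

end WallachRicci

/-! ### Automorphisms and Schur's lemma -/

section WallachAutomorphism

variable {L : Type*} [LieRing L] [LieAlgebra ℝ L]

lemma negKilling_equiv (A : L ≃ₗ⁅ℝ⁆ L) (X Y : L) :
    negKilling L (A X) (A Y) = negKilling L X Y := by
  rw [negKilling_apply, negKilling_apply, LieAlgebra.killingForm_of_equiv_apply]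

lemma negKilling_equiv_left (A : L ≃ₗ⁅ℝ⁆ L) (X Y : L) :
    negKilling L (A X) Y = negKilling L X (A.symm Y) := by
  rw [← negKilling_equiv A X, LieEquiv.apply_symm_apply]

/-- The Lie algebra automorphism `A` preserves each of the subspaces `m i`. -/
def PreservesSummands (m : Fin 3 → Submodule ℝ L) (A : L ≃ₗ⁅ℝ⁆ L) : Prop :=
  ∀ i, ∀ X ∈ m i, A X ∈ m i ∧ A.symm X ∈ m i

lemma PreservesSummands.symm {m : Fin 3 → Submodule ℝ L} {A : L ≃ₗ⁅ℝ⁆ L}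
    (hA : PreservesSummands m A) : PreservesSummands m A.symm :=
  fun i X hX ↦ ⟨(hA i X hX).2, (hA i X hX).1⟩

namespace IsWallachDecomposition

variable {h : Submodule ℝ L} {m : Fin 3 → Submodule ℝ L} {d : Fin 3 → ℕ}
  {e : ∀ i, Fin (d i) → L} (W : IsWallachDecomposition h m e)

include W

lemma proj_equiv {A : L ≃ₗ⁅ℝ⁆ L} (hA : PreservesSummands m A) (i : Fin 3) (X : L) :
    wallachProj e i (A X) = A (wallachProj e i X) := by
  have hmem : A (wallachProj e i X) ∈ m i := (hA i _ (W.proj_mem i X)).1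
  have h1 : ∀ Z ∈ m i, negKilling L (wallachProj e i (A X) - A (wallachProj e i X)) Z = 0 := by
    intro Z hZ
    rw [map_sub, LinearMap.sub_apply, negKilling_proj, W.proj_of_mem hZ, negKilling_equiv_left,
      negKilling_equiv_left, negKilling_proj, W.proj_of_mem (hA i Z hZ).2, sub_self]
  exact sub_eq_zero.1 (W.eq_zero_of_self (h1 _ (Submodule.sub_mem _ (W.proj_mem i _) hmem)))

lemma projM_equiv {A : L ≃ₗ⁅ℝ⁆ L} (hA : PreservesSummands m A) (X : L) :
    wallachProjM e (A X) = A (wallachProjM e X) := by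
  simp only [wallachProjM_apply, map_sum, W.proj_equiv hA]

lemma nomizuMap_equiv {A : L ≃ₗ⁅ℝ⁆ L} (hA : PreservesSummands m A) (x : Fin 3 → ℝ) (X Y : L) :
    nomizuMap e x (A X) (A Y) = A (nomizuMap e x X Y) := by
  simp only [nomizuMap_apply, map_sum, W.proj_equiv hA, map_smul, LieEquiv.map_lie]

lemma diagForm_equiv {A : L ≃ₗ⁅ℝ⁆ L} (hA : PreservesSummands m A) (x : Fin 3 → ℝ) (X Y : L) :
    diagForm e x (A X) (A Y) = diagForm e x X Y := by
  simp only [diagForm_apply, W.proj_equiv hA, negKilling_equiv]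

lemma casimirForm_equiv [Module.Finite ℝ L] {A : L ≃ₗ⁅ℝ⁆ L} (hA : PreservesSummands m A)
    (j : Fin 3) (Y Z : L) : casimirForm e j (A Y) (A Z) = casimirForm e j Y Z := by
  rw [casimirForm_eq_trace, casimirForm_eq_trace]
  congr 1
  conv_rhs => rw [← LinearMap.trace_conj' _ A.toLinearEquiv]
  congr 1
  ext X
  simp only [LinearEquiv.conj_apply, LinearMap.comp_apply, LieAlgebra.ad_apply]
  change _ = A ⁅Y, ⁅Z, wallachProj e j (A.symm X)⁆⁆
  rw [W.proj_equiv hA.symm, LieEquiv.map_lie, LieEquiv.map_lie, LieEquiv.apply_symm_apply]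

omit W in
lemma casimirForm_sum_left (j : Fin 3) {ι : Type*} (s : Finset ι) (f : ι → L) (Z : L) :
    casimirForm e j (∑ a ∈ s, f a) Z = ∑ a ∈ s, casimirForm e j (f a) Z := by
  simp only [casimirForm, lie_sum, map_sum, LinearMap.sum_apply]
  exact Finset.sum_comm

/-- A partial Casimir form has an eigenvector in `m i`, since it is symmetric. -/
lemma exists_casimir_eigenvector (i j : Fin 3) (hi : 0 < d i) :
    ∃ s : ℝ, ∃ X ∈ m i, X ≠ 0 ∧ ∀ Z ∈ m i, casimirForm e j X Z = s * negKilling L X Z := by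
  classical
  let C : Matrix (Fin (d i)) (Fin (d i)) ℝ := .of fun a b ↦ casimirForm e j (e i a) (e i b)
  have hC : C.IsHermitian := by
    ext a b
    simp [C, casimirForm_comm e j (e i a)]
  let a₀ : Fin (d i) := ⟨0, hi⟩
  have hv := hC.mulVec_eigenvectorBasis a₀
  set v := hC.eigenvectorBasis a₀ with hvdef
  set s := hC.eigenvalues a₀
  have hQ : ∀ a b, negKilling L (e i a) (e i b) = if a = b then 1 else 0 := (W.basis i).2
  have hXb : ∀ b, negKilling L (∑ a, v a • e i a) (e i b) = v b := fun b ↦ by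
    simp [map_sum, LinearMap.sum_apply, hQ]
  refine ⟨s, ∑ a, v a • e i a,
    Submodule.sum_mem _ fun a _ ↦ Submodule.smul_mem _ _ (W.mem_basis i a), fun h0 ↦ ?_, ?_⟩
  · have : v ≠ 0 := by
      intro hv0
      have := hC.eigenvectorBasis.orthonormal.1 a₀
      rw [← hvdef, hv0, norm_zero] at this
      exact zero_ne_one this
    apply this
    ext b
    rw [← hXb b, h0]
    simp
  · have hb : ∀ b, casimirForm e j (∑ a, v a • e i a) (e i b) =
        s * negKilling L (∑ a, v a • e i a) (e i b) := fun b ↦ by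
      rw [hXb, casimirForm_sum_left]
      have := congr_fun hv b
      simp only [Matrix.mulVec, dotProduct, C, Matrix.of_apply, Pi.smul_apply, smul_eq_mul] at this
      rw [← this]
      refine Finset.sum_congr rfl fun a _ ↦ ?_
      rw [casimirForm_comm e j (e i b), casimirForm, casimirForm, mul_comm, Finset.mul_sum]
      exact Finset.sum_congr rfl fun c _ ↦ by
        rw [lie_smul, map_smul, LinearMap.smul_apply, smul_eq_mul]
    intro Z hZ
    have hZ' : Z = ∑ b, negKilling L (e i b) Z • e i b := by
      rw [← wallachProj_apply, W.proj_of_mem hZ]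
    rw [hZ', casimirForm_comm, casimirForm_sum_left, map_sum, Finset.mul_sum]
    refine Finset.sum_congr rfl fun b _ ↦ ?_
    rw [map_smul, smul_eq_mul, mul_left_comm, ← hb b, casimirForm_comm _ _ _ (e i b), casimirForm,
      casimirForm, Finset.mul_sum]
    exact Finset.sum_congr rfl fun c _ ↦ by
      rw [lie_smul, map_smul, LinearMap.smul_apply, smul_eq_mul]

/-- Schur's lemma: if a family of automorphisms acts irreducibly on `m i`, the partial Casimir
forms are multiples of the Killing form on `m i`, because an eigenspace is an invariant subspace. -/
lemma casimirForm_schur [Module.Finite ℝ L] {S : Set (L ≃ₗ⁅ℝ⁆ L)}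
    (hS : ∀ A ∈ S, PreservesSummands m A) (i j : Fin 3) (hi : 0 < d i)
    (hirr : ∀ V ≤ m i, (∀ A ∈ S, ∀ X ∈ V, A X ∈ V) → V = ⊥ ∨ V = m i) :
    ∃ s : ℝ, ∀ Y ∈ m i, ∀ Z ∈ m i, casimirForm e j Y Z = s * negKilling L Y Z := by
  obtain ⟨s, X, hX, hX0, hXs⟩ := W.exists_casimir_eigenvector i j hi
  let V : Submodule ℝ L :=
    { carrier := {Y | Y ∈ m i ∧ ∀ Z ∈ m i, casimirForm e j Y Z = s * negKilling L Y Z}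
      zero_mem' := ⟨Submodule.zero_mem _, fun Z _ ↦ by simp [casimirForm]⟩
      add_mem' := fun {Y Y'} h1 h2 ↦ ⟨Submodule.add_mem _ h1.1 h2.1, fun Z hZ ↦ by
        rw [map_add, LinearMap.add_apply, mul_add, ← h1.2 Z hZ, ← h2.2 Z hZ]
        simp only [casimirForm, lie_add, map_add, LinearMap.add_apply, Finset.sum_add_distrib]⟩
      smul_mem' := fun t Y h1 ↦ ⟨Submodule.smul_mem _ _ h1.1, fun Z hZ ↦ by
        rw [map_smul, LinearMap.smul_apply, smul_eq_mul, mul_left_comm, ← h1.2 Z hZ]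
        simp only [casimirForm, lie_smul, map_smul, LinearMap.smul_apply, smul_eq_mul,
          Finset.mul_sum]⟩ }
  have hV : V = m i := by
    refine (hirr V (fun Y hY ↦ hY.1) fun A hA Y hY ↦
      ⟨(hS A hA i Y hY.1).1, fun Z hZ ↦ ?_⟩).resolve_left fun h0 ↦ hX0 ?_
    · have := W.casimirForm_equiv (hS A hA) j Y (A.symm Z)
      rw [LieEquiv.apply_symm_apply] at this
      rw [this, hY.2 _ (hS A hA i Z hZ).2, negKilling_equiv_left]
    · have : X ∈ V := ⟨hX, hXs⟩
      rwa [h0, Submodule.mem_bot] at this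
  exact ⟨s, fun Y hY Z hZ ↦ by rw [← hV] at hY; exact hY.2 Z hZ⟩

end IsWallachDecomposition

end WallachAutomorphism

/-! ### The Lie bracket of vector fields acting on functions -/

section LieBracketOnFunctions

open VectorField Set Filter
open scoped Topology

variable {n : ℕ} {N : Type*} [TopologicalSpace N] [ChartedSpace (EuclideanSpace ℝ (Fin n)) N]
  [IsManifold (𝓡 n) ∞ N]

/-- The representative of the vector field `V` in the chart around `x`. -/
noncomputable def chartVectorField (x : N) (V : Π y : N, TangentSpace (𝓡 n) y) :
    EuclideanSpace ℝ (Fin n) → EuclideanSpace ℝ (Fin n) :=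
  mpullbackWithin 𝓘(ℝ, EuclideanSpace ℝ (Fin n)) (𝓡 n) (extChartAt (𝓡 n) x).symm V
    (range (𝓡 n))

lemma mfderiv_extChartAt_apply_vectorField (x : N) (V : Π y : N, TangentSpace (𝓡 n) y) {y : N}
    (hy : y ∈ (extChartAt (𝓡 n) x).source) :
    mfderiv (𝓡 n) 𝓘(ℝ, EuclideanSpace ℝ (Fin n)) (extChartAt (𝓡 n) x) y (V y) =
      chartVectorField x V (extChartAt (𝓡 n) x y) := by
  have key : ∀ u ∈ (extChartAt (𝓡 n) x).target,
      mfderiv (𝓡 n) 𝓘(ℝ, EuclideanSpace ℝ (Fin n)) (extChartAt (𝓡 n) x)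
        ((extChartAt (𝓡 n) x).symm u) (V ((extChartAt (𝓡 n) x).symm u)) =
      chartVectorField x V u := by
    intro u hu
    have h1 := mfderiv_extChartAt_comp_mfderivWithin_extChartAt_symm (I := 𝓡 n) hu
    have h2 := mfderivWithin_extChartAt_symm_comp_mfderiv_extChartAt (I := 𝓡 n) hu
    have h3 := ContinuousLinearMap.inverse_eq h2 h1
    rw [chartVectorField, mpullbackWithin_apply]
    exact (congrArg (fun A ↦ A (V ((extChartAt (𝓡 n) x).symm u))) h3).symm
  have := key _ ((extChartAt (𝓡 n) x).map_source hy)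
  rwa [(extChartAt (𝓡 n) x).left_inv hy] at this

lemma differentiableAt_chartVectorField {x : N} {V : Π y : N, TangentSpace (𝓡 n) y}
    (hV : MDifferentiableAt (𝓡 n) (𝓡 n).tangent
      (fun y ↦ (⟨y, V y⟩ : TangentBundle (𝓡 n) N)) x) :
    DifferentiableAt ℝ (chartVectorField x V) (extChartAt (𝓡 n) x x) := by
  have := MDifferentiableWithinAt.differentiableWithinAt_mpullbackWithin_vectorField
    (s := univ) (mdifferentiableWithinAt_univ.2 hV)
  rw [preimage_univ, univ_inter] at this
  have h : DifferentiableWithinAt ℝ (chartVectorField x V) (range (𝓡 n))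
    (extChartAt (𝓡 n) x x) := this
  rw [ModelWithCorners.Boundaryless.range_eq_univ] at h
  exact differentiableWithinAt_univ.1 h

omit [IsManifold (𝓡 n) ∞ N] in
lemma contDiffAt_comp_extChartAt_symm {f : N → ℝ} {x : N} {k : ℕ∞ω}
    (hf : ContMDiffAt (𝓡 n) 𝓘(ℝ) k f x) :
    ContDiffAt ℝ k (f ∘ (extChartAt (𝓡 n) x).symm) (extChartAt (𝓡 n) x x) := by
  have := (contMDiffAt_iff.1 hf).2
  rw [ModelWithCorners.Boundaryless.range_eq_univ, contDiffWithinAt_univ] at this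
  exact this

lemma mvfderiv_apply_eq_fderiv {f : N → ℝ} {x y : N} (hy : y ∈ (extChartAt (𝓡 n) x).source)
    (hf : DifferentiableAt ℝ (f ∘ (extChartAt (𝓡 n) x).symm) (extChartAt (𝓡 n) x y))
    (v : TangentSpace (𝓡 n) y) :
    mvfderiv (𝓡 n) f y v = fderiv ℝ (f ∘ (extChartAt (𝓡 n) x).symm) (extChartAt (𝓡 n) x y)
      (mfderiv (𝓡 n) 𝓘(ℝ, EuclideanSpace ℝ (Fin n)) (extChartAt (𝓡 n) x) y v) := by
  have h1 : f =ᶠ[𝓝 y] (f ∘ (extChartAt (𝓡 n) x).symm) ∘ extChartAt (𝓡 n) x := by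
    filter_upwards [(isOpen_extChartAt_source (I := 𝓡 n) x).mem_nhds hy] with w hw
    simp only [Function.comp_apply, (extChartAt (𝓡 n) x).left_inv hw]
  have h2 : MDifferentiableAt (𝓡 n) 𝓘(ℝ, EuclideanSpace ℝ (Fin n)) (extChartAt (𝓡 n) x) y :=
    mdifferentiableAt_extChartAt (by rwa [extChartAt_source] at hy)
  have h3 := mvfderiv_comp_apply y hf.mdifferentiableAt h2 (v := v)
  have h4 : mvfderiv (𝓡 n) f y =
      mvfderiv (𝓡 n) ((f ∘ (extChartAt (𝓡 n) x).symm) ∘ extChartAt (𝓡 n) x) y := by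
    unfold mvfderiv
    rw [h1.mfderiv_eq]
    congr 1
  rw [h4]
  refine h3.trans ?_
  simp only [mvfderiv, mfderiv_eq_fderiv]
  rfl

/-- The derivative of a function along a vector field, in the chart around `x`. -/
lemma mvfderiv_apply_vectorField_eventuallyEq {f : N → ℝ} {x : N}
    (hf : ContMDiffAt (𝓡 n) 𝓘(ℝ) 2 f x) (W : Π y : N, TangentSpace (𝓡 n) y) :
    (fun y ↦ mvfderiv (𝓡 n) f y (W y)) =ᶠ[𝓝 x] (fun u ↦
      fderiv ℝ (f ∘ (extChartAt (𝓡 n) x).symm) u (chartVectorField x W u)) ∘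
        extChartAt (𝓡 n) x := by
  have h1 := (contDiffAt_comp_extChartAt_symm hf).eventually (by simp)
  filter_upwards [(continuousAt_extChartAt (I := 𝓡 n) x).eventually h1,
    extChartAt_source_mem_nhds (I := 𝓡 n) x] with y hy hys
  rw [mvfderiv_apply_eq_fderiv hys (hy.differentiableAt (by simp)),
    mfderiv_extChartAt_apply_vectorField x W hys]
  rfl

lemma mdifferentiableAt_mvfderiv_apply {f : N → ℝ} {x : N}
    (hf : ContMDiffAt (𝓡 n) 𝓘(ℝ) 2 f x) {W : Π y : N, TangentSpace (𝓡 n) y}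
    (hW : MDifferentiableAt (𝓡 n) (𝓡 n).tangent
      (fun y ↦ (⟨y, W y⟩ : TangentBundle (𝓡 n) N)) x) :
    MDifferentiableAt (𝓡 n) 𝓘(ℝ) (fun y ↦ mvfderiv (𝓡 n) f y (W y)) x := by
  refine MDifferentiableAt.congr_of_eventuallyEq ?_ (mvfderiv_apply_vectorField_eventuallyEq hf W)
  have h1 : DifferentiableAt ℝ (fun u ↦
      fderiv ℝ (f ∘ (extChartAt (𝓡 n) x).symm) u (chartVectorField x W u))
      (extChartAt (𝓡 n) x x) := by
    refine DifferentiableAt.clm_apply ?_ (differentiableAt_chartVectorField hW)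
    exact ((contDiffAt_comp_extChartAt_symm hf).fderiv_right (m := 1) le_rfl).differentiableAt
      one_ne_zero
  exact h1.mdifferentiableAt.comp x (mdifferentiableAt_extChartAt (mem_chart_source _ x))

omit [IsManifold (𝓡 n) ∞ N] in
lemma mvfderiv_congr_of_eventuallyEq {f f' : N → ℝ} {x : N} (h : f =ᶠ[𝓝 x] f') :
    mvfderiv (𝓡 n) f x = mvfderiv (𝓡 n) f' x := by
  unfold mvfderiv
  rw [h.mfderiv_eq, h.eq_of_nhds]

/-- The second derivative of a function along two vector fields, in the chart around `x`. -/
lemma mvfderiv_mvfderiv_apply {f : N → ℝ} {x : N}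
    (hf : ContMDiffAt (𝓡 n) 𝓘(ℝ) 2 f x) {V W : Π y : N, TangentSpace (𝓡 n) y}
    (hW : MDifferentiableAt (𝓡 n) (𝓡 n).tangent
      (fun y ↦ (⟨y, W y⟩ : TangentBundle (𝓡 n) N)) x) :
    mvfderiv (𝓡 n) (fun y ↦ mvfderiv (𝓡 n) f y (W y)) x (V x) =
      fderiv ℝ (fun u ↦ fderiv ℝ (f ∘ (extChartAt (𝓡 n) x).symm) u (chartVectorField x W u))
        (extChartAt (𝓡 n) x x) (chartVectorField x V (extChartAt (𝓡 n) x x)) := by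
  have h1 : DifferentiableAt ℝ (fun u ↦
      fderiv ℝ (f ∘ (extChartAt (𝓡 n) x).symm) u (chartVectorField x W u))
      (extChartAt (𝓡 n) x x) := by
    refine DifferentiableAt.clm_apply ?_ (differentiableAt_chartVectorField hW)
    exact ((contDiffAt_comp_extChartAt_symm hf).fderiv_right (m := 1) le_rfl).differentiableAt
      one_ne_zero
  rw [mvfderiv_congr_of_eventuallyEq (mvfderiv_apply_vectorField_eventuallyEq hf W)]
  have h3 := mvfderiv_comp_apply x h1.mdifferentiableAt
    (mdifferentiableAt_extChartAt (I := 𝓡 n) (mem_chart_source _ x)) (v := V x)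
  rw [mfderiv_extChartAt_apply_vectorField x V (mem_extChartAt_source x)] at h3
  refine h3.trans ?_
  simp only [mvfderiv, mfderiv_eq_fderiv]
  rfl

/-- The Lie bracket of vector fields acts on functions as the commutator. -/
lemma mvfderiv_mlieBracket {f : N → ℝ} {x : N}
    (hf : ContMDiffAt (𝓡 n) 𝓘(ℝ) 2 f x) {V W : Π y : N, TangentSpace (𝓡 n) y}
    (hV : MDifferentiableAt (𝓡 n) (𝓡 n).tangent
      (fun y ↦ (⟨y, V y⟩ : TangentBundle (𝓡 n) N)) x)
    (hW : MDifferentiableAt (𝓡 n) (𝓡 n).tangent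
      (fun y ↦ (⟨y, W y⟩ : TangentBundle (𝓡 n) N)) x) :
    mvfderiv (𝓡 n) f x (mlieBracket (𝓡 n) V W x) =
      mvfderiv (𝓡 n) (fun y ↦ mvfderiv (𝓡 n) f y (W y)) x (V x) -
        mvfderiv (𝓡 n) (fun y ↦ mvfderiv (𝓡 n) f y (V y)) x (W x) := by
  have hc := contDiffAt_comp_extChartAt_symm hf
  rw [mvfderiv_mvfderiv_apply hf hW, mvfderiv_mvfderiv_apply hf hV,
    ← fderiv_apply_lieBracket hc (by simp [minSmoothness_of_isRCLikeNormedField])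
      (differentiableAt_chartVectorField hW) (differentiableAt_chartVectorField hV),
    mvfderiv_apply_eq_fderiv (mem_extChartAt_source (I := 𝓡 n) x)
      (hc.differentiableAt (by simp))]
  congr 1
  rw [← mlieBracketWithin_univ, mlieBracketWithin_apply]
  refine ((isInvertible_mfderiv_extChartAt
    (mem_extChartAt_source (I := 𝓡 n) x)).self_apply_inverse _).trans ?_
  have h1 : ((extChartAt (𝓡 n) x).symm ⁻¹' univ ∩ range (𝓡 n) :
      Set (EuclideanSpace ℝ (Fin n))) = univ := by
    rw [ModelWithCorners.Boundaryless.range_eq_univ, preimage_univ, univ_inter]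
  rw [h1]
  have h2 : ∀ A B : EuclideanSpace ℝ (Fin n) → EuclideanSpace ℝ (Fin n),
      lieBracketWithin ℝ A B univ = lieBracket ℝ A B := fun A B ↦ lieBracketWithin_univ
  exact congrFun (h2 (chartVectorField x V) (chartVectorField x W)) _

end LieBracketOnFunctions

/-! ### Functions with values in finite-dimensional vector spaces -/

section FiniteDimensionalDerivative

set_option linter.unusedSectionVars false

open Set Filter
open scoped Topology

variable {n : ℕ} {N : Type*} [TopologicalSpace N] [ChartedSpace (EuclideanSpace ℝ (Fin n)) N]
  {n' : ℕ} {N' : Type*} [TopologicalSpace N'] [ChartedSpace (EuclideanSpace ℝ (Fin n')) N']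
  {U V W : Type*} [AddCommGroup U] [Module ℝ U] [Module.Finite ℝ U]
  [AddCommGroup V] [Module ℝ V] [Module.Finite ℝ V]
  [AddCommGroup W] [Module ℝ W] [Module.Finite ℝ W]

lemma mvfderiv_sum_apply {ι : Type*} (s : Finset ι) {f : ι → N → ℝ} {x : N}
    (hf : ∀ i ∈ s, MDifferentiableAt (𝓡 n) 𝓘(ℝ) (f i) x) (v : TangentSpace (𝓡 n) x) :
    MDifferentiableAt (𝓡 n) 𝓘(ℝ) (fun y ↦ ∑ i ∈ s, f i y) x ∧
    mvfderiv (𝓡 n) (fun y ↦ ∑ i ∈ s, f i y) x v = ∑ i ∈ s, mvfderiv (𝓡 n) (f i) x v := by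
  classical
  induction s using Finset.induction_on with
  | empty => exact ⟨by simpa using mdifferentiableAt_const, by simp [mvfderiv_const]⟩
  | insert a s ha ih =>
    obtain ⟨h1, h2⟩ := ih fun i hi ↦ hf i (Finset.mem_insert_of_mem hi)
    have h3 := hf a (Finset.mem_insert_self _ _)
    simp only [Finset.sum_insert ha]
    refine ⟨h3.add h1, ?_⟩
    rw [mvfderiv_fun_add h3 h1, add_apply, h2]

variable (n) in
/-- Differentiability at `x` of a function with values in a finite-dimensional real vector space
(which need not carry a norm), tested on linear functionals. -/
def DualMDifferentiableAt (F : N → V) (x : N) : Prop :=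
  ∀ ℓ : Module.Dual ℝ V, MDifferentiableAt (𝓡 n) 𝓘(ℝ) (fun y ↦ ℓ (F y)) x

variable (n) in
/-- The class `C^k` at `x` for functions with values in a finite-dimensional real vector space,
tested on linear functionals. -/
def DualContMDiffAt (k : ℕ∞ω) (F : N → V) (x : N) : Prop :=
  ∀ ℓ : Module.Dual ℝ V, ContMDiffAt (𝓡 n) 𝓘(ℝ) k (fun y ↦ ℓ (F y)) x

variable (n) in
/-- The differential at `x` of a function with values in a finite-dimensional real vector space;
it is assembled from the differentials of the components in a basis. -/
noncomputable def dualDeriv (F : N → V) (x : N) : TangentSpace (𝓡 n) x →ₗ[ℝ] V :=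
  ∑ k, ((mvfderiv (𝓡 n) (fun y ↦ (Module.finBasis ℝ V).coord k (F y)) x).toLinearMap).smulRight
    (Module.finBasis ℝ V k)

lemma dualDeriv_apply (F : N → V) (x : N) (v : TangentSpace (𝓡 n) x) :
    dualDeriv n F x v = ∑ k, mvfderiv (𝓡 n) (fun y ↦ (Module.finBasis ℝ V).coord k (F y)) x v •
      Module.finBasis ℝ V k := by
  simp [dualDeriv]

lemma apply_eq_sum_coord (ℓ : Module.Dual ℝ V) (X : V) :
    ℓ X = ∑ k, (Module.finBasis ℝ V).coord k X * ℓ (Module.finBasis ℝ V k) := by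
  conv_lhs => rw [← (Module.finBasis ℝ V).sum_repr X, map_sum]
  simp only [map_smul, smul_eq_mul, Module.Basis.coord_apply]

lemma mvfderiv_const_mul {f : N → ℝ} {x : N} (hf : MDifferentiableAt (𝓡 n) 𝓘(ℝ) f x) (c : ℝ)
    (v : TangentSpace (𝓡 n) x) :
    MDifferentiableAt (𝓡 n) 𝓘(ℝ) (fun y ↦ c * f y) x ∧
    mvfderiv (𝓡 n) (fun y ↦ c * f y) x v = c * mvfderiv (𝓡 n) f x v := by
  have hc : MDifferentiableAt (𝓡 n) 𝓘(ℝ) (fun _ : N ↦ c) x := mdifferentiableAt_const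
  refine ⟨hc.mul hf, ?_⟩
  rw [mvfderiv_fun_mul hc hf, mvfderiv_const]
  simp

/-- Linear functionals commute with differentiation; in particular the differential does not depend
on the basis in its definition. -/
lemma DualMDifferentiableAt.dual_dualDeriv {F : N → V} {x : N} (hF : DualMDifferentiableAt n F x)
    (ℓ : Module.Dual ℝ V) (v : TangentSpace (𝓡 n) x) :
    ℓ (dualDeriv n F x v) = mvfderiv (𝓡 n) (fun y ↦ ℓ (F y)) x v := by
  have h1 : (fun y ↦ ℓ (F y)) = fun y ↦ ∑ k, ℓ (Module.finBasis ℝ V k) *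
      (Module.finBasis ℝ V).coord k (F y) := by
    ext y
    rw [apply_eq_sum_coord]
    simp only [mul_comm]
  rw [h1, (mvfderiv_sum_apply Finset.univ
    (fun k _ ↦ (mvfderiv_const_mul (hF _) _ v).1) v).2, dualDeriv_apply, map_sum]
  refine Finset.sum_congr rfl fun k _ ↦ ?_
  rw [(mvfderiv_const_mul (hF _) _ v).2, map_smul, smul_eq_mul, mul_comm]

lemma eq_of_dual_eq {X Y : V} (h : ∀ ℓ : Module.Dual ℝ V, ℓ X = ℓ Y) : X = Y := by
  rw [← sub_eq_zero]
  exact (Module.forall_dual_apply_eq_zero_iff ℝ _).1 fun ℓ ↦ by rw [map_sub, h, sub_self]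

lemma DualContMDiffAt.dualMDifferentiableAt {k : ℕ∞ω} {F : N → V} {x : N}
    (hF : DualContMDiffAt n k F x) (hk : k ≠ 0) : DualMDifferentiableAt n F x :=
  fun ℓ ↦ (hF ℓ).mdifferentiableAt hk

lemma dualMDifferentiableAt_const (X : V) (x : N) : DualMDifferentiableAt n (fun _ : N ↦ X) x :=
  fun _ ↦ mdifferentiableAt_const

lemma dualDeriv_const (X : V) (x : N) (v : TangentSpace (𝓡 n) x) :
    dualDeriv n (fun _ : N ↦ X) x v = 0 :=
  eq_of_dual_eq fun ℓ ↦ by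
    rw [(dualMDifferentiableAt_const X x).dual_dualDeriv, mvfderiv_const, map_zero]
    rfl

lemma dualDeriv_congr {F F' : N → V} {x : N} (h : F =ᶠ[𝓝 x] F') :
    dualDeriv n F x = dualDeriv n F' x := by
  ext v
  rw [dualDeriv_apply, dualDeriv_apply]
  refine Finset.sum_congr rfl fun k _ ↦ ?_
  have h' : (fun y ↦ (Module.finBasis ℝ V).coord k (F y)) =ᶠ[𝓝 x]
    fun y ↦ (Module.finBasis ℝ V).coord k (F' y) := h.fun_comp _
  rw [mvfderiv_congr_of_eventuallyEq h']

lemma DualMDifferentiableAt.linearMap_comp {F : N → V} {x : N} (hF : DualMDifferentiableAt n F x)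
    (A : V →ₗ[ℝ] W) : DualMDifferentiableAt n (fun y ↦ A (F y)) x :=
  fun ℓ ↦ hF (ℓ ∘ₗ A)

lemma dualDeriv_linearMap_comp {F : N → V} {x : N} (hF : DualMDifferentiableAt n F x)
    (A : V →ₗ[ℝ] W) (v : TangentSpace (𝓡 n) x) :
    dualDeriv n (fun y ↦ A (F y)) x v = A (dualDeriv n F x v) :=
  eq_of_dual_eq fun ℓ ↦ by
    rw [(hF.linearMap_comp A).dual_dualDeriv]
    exact (hF.dual_dualDeriv (ℓ ∘ₗ A) v).symm

lemma DualMDifferentiableAt.add {F F' : N → V} {x : N} (hF : DualMDifferentiableAt n F x)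
    (hF' : DualMDifferentiableAt n F' x) : DualMDifferentiableAt n (fun y ↦ F y + F' y) x :=
  fun ℓ ↦ by simpa using! (hF ℓ).add (hF' ℓ)

lemma dualDeriv_add {F F' : N → V} {x : N} (hF : DualMDifferentiableAt n F x)
    (hF' : DualMDifferentiableAt n F' x) (v : TangentSpace (𝓡 n) x) :
    dualDeriv n (fun y ↦ F y + F' y) x v = dualDeriv n F x v + dualDeriv n F' x v :=
  eq_of_dual_eq fun ℓ ↦ by
    rw [(hF.add hF').dual_dualDeriv, map_add, hF.dual_dualDeriv, hF'.dual_dualDeriv]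
    simp only [map_add]
    rw [mvfderiv_fun_add (hF ℓ) (hF' ℓ), add_apply]

lemma mul_apply_of_bilinear (β : V →ₗ[ℝ] W →ₗ[ℝ] ℝ) (X : V) (Y : W) :
    β X Y = ∑ i, ∑ j, β (Module.finBasis ℝ V i) (Module.finBasis ℝ W j) *
      ((Module.finBasis ℝ V).coord i X * (Module.finBasis ℝ W).coord j Y) := by
  conv_lhs => rw [← (Module.finBasis ℝ V).sum_repr X, ← (Module.finBasis ℝ W).sum_repr Y]
  simp only [map_sum, map_smul, LinearMap.coe_sum, Finset.sum_apply, LinearMap.smul_apply,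
    smul_eq_mul, Module.Basis.coord_apply, Finset.mul_sum]
  rw [Finset.sum_comm]
  refine Finset.sum_congr rfl fun i _ ↦ Finset.sum_congr rfl fun j _ ↦ by ring

lemma mvfderiv_bilinear {F : N → V} {F' : N → W} {x : N} (hF : DualMDifferentiableAt n F x)
    (hF' : DualMDifferentiableAt n F' x) (β : V →ₗ[ℝ] W →ₗ[ℝ] ℝ) (v : TangentSpace (𝓡 n) x) :
    MDifferentiableAt (𝓡 n) 𝓘(ℝ) (fun y ↦ β (F y) (F' y)) x ∧
    mvfderiv (𝓡 n) (fun y ↦ β (F y) (F' y)) x v =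
      β (dualDeriv n F x v) (F' x) + β (F x) (dualDeriv n F' x v) := by
  have h0 : (fun y ↦ β (F y) (F' y)) = fun y ↦ ∑ i, ∑ j, _ :=
    funext fun y ↦ mul_apply_of_bilinear β (F y) (F' y)
  have h1 : ∀ i j, MDifferentiableAt (𝓡 n) 𝓘(ℝ) (fun y ↦
      (Module.finBasis ℝ V).coord i (F y) * (Module.finBasis ℝ W).coord j (F' y)) x :=
    fun i j ↦ (hF _).mul (hF' _)
  have h2 := fun i j ↦ mvfderiv_const_mul (h1 i j)
    (β (Module.finBasis ℝ V i) (Module.finBasis ℝ W j)) v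
  have h3 := fun i ↦ mvfderiv_sum_apply Finset.univ (fun j _ ↦ (h2 i j).1) v
  have h4 := mvfderiv_sum_apply Finset.univ (fun i _ ↦ (h3 i).1) v
  rw [h0]
  refine ⟨h4.1, ?_⟩
  rw [h4.2, mul_apply_of_bilinear β, mul_apply_of_bilinear β, ← Finset.sum_add_distrib]
  refine Finset.sum_congr rfl fun i _ ↦ ?_
  rw [(h3 i).2, ← Finset.sum_add_distrib]
  refine Finset.sum_congr rfl fun j _ ↦ ?_
  rw [(h2 i j).2, mvfderiv_fun_mul (hF _) (hF' _), hF.dual_dualDeriv, hF'.dual_dualDeriv]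
  simp only [add_apply, smul_apply, smul_eq_mul]
  ring

lemma DualContMDiffAt.bilinear {k : ℕ∞ω} {F : N → V} {F' : N → W} {x : N}
    (hF : DualContMDiffAt n k F x) (hF' : DualContMDiffAt n k F' x) (β : V →ₗ[ℝ] W →ₗ[ℝ] ℝ) :
    ContMDiffAt (𝓡 n) 𝓘(ℝ) k (fun y ↦ β (F y) (F' y)) x := by
  have h0 : (fun y ↦ β (F y) (F' y)) = fun y ↦ ∑ i, ∑ j, _ :=
    funext fun y ↦ mul_apply_of_bilinear β (F y) (F' y)
  rw [h0]
  exact contMDiffAt_finsetSum fun i _ ↦ contMDiffAt_finsetSum fun j _ ↦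
    contMDiffAt_const.mul ((hF _).mul (hF' _))

lemma DualMDifferentiableAt.bilinear {F : N → V} {F' : N → W} {x : N}
    (hF : DualMDifferentiableAt n F x) (hF' : DualMDifferentiableAt n F' x)
    (β : V →ₗ[ℝ] W →ₗ[ℝ] U) : DualMDifferentiableAt n (fun y ↦ β (F y) (F' y)) x :=
  fun ℓ ↦ (mvfderiv_bilinear hF hF' (β.compr₂ ℓ) 0).1

/-- The product rule. -/
lemma dualDeriv_bilinear {F : N → V} {F' : N → W} {x : N} (hF : DualMDifferentiableAt n F x)
    (hF' : DualMDifferentiableAt n F' x) (β : V →ₗ[ℝ] W →ₗ[ℝ] U) (v : TangentSpace (𝓡 n) x) :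
    dualDeriv n (fun y ↦ β (F y) (F' y)) x v =
      β (dualDeriv n F x v) (F' x) + β (F x) (dualDeriv n F' x v) :=
  eq_of_dual_eq fun ℓ ↦ by
    rw [(hF.bilinear hF' β).dual_dualDeriv, map_add]
    exact (mvfderiv_bilinear hF hF' (β.compr₂ ℓ) v).2

lemma DualMDifferentiableAt.comp {F : N → V} {f : N' → N} {x : N'}
    (hF : DualMDifferentiableAt n F (f x)) (hf : MDifferentiableAt (𝓡 n') (𝓡 n) f x) :
    DualMDifferentiableAt n' (fun y ↦ F (f y)) x :=
  fun ℓ ↦ (hF ℓ).comp x hf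

lemma mdifferentiableAt_iff_dualMDifferentiableAt {f : N → ℝ} {x : N} :
    DualMDifferentiableAt n f x ↔ MDifferentiableAt (𝓡 n) 𝓘(ℝ) f x := by
  refine ⟨fun h ↦ h LinearMap.id, fun h ℓ ↦ ?_⟩
  have : (fun y ↦ ℓ (f y)) = fun y ↦ ℓ 1 * f y := by
    ext y
    conv_lhs => rw [← mul_one (f y), ← smul_eq_mul, map_smul, smul_eq_mul, mul_comm]
  rw [this]
  exact (mvfderiv_const_mul h _ 0).1

lemma dualDeriv_eq_mvfderiv {f : N → ℝ} {x : N} (h : MDifferentiableAt (𝓡 n) 𝓘(ℝ) f x)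
    (v : TangentSpace (𝓡 n) x) : dualDeriv n f x v = mvfderiv (𝓡 n) f x v :=
  (mdifferentiableAt_iff_dualMDifferentiableAt.2 h).dual_dualDeriv LinearMap.id v

end FiniteDimensionalDerivative

/-! ### Mixed partial derivatives -/

section MixedPartials

set_option linter.unusedSectionVars false

open Set Filter
open scoped Topology

variable {n : ℕ} {N : Type*} [TopologicalSpace N] [ChartedSpace (EuclideanSpace ℝ (Fin n)) N]
  [IsManifold (𝓡 n) ∞ N]
  {n' : ℕ} {N' : Type*} [TopologicalSpace N'] [ChartedSpace (EuclideanSpace ℝ (Fin n')) N']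
  [IsManifold (𝓡 n') ∞ N']

/-- Every covector is the differential of a smooth function. -/
lemma exists_mvfderiv_eq (x : N) (ℓ : TangentSpace (𝓡 n) x →ₗ[ℝ] ℝ) :
    ∃ f : N → ℝ, ContMDiffAt (𝓡 n) 𝓘(ℝ) ∞ f x ∧ ∀ v, mvfderiv (𝓡 n) f x v = ℓ v := by
  let E := EuclideanSpace ℝ (Fin n)
  let A : TangentSpace (𝓡 n) x →L[ℝ] E := mfderiv (𝓡 n) 𝓘(ℝ, E) (extChartAt (𝓡 n) x) x
  obtain ⟨B, hB⟩ : A.IsInvertible := isInvertible_mfderiv_extChartAt (mem_extChartAt_source x)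
  let l : E →L[ℝ] ℝ := LinearMap.toContinuousLinearMap (ℓ ∘ₗ B.symm.toLinearMap : E →ₗ[ℝ] ℝ)
  have h1 : ContMDiffAt 𝓘(ℝ, E) 𝓘(ℝ) ∞ l (extChartAt (𝓡 n) x x) := l.contDiff.contMDiff _
  refine ⟨l ∘ extChartAt (𝓡 n) x, h1.comp x contMDiffAt_extChartAt, fun v ↦ ?_⟩
  have h3 := mvfderiv_comp_apply x (h1.mdifferentiableAt (by simp))
    (mdifferentiableAt_extChartAt (I := 𝓡 n) (mem_chart_source _ x)) (v := v)
  rw [h3]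
  have h4 : mvfderiv 𝓘(ℝ, E) l (extChartAt (𝓡 n) x x) = l := by
    simp only [mvfderiv, mfderiv_eq_fderiv]
    exact l.fderiv
  rw [h4]
  change ℓ (B.symm (A v)) = ℓ v
  rw [← hB]
  simp

/-- Tangent vectors are determined by their action on smooth functions. -/
lemma eq_of_mvfderiv_eq {x : N} {v w : TangentSpace (𝓡 n) x}
    (h : ∀ f : N → ℝ, ContMDiffAt (𝓡 n) 𝓘(ℝ) ∞ f x →
      mvfderiv (𝓡 n) f x v = mvfderiv (𝓡 n) f x w) : v = w := by
  have : Module.Finite ℝ (TangentSpace (𝓡 n) x) :=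
    inferInstanceAs (Module.Finite ℝ (EuclideanSpace ℝ (Fin n)))
  refine eq_of_dual_eq fun ℓ ↦ ?_
  obtain ⟨f, hf, hℓ⟩ := exists_mvfderiv_eq x ℓ
  rw [← hℓ, ← hℓ, h f hf]

variable {F : N → N' → ℝ} {x : N} {y : N'}

lemma contDiffAt_comp_extChartAt_symm_prod
    (hF : ContMDiffAt ((𝓡 n).prod (𝓡 n')) 𝓘(ℝ) 2 (fun p : N × N' ↦ F p.1 p.2) (x, y)) :
    ContDiffAt ℝ 2 (fun p : EuclideanSpace ℝ (Fin n) × EuclideanSpace ℝ (Fin n') ↦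
      F ((extChartAt (𝓡 n) x).symm p.1) ((extChartAt (𝓡 n') y).symm p.2))
      (extChartAt (𝓡 n) x x, extChartAt (𝓡 n') y y) := by
  have := (contMDiffAt_iff.1 hF).2
  rw [ModelWithCorners.Boundaryless.range_eq_univ, contDiffWithinAt_univ] at this
  exact this

/-- A mixed second derivative on a product of manifolds, in charts.  With `v = 0` the first part
says that a partial derivative of a `C^2` function of two variables is differentiable in the other
variable. -/
lemma mvfderiv_mvfderiv_right
    (hF : ContMDiffAt ((𝓡 n).prod (𝓡 n')) 𝓘(ℝ) 2 (fun p : N × N' ↦ F p.1 p.2) (x, y))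
    (v : TangentSpace (𝓡 n) x) (w : TangentSpace (𝓡 n') y) :
    MDifferentiableAt (𝓡 n) 𝓘(ℝ) (fun a ↦ mvfderiv (𝓡 n') (F a) y w) x ∧
    mvfderiv (𝓡 n) (fun a ↦ mvfderiv (𝓡 n') (F a) y w) x v =
      fderiv ℝ (fderiv ℝ (fun p : EuclideanSpace ℝ (Fin n) × EuclideanSpace ℝ (Fin n') ↦
        F ((extChartAt (𝓡 n) x).symm p.1) ((extChartAt (𝓡 n') y).symm p.2)))
        (extChartAt (𝓡 n) x x, extChartAt (𝓡 n') y y)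
        (mfderiv (𝓡 n) 𝓘(ℝ, EuclideanSpace ℝ (Fin n)) (extChartAt (𝓡 n) x) x v, 0)
        (0, mfderiv (𝓡 n') 𝓘(ℝ, EuclideanSpace ℝ (Fin n')) (extChartAt (𝓡 n') y) y w) := by
  have hc := contDiffAt_comp_extChartAt_symm_prod hF
  set K := fun p : EuclideanSpace ℝ (Fin n) × EuclideanSpace ℝ (Fin n') ↦
        F ((extChartAt (𝓡 n) x).symm p.1) ((extChartAt (𝓡 n') y).symm p.2)
  set v' : EuclideanSpace ℝ (Fin n) :=
    mfderiv (𝓡 n) 𝓘(ℝ, EuclideanSpace ℝ (Fin n)) (extChartAt (𝓡 n) x) x v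
  set w' : EuclideanSpace ℝ (Fin n') :=
    mfderiv (𝓡 n') 𝓘(ℝ, EuclideanSpace ℝ (Fin n')) (extChartAt (𝓡 n') y) y w with hw'
  let g : EuclideanSpace ℝ (Fin n) → ℝ := fun u ↦ fderiv ℝ K (u, extChartAt (𝓡 n') y y) (0, w')
  have hpair : HasFDerivAt (fun u : EuclideanSpace ℝ (Fin n) ↦ (u, extChartAt (𝓡 n') y y))
      (ContinuousLinearMap.inl ℝ _ _) (extChartAt (𝓡 n) x x) := hasFDerivAt_prodMk_left _ _
  have hK2 : HasFDerivAt (fderiv ℝ K) _ (extChartAt (𝓡 n) x x, extChartAt (𝓡 n') y y) :=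
    ((hc.fderiv_right (m := 1) le_rfl).differentiableAt one_ne_zero).hasFDerivAt
  have hg : HasFDerivAt g _ (extChartAt (𝓡 n) x x) :=
    (hK2.comp (extChartAt (𝓡 n) x x) hpair).clm_apply (hasFDerivAt_const (0, w') _)
  have h0 : (fun a ↦ mvfderiv (𝓡 n') (F a) y w) =ᶠ[𝓝 x] g ∘ extChartAt (𝓡 n) x := by
    have h1 := hc.eventually (by simp)
    have h2 : Tendsto (fun a ↦ (extChartAt (𝓡 n) x a, extChartAt (𝓡 n') y y)) (𝓝 x)
        (𝓝 (extChartAt (𝓡 n) x x, extChartAt (𝓡 n') y y)) :=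
      (continuousAt_extChartAt (I := 𝓡 n) x).prodMk continuousAt_const
    filter_upwards [h2.eventually h1, extChartAt_source_mem_nhds (I := 𝓡 n) x] with a ha has
    have h3 : HasFDerivAt (fun u : EuclideanSpace ℝ (Fin n') ↦ K (extChartAt (𝓡 n) x a, u))
        _ (extChartAt (𝓡 n') y y) :=
      (ha.differentiableAt (by simp)).hasFDerivAt.comp (extChartAt (𝓡 n') y y)
        (hasFDerivAt_prodMk_right _ _)
    have h4 : (fun u : EuclideanSpace ℝ (Fin n') ↦ K (extChartAt (𝓡 n) x a, u)) =
        F a ∘ (extChartAt (𝓡 n') y).symm := by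
      ext u
      simp only [K, (extChartAt (𝓡 n) x).left_inv has, Function.comp_apply]
    rw [h4] at h3
    rw [mvfderiv_apply_eq_fderiv (mem_extChartAt_source (I := 𝓡 n') y) h3.differentiableAt,
      h3.fderiv, ← hw']
    simp [g]
  have h5 := mvfderiv_comp_apply x hg.differentiableAt.mdifferentiableAt
    (mdifferentiableAt_extChartAt (I := 𝓡 n) (mem_chart_source _ x)) (v := v)
  refine ⟨(hg.differentiableAt.mdifferentiableAt.comp x
    (mdifferentiableAt_extChartAt (mem_chart_source _ x))).congr_of_eventuallyEq h0, ?_⟩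
  rw [mvfderiv_congr_of_eventuallyEq h0]
  refine h5.trans ?_
  have h6 : mvfderiv 𝓘(ℝ, EuclideanSpace ℝ (Fin n)) g (extChartAt (𝓡 n) x x) =
      fderiv ℝ g (extChartAt (𝓡 n) x x) := by
    simp only [mvfderiv, mfderiv_eq_fderiv]
    rfl
  rw [h6, hg.fderiv]
  change fderiv ℝ K _ 0 + (fderiv ℝ (fderiv ℝ K) _) (ContinuousLinearMap.inl ℝ _ _ v') (0, w') = _
  simp

lemma fderiv_fderiv_comp_swap {E E' : Type*} [NormedAddCommGroup E] [NormedSpace ℝ E]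
    [NormedAddCommGroup E'] [NormedSpace ℝ E'] {K : E × E' → ℝ} {p : E × E'}
    (hK : ContDiffAt ℝ 2 K p) (v : E) (w : E') :
    fderiv ℝ (fderiv ℝ (fun q : E' × E ↦ K (q.2, q.1))) (p.2, p.1) (w, 0) (0, v) =
      fderiv ℝ (fderiv ℝ K) p (0, w) (v, 0) := by
  let s : (E' × E) ≃L[ℝ] (E × E') := ContinuousLinearEquiv.prodComm ℝ E' E
  have h1 : (fderiv ℝ (fun q : E' × E ↦ K (q.2, q.1))) =
      fun q ↦ (fderiv ℝ K (s q)).comp (s : (E' × E) →L[ℝ] (E × E')) := by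
    ext1 q
    exact s.comp_right_fderiv (f := K) (x := q)
  have h2 : HasFDerivAt (fderiv ℝ K) (fderiv ℝ (fderiv ℝ K) p) (s (p.2, p.1)) :=
    ((hK.fderiv_right (m := 1) le_rfl).differentiableAt one_ne_zero).hasFDerivAt
  have h3 := ((h2.comp (p.2, p.1) s.hasFDerivAt).clm_comp
    (hasFDerivAt_const (s : (E' × E) →L[ℝ] (E × E')) (p.2, p.1)))
  rw [h1]
  have h4 := h3.fderiv
  simp only [Function.comp_apply] at h4
  rw [h4]
  simp [s]

/-- Partial derivatives in two variables commute. -/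
lemma mvfderiv_mvfderiv_comm
    (hF : ContMDiffAt ((𝓡 n).prod (𝓡 n')) 𝓘(ℝ) 2 (fun p : N × N' ↦ F p.1 p.2) (x, y))
    (v : TangentSpace (𝓡 n) x) (w : TangentSpace (𝓡 n') y) :
    mvfderiv (𝓡 n) (fun a ↦ mvfderiv (𝓡 n') (F a) y w) x v =
      mvfderiv (𝓡 n') (fun b ↦ mvfderiv (𝓡 n) (fun a ↦ F a b) x v) y w := by
  have hF' : ContMDiffAt ((𝓡 n').prod (𝓡 n)) 𝓘(ℝ) 2
      (fun p : N' × N ↦ (fun b a ↦ F a b) p.1 p.2) (y, x) :=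
    ContMDiffAt.comp (y, x) (f := fun p : N' × N ↦ (p.2, p.1))
      (g := fun p : N × N' ↦ F p.1 p.2) hF (contMDiffAt_snd.prodMk contMDiffAt_fst)
  have hc := contDiffAt_comp_extChartAt_symm_prod hF
  have h1 := (mvfderiv_mvfderiv_right (F := fun b a ↦ F a b) hF' w v).2
  rw [(mvfderiv_mvfderiv_right hF v w).2]
  refine Eq.trans ?_ h1.symm
  refine Eq.trans ?_ (fderiv_fderiv_comp_swap hc _ _).symm
  exact (hc.isSymmSndFDerivAt (by simp [minSmoothness_of_isRCLikeNormedField])).eq _ _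

end MixedPartials

/-! ### Left-invariant derivatives and the adjoint representation -/

section Adjoint

set_option linter.unusedSectionVars false

open Set Filter VectorField
open scoped Topology

variable {n : ℕ} {G : Type*} [TopologicalSpace G] [ChartedSpace (EuclideanSpace ℝ (Fin n)) G]
  [Group G]

instance finite_groupLieAlgebra : Module.Finite ℝ (GroupLieAlgebra (𝓡 n) G) :=
  inferInstanceAs (Module.Finite ℝ (EuclideanSpace ℝ (Fin n)))

/-- The differential at the identity of the left translation by `b`. -/
noncomputable def leftTranslation (b : G) :
    GroupLieAlgebra (𝓡 n) G →ₗ[ℝ] TangentSpace (𝓡 n) b where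
  toFun X := mulInvariantVectorField X b
  map_add' X Y := by rw [mulInvariantVectorField_add]; rfl
  map_smul' c X := by rw [mulInvariantVectorField_smul]; rfl

/-- The adjoint representation `Ad a` as a linear map. -/
noncomputable def adjointRepLinear (a : G) :
    GroupLieAlgebra (𝓡 n) G →ₗ[ℝ] GroupLieAlgebra (𝓡 n) G where
  toFun X := adjointRep a X
  map_add' X Y := map_add (mfderiv (𝓡 n) (𝓡 n) (fun x : G ↦ a * x * a⁻¹) 1 :
    EuclideanSpace ℝ (Fin n) →L[ℝ] EuclideanSpace ℝ (Fin n)) X Y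
  map_smul' c X := map_smul (mfderiv (𝓡 n) (𝓡 n) (fun x : G ↦ a * x * a⁻¹) 1 :
    EuclideanSpace ℝ (Fin n) →L[ℝ] EuclideanSpace ℝ (Fin n)) c X

variable [LieGroup (𝓡 n) ∞ G]

variable {V : Type*} [AddCommGroup V] [Module ℝ V] [Module.Finite ℝ V]

variable (n) in
/-- The derivatives at `b` of a vector-valued function along the left-invariant vector fields. -/
noncomputable def leftDeriv (F : G → V) (b : G) : GroupLieAlgebra (𝓡 n) G →ₗ[ℝ] V :=
  dualDeriv n F b ∘ₗ leftTranslation b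

lemma contMDiff_left_mul (a : G) : ContMDiff (𝓡 n) (𝓡 n) ∞ (fun x : G ↦ a * x) :=
  contMDiff_mul_left

lemma contMDiff_right_mul (a : G) : ContMDiff (𝓡 n) (𝓡 n) ∞ (fun x : G ↦ x * a) :=
  contMDiff_mul_right

lemma contMDiff_conj (a : G) : ContMDiff (𝓡 n) (𝓡 n) ∞ (fun x : G ↦ a * x * a⁻¹) :=
  (contMDiff_right_mul a⁻¹).comp (contMDiff_left_mul a)

lemma mvfderiv_leftTranslation {f : G → ℝ} {b : G} (hf : MDifferentiableAt (𝓡 n) 𝓘(ℝ) f b)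
    (X : GroupLieAlgebra (𝓡 n) G) :
    mvfderiv (𝓡 n) f b (leftTranslation b X) = mvfderiv (𝓡 n) (fun x ↦ f (b * x)) 1 X :=
  (mvfderiv_comp_apply_of_eq 1 hf ((contMDiff_left_mul b).mdifferentiableAt (by simp))
    (mul_one b) X).symm

lemma mvfderiv_adjointRep {f : G → ℝ} (hf : MDifferentiableAt (𝓡 n) 𝓘(ℝ) f 1) (a : G)
    (X : GroupLieAlgebra (𝓡 n) G) :
    mvfderiv (𝓡 n) f 1 (adjointRep a X) = mvfderiv (𝓡 n) (fun x ↦ f (a * x * a⁻¹)) 1 X :=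
  (mvfderiv_comp_apply_of_eq 1 hf ((contMDiff_conj a).mdifferentiableAt (by simp))
    (by simp) X).symm

lemma adjointRep_mul (a b : G) (X : GroupLieAlgebra (𝓡 n) G) :
    adjointRep (a * b) X = adjointRep a (adjointRep b X) := by
  refine eq_of_mvfderiv_eq (N := G) fun f hf ↦ ?_
  have hf' := hf.mdifferentiableAt (n := ∞) (by simp)
  have h : MDifferentiableAt (𝓡 n) 𝓘(ℝ) (fun x ↦ f (a * x * a⁻¹)) 1 :=
    MDifferentiableAt.comp_of_eq (I' := 𝓡 n) (1 : G) (g := f) hf'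
      ((contMDiff_conj a).mdifferentiableAt (by simp)) (by simp)
  rw [mvfderiv_adjointRep hf', mvfderiv_adjointRep hf', mvfderiv_adjointRep h]
  simp only [mul_inv_rev, mul_assoc]

lemma adjointRep_one (X : GroupLieAlgebra (𝓡 n) G) : adjointRep (1 : G) X = X := by
  refine eq_of_mvfderiv_eq (N := G) fun f hf ↦ ?_
  rw [mvfderiv_adjointRep (hf.mdifferentiableAt (n := ∞) (by simp))]
  simp

lemma mvfderiv_comp_mul_left {f : G → ℝ} {a b : G}
    (hf : MDifferentiableAt (𝓡 n) 𝓘(ℝ) f (a * b)) (X : GroupLieAlgebra (𝓡 n) G) :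
    mvfderiv (𝓡 n) (fun y ↦ f (a * y)) b (leftTranslation b X) =
      mvfderiv (𝓡 n) f (a * b) (leftTranslation (a * b) X) := by
  have h : MDifferentiableAt (𝓡 n) 𝓘(ℝ) (fun y ↦ f (a * y)) b :=
    MDifferentiableAt.comp (I' := 𝓡 n) b (g := f) hf
      ((contMDiff_left_mul a).mdifferentiableAt (by simp))
  rw [mvfderiv_leftTranslation hf, mvfderiv_leftTranslation h]
  simp only [mul_assoc]

/-- Right translations turn the left-invariant frame by the adjoint representation. -/
lemma mvfderiv_comp_mul_right {f : G → ℝ} {a b : G}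
    (hf : MDifferentiableAt (𝓡 n) 𝓘(ℝ) f (b * a)) (X : GroupLieAlgebra (𝓡 n) G) :
    mvfderiv (𝓡 n) (fun y ↦ f (y * a)) b (leftTranslation b X) =
      mvfderiv (𝓡 n) f (b * a) (leftTranslation (b * a) (adjointRep a⁻¹ X)) := by
  have h : MDifferentiableAt (𝓡 n) 𝓘(ℝ) (fun y ↦ f (y * a)) b :=
    MDifferentiableAt.comp (I' := 𝓡 n) b (g := f) hf
      ((contMDiff_right_mul a).mdifferentiableAt (by simp))
  have h' : MDifferentiableAt (𝓡 n) 𝓘(ℝ) (fun x ↦ f (b * a * x)) 1 :=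
    MDifferentiableAt.comp_of_eq (I' := 𝓡 n) (1 : G) (g := f) hf
      ((contMDiff_left_mul (b * a)).mdifferentiableAt (by simp)) (by simp)
  rw [mvfderiv_leftTranslation hf, mvfderiv_leftTranslation h, mvfderiv_adjointRep h']
  congr 2
  ext x
  group

lemma leftDeriv_apply (F : G → V) (b : G) (X : GroupLieAlgebra (𝓡 n) G) :
    leftDeriv n F b X = dualDeriv n F b (leftTranslation b X) := rfl

lemma dual_leftDeriv {F : G → V} {b : G} (hF : DualMDifferentiableAt n F b) (ℓ : Module.Dual ℝ V)
    (X : GroupLieAlgebra (𝓡 n) G) :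
    ℓ (leftDeriv n F b X) = mvfderiv (𝓡 n) (fun y ↦ ℓ (F y)) b (leftTranslation b X) :=
  hF.dual_dualDeriv ℓ _

lemma leftDeriv_comp_mul_right {F : G → V} {a b : G} (hF : DualMDifferentiableAt n F (b * a))
    (X : GroupLieAlgebra (𝓡 n) G) :
    leftDeriv n (fun y ↦ F (y * a)) b X = leftDeriv n F (b * a) (adjointRep a⁻¹ X) := by
  refine eq_of_dual_eq fun ℓ ↦ ?_
  rw [dual_leftDeriv hF, dual_leftDeriv
    (hF.comp (f := fun y ↦ y * a) ((contMDiff_right_mul a).mdifferentiableAt (by simp)))]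
  exact mvfderiv_comp_mul_right (hF ℓ) X

lemma DualContMDiffAt.leftDeriv_apply {F : G → V} {b : G} (hF : DualContMDiffAt n 2 F b)
    (X : GroupLieAlgebra (𝓡 n) G) :
    DualMDifferentiableAt n (fun y ↦ leftDeriv n F y X) b := by
  intro ℓ
  have h : (fun y ↦ ℓ (leftDeriv n F y X)) = fun y ↦ ∑ k, ℓ (Module.finBasis ℝ V k) *
      mvfderiv (𝓡 n) (fun y ↦ (Module.finBasis ℝ V).coord k (F y)) y
        (mulInvariantVectorField X y) := by
    ext y
    rw [_root_.leftDeriv_apply, dualDeriv_apply, map_sum]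
    refine Finset.sum_congr rfl fun k _ ↦ ?_
    rw [map_smul, smul_eq_mul, mul_comm]
    rfl
  rw [h]
  exact (mvfderiv_sum_apply Finset.univ (fun k _ ↦ (mvfderiv_const_mul
    (mdifferentiableAt_mvfderiv_apply (hF _) (mdifferentiableAt_mulInvariantVectorField X))
    _ 0).1) 0).1

lemma DualContMDiffAt.eventually {F : G → V} {b : G} (hF : DualContMDiffAt n 2 F b) :
    ∀ᶠ y in 𝓝 b, DualMDifferentiableAt n F y := by
  have h : ∀ᶠ y in 𝓝 b, ∀ k, ContMDiffAt (𝓡 n) 𝓘(ℝ) 2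
      (fun y ↦ (Module.finBasis ℝ V).coord k (F y)) y :=
    Filter.eventually_all.2 fun k ↦ (contMDiffAt_iff_contMDiffAt_nhds (by simp)).1 (hF _)
  filter_upwards [h] with y hy
  intro ℓ
  have h1 : (fun y ↦ ℓ (F y)) = fun y ↦ ∑ k, ℓ (Module.finBasis ℝ V k) *
      (Module.finBasis ℝ V).coord k (F y) := by
    ext y
    rw [apply_eq_sum_coord]
    simp only [mul_comm]
  rw [h1]
  exact (mvfderiv_sum_apply Finset.univ (fun k _ ↦ (mvfderiv_const_mul
    ((hy k).mdifferentiableAt (by simp)) _ 0).1) 0).1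

/-- Differentiation along left-invariant vector fields is a representation of the Lie algebra. -/
lemma leftDeriv_lie {F : G → V} {b : G} (hF : DualContMDiffAt n 2 F b)
    (X Y : GroupLieAlgebra (𝓡 n) G) :
    leftDeriv n F b ⁅X, Y⁆ = leftDeriv n (fun y ↦ leftDeriv n F y Y) b X -
      leftDeriv n (fun y ↦ leftDeriv n F y X) b Y := by
  have h0 := hF.dualMDifferentiableAt (by simp)
  refine eq_of_dual_eq fun ℓ ↦ ?_
  have h1 : ∀ Z, (fun y ↦ ℓ (leftDeriv n F y Z)) =ᶠ[𝓝 b]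
      fun y ↦ mvfderiv (𝓡 n) (fun y ↦ ℓ (F y)) y (mulInvariantVectorField Z y) := by
    intro Z
    filter_upwards [hF.eventually] with y hy
    exact dual_leftDeriv hy ℓ Z
  rw [map_sub, dual_leftDeriv h0, dual_leftDeriv (hF.leftDeriv_apply Y),
    dual_leftDeriv (hF.leftDeriv_apply X), mvfderiv_congr_of_eventuallyEq (h1 X),
    mvfderiv_congr_of_eventuallyEq (h1 Y)]
  refine Eq.trans ?_ (mvfderiv_mlieBracket (hF ℓ) (mdifferentiableAt_mulInvariantVectorField X)
    (mdifferentiableAt_mulInvariantVectorField Y))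
  rw [← mulInvariantVector_mlieBracket]
  rfl

lemma contMDiffAt_comp_mul {f : G → ℝ} (hf : ContMDiffAt (𝓡 n) 𝓘(ℝ) ∞ f 1) :
    ContMDiffAt ((𝓡 n).prod (𝓡 n)) 𝓘(ℝ) 2 (fun p : G × G ↦ f (p.2 * p.1)) (1, 1) :=
  ContMDiffAt.comp_of_eq (I' := 𝓡 n) (g := f) (f := fun p : G × G ↦ p.2 * p.1)
    (x := ((1 : G), (1 : G))) (hf.of_le ENat.LEInfty.out)
    ((contMDiff_snd.mul contMDiff_fst).contMDiffAt) (by simp)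

lemma dualMDifferentiableAt_adjointRep (a : G) (X : GroupLieAlgebra (𝓡 n) G) :
    DualMDifferentiableAt n (fun b : G ↦ adjointRep b X) a := by
  intro ℓ
  obtain ⟨f, hf, hℓ⟩ := exists_mvfderiv_eq (N := G) 1 ℓ
  have h1 : (fun b : G ↦ ℓ (adjointRep b X)) = fun b ↦ mvfderiv (𝓡 n)
      ((fun (b x : G) ↦ f (b * x * b⁻¹)) b) 1 X := by
    ext b
    rw [← mvfderiv_adjointRep (hf.mdifferentiableAt (by simp)), hℓ]
  have h2 : ContMDiffAt ((𝓡 n).prod (𝓡 n)) 𝓘(ℝ) 2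
      (fun p : G × G ↦ f (p.1 * p.2 * p.1⁻¹)) (a, 1) :=
    ContMDiffAt.comp_of_eq (I' := 𝓡 n) (g := f) (f := fun p : G × G ↦ p.1 * p.2 * p.1⁻¹)
      (x := (a, (1 : G))) (hf.of_le ENat.LEInfty.out)
      (((contMDiff_fst.mul contMDiff_snd).mul contMDiff_fst.inv).contMDiffAt) (by simp)
  rw [h1]
  exact (mvfderiv_mvfderiv_right (F := fun (b x : G) ↦ f (b * x * b⁻¹)) h2 0 X).1

/-- The differential of `Ad` at the identity is `ad`.  Since a left-invariant derivative of `f` at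
`b` is `ρ_b (Ad b X)`, where `ρ_b` collects the right-invariant derivatives of `f`, this follows
from the product rule and from the fact that left- and right-invariant derivatives commute. -/
lemma dualDeriv_adjointRep_one (X Z : GroupLieAlgebra (𝓡 n) G) :
    dualDeriv n (fun b : G ↦ adjointRep b X) 1 Z = ⁅Z, X⁆ := by
  refine eq_of_mvfderiv_eq (N := G) fun f hf ↦ ?_
  have hf2 : ContMDiffAt (𝓡 n) 𝓘(ℝ) 2 f 1 := hf.of_le ENat.LEInfty.out
  have hfd : DualContMDiffAt n 2 f 1 := by
    intro ℓ
    have : (fun y ↦ ℓ (f y)) = fun y ↦ ℓ 1 * f y := by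
      ext y
      conv_lhs => rw [← mul_one (f y), ← smul_eq_mul, map_smul, smul_eq_mul, mul_comm]
    rw [this]
    exact contMDiffAt_const.mul hf2
  have hev : ∀ᶠ b in 𝓝 (1 : G), MDifferentiableAt (𝓡 n) 𝓘(ℝ) f b := by
    filter_upwards [(contMDiffAt_iff_contMDiffAt_nhds (by simp)).1 hf2] with b hb
    exact hb.mdifferentiableAt (by simp)
  let ρ : G → Module.Dual ℝ (GroupLieAlgebra (𝓡 n) G) :=
    fun b ↦ (mvfderiv (𝓡 n) (fun x : G ↦ f (x * b)) 1).toLinearMap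
  have hF := contMDiffAt_comp_mul hf
  have hρW : ∀ W, MDifferentiableAt (𝓡 n) 𝓘(ℝ) (fun b ↦ ρ b W) 1 := fun W ↦
    (mvfderiv_mvfderiv_right (F := fun (b x : G) ↦ f (x * b)) hF 0 W).1
  have hρ : DualMDifferentiableAt n ρ 1 := by
    intro ξ
    obtain ⟨W, rfl⟩ := (Module.evalEquiv ℝ (GroupLieAlgebra (𝓡 n) G)).surjective ξ
    exact hρW W
  have hA := dualMDifferentiableAt_adjointRep (1 : G) X
  -- the left-invariant derivative along `X` in terms of right-invariant derivatives
  have h1 : (fun b ↦ leftDeriv n f b X) =ᶠ[𝓝 1] fun b ↦ ρ b (adjointRep b X) := by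
    filter_upwards [hev] with b hb
    have h : MDifferentiableAt (𝓡 n) 𝓘(ℝ) (fun x ↦ f (x * b)) 1 :=
      MDifferentiableAt.comp_of_eq (I' := 𝓡 n) (1 : G) (g := f) hb
        ((contMDiff_right_mul b).mdifferentiableAt (by simp)) (by simp)
    change _ = mvfderiv (𝓡 n) (fun x : G ↦ f (x * b)) 1 (adjointRep b X)
    rw [leftDeriv_apply, dualDeriv_eq_mvfderiv hb, mvfderiv_leftTranslation hb,
      mvfderiv_adjointRep h]
    simp
  have h2 : ∀ W, leftDeriv n f 1 W = mvfderiv (𝓡 n) f 1 W := by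
    intro W
    rw [leftDeriv_apply, dualDeriv_eq_mvfderiv hev.self_of_nhds,
      mvfderiv_leftTranslation hev.self_of_nhds]
    simp
  have h1' : ∀ g : G → ℝ, MDifferentiableAt (𝓡 n) 𝓘(ℝ) g 1 → ∀ W,
      leftDeriv n g 1 W = mvfderiv (𝓡 n) g 1 W := by
    intro g hg W
    rw [leftDeriv_apply, dualDeriv_eq_mvfderiv hg, mvfderiv_leftTranslation hg]
    simp
  have h3 : ∀ W, MDifferentiableAt (𝓡 n) 𝓘(ℝ) (fun b ↦ leftDeriv n f b W) 1 := fun W ↦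
    mdifferentiableAt_iff_dualMDifferentiableAt.1 (hfd.leftDeriv_apply W)
  have h4 := leftDeriv_lie hfd Z X
  have h0 : mvfderiv (𝓡 n) (fun b ↦ ρ b (adjointRep b X)) 1 Z =
      dualDeriv n ρ 1 Z (adjointRep 1 X) + ρ 1 (dualDeriv n (fun b : G ↦ adjointRep b X) 1 Z) :=
    (mvfderiv_bilinear hρ hA LinearMap.id Z).2
  rw [h2, h1' _ (h3 X), h1' _ (h3 Z), mvfderiv_congr_of_eventuallyEq h1, h0,
    adjointRep_one] at h4
  have h5 : (dualDeriv n ρ 1 Z) X = mvfderiv (𝓡 n) (fun b ↦ ρ b X) 1 Z :=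
    hρ.dual_dualDeriv (Module.evalEquiv ℝ (GroupLieAlgebra (𝓡 n) G) X) Z
  have h6 : mvfderiv (𝓡 n) (fun b ↦ ρ b X) 1 Z =
      mvfderiv (𝓡 n) (fun x ↦ mvfderiv (𝓡 n) (fun b ↦ f (x * b)) 1 Z) 1 X :=
    mvfderiv_mvfderiv_comm (F := fun (b x : G) ↦ f (x * b)) hF Z X
  have h7 : (fun b ↦ leftDeriv n f b Z) =ᶠ[𝓝 1]
      fun x ↦ mvfderiv (𝓡 n) (fun b ↦ f (x * b)) 1 Z := by
    filter_upwards [hev] with b hb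
    rw [leftDeriv_apply, dualDeriv_eq_mvfderiv hb, mvfderiv_leftTranslation hb]
  have h8 : (ρ 1) (dualDeriv n (fun b : G ↦ adjointRep b X) 1 Z) =
      mvfderiv (𝓡 n) f 1 (dualDeriv n (fun b : G ↦ adjointRep b X) 1 Z) := by
    simp [ρ]
  rw [h4, mvfderiv_congr_of_eventuallyEq h7, ← h6, ← h5, ← h8]
  simp

/-- `Ad a` is a Lie algebra homomorphism: differentiate
`Ad a (Ad b Y) = Ad (a * b * a⁻¹) (Ad a Y)` in `b` at the identity. -/
lemma adjointRep_lie (a : G) (X Y : GroupLieAlgebra (𝓡 n) G) :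
    adjointRep a ⁅X, Y⁆ = ⁅adjointRep a X, adjointRep a Y⁆ := by
  have h1 : (fun b : G ↦ adjointRepLinear a (adjointRep b Y)) =
      fun b : G ↦ (fun c ↦ adjointRep c (adjointRep a Y)) (a * b * a⁻¹) := by
    ext1 b
    change adjointRep a (adjointRep b Y) = _
    simp only [← adjointRep_mul]
    simp
  have hA := dualMDifferentiableAt_adjointRep (1 : G) Y
  have h2 := dualDeriv_linearMap_comp hA (adjointRepLinear a) X
  rw [dualDeriv_adjointRep_one, h1] at h2
  change _ = adjointRep a _ at h2
  rw [← h2, ← dualDeriv_adjointRep_one]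
  refine eq_of_dual_eq fun ℓ ↦ ?_
  have hB := dualMDifferentiableAt_adjointRep (1 : G) (adjointRep a Y)
  have hB' := dualMDifferentiableAt_adjointRep (a * 1 * a⁻¹) (adjointRep a Y)
  rw [(hB'.comp (f := fun b ↦ a * b * a⁻¹)
    ((contMDiff_conj a).mdifferentiableAt (by simp))).dual_dualDeriv, hB.dual_dualDeriv]
  exact (mvfderiv_adjointRep (hB ℓ) a X).symm

/-- The adjoint representation `Ad a` as an automorphism of the Lie algebra. -/
noncomputable def adjointLieEquiv (a : G) :
    GroupLieAlgebra (𝓡 n) G ≃ₗ⁅ℝ⁆ GroupLieAlgebra (𝓡 n) G :=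
  { adjointRepLinear a with
    map_lie' := fun {X Y} ↦ adjointRep_lie a X Y
    invFun := adjointRepLinear a⁻¹
    left_inv := fun X ↦ by
      change adjointRep a⁻¹ (adjointRep a X) = X
      rw [← adjointRep_mul, inv_mul_cancel, adjointRep_one]
    right_inv := fun X ↦ by
      change adjointRep a (adjointRep a⁻¹ X) = X
      rw [← adjointRep_mul, mul_inv_cancel, adjointRep_one] }

end Adjoint

/-! ### Local sections of submersions -/

section Submersion

set_option linter.unusedSectionVars false

open Set Filter
open scoped Topology

/-- A submersion has smooth local sections. -/
lemma Manifold.IsSubmersionAt.exists_section {n k : ℕ}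
    {N : Type*} [TopologicalSpace N] [ChartedSpace (EuclideanSpace ℝ (Fin n)) N]
    [IsManifold (𝓡 n) ∞ N] {M : Type*} [TopologicalSpace M]
    [ChartedSpace (EuclideanSpace ℝ (Fin k)) M] [IsManifold (𝓡 k) ∞ M] {f : N → M} {b : N}
    (h : Manifold.IsSubmersionAt (𝓡 n) (𝓡 k) ∞ f b) :
    ∃ s : M → N, ContMDiffAt (𝓡 k) (𝓡 n) ∞ s (f b) ∧ s (f b) = b ∧
      ∀ᶠ y in 𝓝 (f b), f (s y) = y := by
  let φ := h.domChart.extend (𝓡 n)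
  let ψ := h.codChart.extend (𝓡 k)
  let u : M → EuclideanSpace ℝ (Fin n) := fun y ↦ h.equiv.symm (ψ y, (h.equiv (φ b)).2)
  have hbφ : b ∈ φ.source := by
    simpa [φ] using h.mem_domChart_source
  have hbψ : f b ∈ ψ.source := by
    simpa [ψ] using h.mem_codChart_source
  have hb : ψ (f b) = (h.equiv (φ b)).1 := by
    have := h.writtenInCharts (φ.map_source hbφ)
    simp only [Function.comp_apply] at this
    rw [← this]
    change _ = ψ (f (φ.symm (φ b)))
    rw [φ.left_inv hbφ]
  have hu : u (f b) = φ b := by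
    simp only [u, hb]
    simp
  have hψ : ContMDiffAt (𝓡 k) 𝓘(ℝ, EuclideanSpace ℝ (Fin k)) ∞ ψ (f b) :=
    h.codChart.contMDiffAt_extend h.codChart_mem_maximalAtlas h.mem_codChart_source
  have husmooth : ContMDiffAt (𝓡 k) 𝓘(ℝ, EuclideanSpace ℝ (Fin n)) ∞ u (f b) := by
    have h1 : ContDiff ℝ ∞ (fun v : EuclideanSpace ℝ (Fin k) ↦
        h.equiv.symm (v, (h.equiv (φ b)).2)) :=
      h.equiv.symm.contDiff.comp (contDiff_id.prodMk contDiff_const)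
    exact h1.contMDiff.contMDiffAt.comp (f b) hψ
  have htarget : φ.target ∈ 𝓝 (φ b) :=
    h.domChart.isOpen_extend_target.mem_nhds (φ.map_source hbφ)
  have hφ : ContMDiffAt 𝓘(ℝ, EuclideanSpace ℝ (Fin n)) (𝓡 n) ∞ φ.symm (φ b) :=
    ((contMDiffOn_extend_symm h.domChart_mem_maximalAtlas).mono
      h.domChart.extend_target'.subset).contMDiffAt htarget
  refine ⟨φ.symm ∘ u, ?_, ?_, ?_⟩
  · exact ContMDiffAt.comp_of_eq hφ husmooth hu
  · simp only [Function.comp_apply, hu, φ.left_inv hbφ]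
  · have h1 : ∀ᶠ y in 𝓝 (f b), u y ∈ φ.target :=
      husmooth.continuousAt.eventually (by rw [hu]; exact htarget)
    have h2 : ∀ᶠ y in 𝓝 (f b), y ∈ ψ.source :=
      h.codChart.extend_source_mem_nhds h.mem_codChart_source
    filter_upwards [h1, h2] with y hy1 hy2
    have h3 : φ.symm (u y) ∈ φ.source := φ.map_target hy1
    have h4 : f (φ.symm (u y)) ∈ ψ.source := by
      have := h.source_subset_preimage_source (by simpa [φ] using h3)
      rw [h.codChart.extend_source]
      exact this
    refine ψ.injOn h4 hy2 ?_
    refine (h.writtenInCharts hy1).trans ?_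
    simp [u]

end Submersion

/-! ### The projection onto a homogeneous space -/

section HomogeneousSpace

set_option linter.unusedSectionVars false

open Set Filter
open scoped Topology

variable {n k : ℕ} {G : Type*} [TopologicalSpace G] [ChartedSpace (EuclideanSpace ℝ (Fin n)) G]
  [Group G] {H : Subgroup G}
  [ChartedSpace (EuclideanSpace ℝ (Fin k)) (G ⧸ H)]

/-- The map `X ↦ dπ (dL_b X)`, where `π : G → G ⧸ H` is the projection.  Its values are tangent
vectors at `π b`; the target point `x` is a separate argument, to be used with `π b = x` only, so
that representatives of the same point can be compared. -/
noncomputable def projFrame (x : G ⧸ H) (b : G) :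
    GroupLieAlgebra (𝓡 n) G →ₗ[ℝ] TangentSpace (𝓡 k) x :=
  ((mfderiv (𝓡 n) (𝓡 k) (fun a : G ↦ (a : G ⧸ H)) b).toLinearMap ∘ₗ leftTranslation b :
    GroupLieAlgebra (𝓡 n) G →ₗ[ℝ] EuclideanSpace ℝ (Fin k))

variable [LieGroup (𝓡 n) ∞ G] [IsManifold (𝓡 k) ∞ (G ⧸ H)]
  (hπ : Manifold.IsSubmersion (𝓡 n) (𝓡 k) ∞ (fun a : G ↦ (a : G ⧸ H)))

lemma injective_leftTranslation (b : G) :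
    Function.Injective (leftTranslation (n := n) b) := by
  rw [injective_iff_map_eq_zero]
  intro X hX
  refine eq_of_mvfderiv_eq (N := G) fun f hf ↦ ?_
  have h1 : MDifferentiableAt (𝓡 n) 𝓘(ℝ) (fun x ↦ f (b⁻¹ * x)) b :=
    MDifferentiableAt.comp_of_eq (I' := 𝓡 n) b (g := f) (hf.mdifferentiableAt (by simp))
      ((contMDiff_left_mul b⁻¹).mdifferentiableAt (by simp)) (by simp)
  have h2 := mvfderiv_leftTranslation h1 X
  rw [hX, map_zero] at h2
  simp only [inv_mul_cancel_left] at h2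
  rw [map_zero]
  exact h2.symm

lemma surjective_leftTranslation (b : G) :
    Function.Surjective (leftTranslation (n := n) b) := by
  have h : Function.Injective (leftTranslation (n := n) b :
    EuclideanSpace ℝ (Fin n) →ₗ[ℝ] EuclideanSpace ℝ (Fin n)) := injective_leftTranslation b
  exact LinearMap.injective_iff_surjective.1 h

include hπ

lemma mvfderiv_projFrame {f : G ⧸ H → ℝ} {x : G ⧸ H} {b : G} (hb : (b : G ⧸ H) = x)
    (hf : MDifferentiableAt (𝓡 k) 𝓘(ℝ) f x) (X : GroupLieAlgebra (𝓡 n) G) :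
    mvfderiv (𝓡 k) f x (projFrame x b X) =
      mvfderiv (𝓡 n) (fun a : G ↦ f (a : G ⧸ H)) b (leftTranslation b X) := by
  subst hb
  exact (mvfderiv_comp_apply b hf (hπ.contMDiff.mdifferentiableAt (by simp)) _).symm

lemma mdifferentiableAt_comp_mk {f : G ⧸ H → ℝ} {b : G}
    (hf : MDifferentiableAt (𝓡 k) 𝓘(ℝ) f (b : G ⧸ H)) :
    MDifferentiableAt (𝓡 n) 𝓘(ℝ) (fun a : G ↦ f (a : G ⧸ H)) b :=
  hf.comp b (hπ.contMDiff.mdifferentiableAt (by simp))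

lemma exists_smooth_section (b : G) :
    ∃ s : G ⧸ H → G, ContMDiffAt (𝓡 k) (𝓡 n) ∞ s (b : G ⧸ H) ∧ s (b : G ⧸ H) = b ∧
      ∀ᶠ y in 𝓝 (b : G ⧸ H), (s y : G ⧸ H) = y :=
  (hπ.isSubmersionAt b).exists_section

/-- Every tangent vector of `G ⧸ H` lifts, by the differential of a local section. -/
lemma surjective_projFrame {x : G ⧸ H} {b : G} (hb : (b : G ⧸ H) = x) :
    Function.Surjective (projFrame (n := n) (k := k) x b) := by
  subst hb
  intro v
  obtain ⟨s, hs, hsb, hsec⟩ := exists_smooth_section hπ b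
  obtain ⟨X, hX⟩ := surjective_leftTranslation (n := n) b
    (mfderiv (𝓡 k) (𝓡 n) s (b : G ⧸ H) v : EuclideanSpace ℝ (Fin n))
  refine ⟨X, eq_of_mvfderiv_eq (N := G ⧸ H) fun f hf ↦ ?_⟩
  have hf' := hf.mdifferentiableAt (n := ∞) (by simp)
  rw [mvfderiv_projFrame hπ rfl hf', hX]
  have h1 := mvfderiv_comp_apply_of_eq (b : G ⧸ H) (mdifferentiableAt_comp_mk hπ hf')
    (hs.mdifferentiableAt (by simp)) hsb v
  have h2 : (fun a : G ↦ f (a : G ⧸ H)) ∘ s =ᶠ[𝓝 (b : G ⧸ H)] f := by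
    filter_upwards [hsec] with y hy
    simp only [Function.comp_apply, hy]
  rw [mvfderiv_congr_of_eventuallyEq h2] at h1
  exact h1.symm

/-- Smooth functions on `G ⧸ H` are those which are smooth on `G`. -/
lemma contMDiffAt_of_comp_mk {E' H' : Type*} [NormedAddCommGroup E'] [NormedSpace ℝ E']
    [TopologicalSpace H'] {I' : ModelWithCorners ℝ E' H'} {N : Type*} [TopologicalSpace N]
    [ChartedSpace H' N] {r : ℕ∞ω} (hr : r ≤ ∞) {f : G ⧸ H → N} {b : G}
    (hf : ContMDiffAt (𝓡 n) I' r (fun a : G ↦ f (a : G ⧸ H)) b) :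
    ContMDiffAt (𝓡 k) I' r f (b : G ⧸ H) := by
  obtain ⟨s, hs, hsb, hsec⟩ := exists_smooth_section hπ b
  have h1 : ContMDiffAt (𝓡 k) I' r ((fun a : G ↦ f (a : G ⧸ H)) ∘ s) (b : G ⧸ H) :=
    ContMDiffAt.comp_of_eq hf (hs.of_le hr) hsb
  refine h1.congr_of_eventuallyEq ?_
  filter_upwards [hsec] with y hy
  simp only [Function.comp_apply, hy]

lemma contMDiff_smul_quotient (a : G) :
    ContMDiff (𝓡 k) (𝓡 k) ∞ (fun x : G ⧸ H ↦ a • x) := by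
  intro x
  induction x using QuotientGroup.induction_on with
  | H b =>
    refine contMDiffAt_of_comp_mk hπ le_rfl ?_
    exact (hπ.contMDiff.comp (contMDiff_left_mul a)).contMDiffAt

/-- The frame is equivariant under the action of `G`. -/
lemma mfderiv_smul_projFrame {x : G ⧸ H} {b : G} (hb : (b : G ⧸ H) = x) (a : G)
    (X : GroupLieAlgebra (𝓡 n) G) :
    mfderiv (𝓡 k) (𝓡 k) (fun y : G ⧸ H ↦ a • y) x (projFrame x b X) =
      projFrame (a • x) (a * b) X := by
  subst hb
  refine eq_of_mvfderiv_eq (N := G ⧸ H) fun f hf ↦ ?_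
  have hf' := hf.mdifferentiableAt (n := ∞) (by simp)
  have h1 : MDifferentiableAt (𝓡 k) (𝓡 k) (fun y : G ⧸ H ↦ a • y) (b : G ⧸ H) :=
    (contMDiff_smul_quotient hπ a).mdifferentiableAt (by simp)
  rw [mvfderiv_projFrame hπ (b := a * b) (x := a • (b : G ⧸ H)) rfl hf',
    ← mvfderiv_comp_mul_left (mdifferentiableAt_comp_mk hπ hf')]
  have h2 := mvfderiv_projFrame hπ (b := b) rfl (hf'.comp (b : G ⧸ H) h1) X
  have h3 := mvfderiv_comp_apply (b : G ⧸ H) hf' h1 (projFrame (b : G ⧸ H) b X)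
  exact h3.symm.trans h2

/-- Changing the representative of a point by an element of `H` turns the frame by `Ad`. -/
lemma projFrame_mul_right {x : G ⧸ H} {b : G} (hb : (b : G ⧸ H) = x) {a : G} (ha : a ∈ H)
    (X : GroupLieAlgebra (𝓡 n) G) :
    projFrame (k := k) x (b * a) X = projFrame x b (adjointRep a X) := by
  refine eq_of_mvfderiv_eq (N := G ⧸ H) fun f hf ↦ ?_
  have hf' := hf.mdifferentiableAt (n := ∞) (by simp)
  have hba : ((b * a : G) : G ⧸ H) = x := by
    rw [← hb, QuotientGroup.mk_mul_of_mem b ha]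
  rw [mvfderiv_projFrame hπ hba hf', mvfderiv_projFrame hπ hb hf']
  have h1 : MDifferentiableAt (𝓡 n) 𝓘(ℝ) (fun a : G ↦ f (a : G ⧸ H)) (b * a) :=
    mdifferentiableAt_comp_mk hπ (by rwa [hba])
  have h2 := mvfderiv_comp_mul_right h1 (adjointRep a X)
  rw [← adjointRep_mul, inv_mul_cancel, adjointRep_one] at h2
  rw [← h2]
  simp only [QuotientGroup.mk_mul_of_mem _ ha]

lemma projFrame_one (X : GroupLieAlgebra (𝓡 n) G) :
    projFrame (k := k) ((1 : G) : G ⧸ H) 1 X = dproj H X := by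
  refine eq_of_mvfderiv_eq (N := G ⧸ H) fun f hf ↦ ?_
  have hf' := hf.mdifferentiableAt (n := ∞) (by simp)
  rw [mvfderiv_projFrame hπ rfl hf', mvfderiv_leftTranslation (mdifferentiableAt_comp_mk hπ hf')]
  simp only [one_mul]
  exact mvfderiv_comp_apply 1 hf' (hπ.contMDiff.mdifferentiableAt (by simp)) X

lemma projFrame_eq_zero_iff {x : G ⧸ H} {b : G} (hb : (b : G ⧸ H) = x)
    (X : GroupLieAlgebra (𝓡 n) G) :
    projFrame (k := k) x b X = 0 ↔ X ∈ subgroupLieAlgebra k H := by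
  have h0 : X ∈ subgroupLieAlgebra k H ↔ projFrame (k := k) ((1 : G) : G ⧸ H) 1 X = 0 := by
    rw [projFrame_one hπ]
    rfl
  rw [h0]
  constructor
  · intro h
    have h1 := mfderiv_smul_projFrame hπ hb b⁻¹ X
    rw [h, map_zero] at h1
    subst hb
    have h2 : (b⁻¹ : G) • (b : G ⧸ H) = ((1 : G) : G ⧸ H) := by
      change ((b⁻¹ * b : G) : G ⧸ H) = _
      rw [inv_mul_cancel]
    rw [inv_mul_cancel] at h1
    rw [h2] at h1
    exact h1.symm
  · intro h
    have h1 := mfderiv_smul_projFrame hπ (b := (1 : G)) rfl b X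
    rw [h, map_zero, mul_one] at h1
    have h2 : b • ((1 : G) : G ⧸ H) = x := by
      rw [← hb]
      change ((b * 1 : G) : G ⧸ H) = _
      rw [mul_one]
    rw [h2] at h1
    exact h1.symm

/-- Functions which agree on `H` have the same derivatives in the directions of `𝔥`: with a local
section `s` of the projection, `a ↦ (s (π a))⁻¹ * a` maps a neighbourhood of the identity to `H`
and fixes these directions. -/
lemma mvfderiv_eq_of_eqOn_subgroup {f f' : G → ℝ} (hf : MDifferentiableAt (𝓡 n) 𝓘(ℝ) f 1)
    (hf' : MDifferentiableAt (𝓡 n) 𝓘(ℝ) f' 1) (h : ∀ a ∈ H, f a = f' a)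
    {X : GroupLieAlgebra (𝓡 n) G} (hX : X ∈ subgroupLieAlgebra k H) :
    mvfderiv (𝓡 n) f 1 X = mvfderiv (𝓡 n) f' 1 X := by
  obtain ⟨s, hs, hs1, hsec⟩ := exists_smooth_section hπ 1
  let σ : G → G := fun a ↦ s (a : G ⧸ H)
  have hσ : ContMDiffAt (𝓡 n) (𝓡 n) ∞ σ 1 := hs.comp (1 : G) hπ.contMDiff.contMDiffAt
  have hσX : mfderiv (𝓡 n) (𝓡 n) σ 1 X = 0 := by
    have h1 : mfderiv (𝓡 n) (𝓡 n) σ 1 X =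
        mfderiv (𝓡 k) (𝓡 n) s ((1 : G) : G ⧸ H) (dproj (k := k) H X) :=
      mfderiv_comp_apply (1 : G) (hs.mdifferentiableAt (by simp))
        (hπ.contMDiff.mdifferentiableAt (by simp)) X
    rw [h1, show dproj (k := k) H X = 0 from hX, map_zero]
  have key : ∀ g : G → ℝ, MDifferentiableAt (𝓡 n) 𝓘(ℝ) g 1 →
      mvfderiv (𝓡 n) (fun a ↦ g ((σ a)⁻¹ * a)) 1 X = mvfderiv (𝓡 n) g 1 X := by
    intro g hg
    let K : G × G → ℝ := fun p ↦ g (p.1⁻¹ * p.2)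
    have hK : MDifferentiableAt ((𝓡 n).prod (𝓡 n)) 𝓘(ℝ) K ((1 : G), (1 : G)) :=
      MDifferentiableAt.comp_of_eq (I' := 𝓡 n) ((1 : G), (1 : G)) (g := g)
        (f := fun p : G × G ↦ p.1⁻¹ * p.2) hg
        ((contMDiff_fst.inv.mul contMDiff_snd : ContMDiff ((𝓡 n).prod (𝓡 n)) (𝓡 n) ∞
          (fun p : G × G ↦ p.1⁻¹ * p.2)).mdifferentiableAt (by simp)) (by simp)
    have hpair : ∀ τ : G → G, MDifferentiableAt (𝓡 n) (𝓡 n) τ 1 → τ 1 = 1 →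
        (mfderiv (𝓡 n) (𝓡 n) τ 1 X : EuclideanSpace ℝ (Fin n)) = 0 →
        mvfderiv (𝓡 n) (fun a ↦ K (τ a, a)) 1 X =
          mvfderiv ((𝓡 n).prod (𝓡 n)) K ((1 : G), (1 : G))
            ((0 : EuclideanSpace ℝ (Fin n)), (X : EuclideanSpace ℝ (Fin n))) := by
      intro τ hτ hτ1 hτX
      have h2 := mvfderiv_comp_apply_of_eq (f := fun a : G ↦ (τ a, a)) (g := K)
        (1 : G) hK (hτ.prodMk mdifferentiableAt_id) (by simp [hτ1]) X
      have h3 := mfderiv_prodMk hτ (mdifferentiableAt_id (I := 𝓡 n) (x := (1 : G)))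
      refine h2.trans ?_
      refine congrArg _ ?_
      refine (congrArg (fun A ↦ A X) h3).trans ?_
      refine Prod.ext hτX ?_
      rw [mfderiv_id]
      rfl
    rw [show (fun a ↦ g ((σ a)⁻¹ * a)) = fun a ↦ K (σ a, a) from rfl,
      hpair σ (hσ.mdifferentiableAt (by simp)) hs1 hσX,
      ← hpair (fun _ ↦ 1) mdifferentiableAt_const rfl (by simp)]
    simp [K]
  rw [← key f hf, ← key f' hf']
  refine congrArg (fun A ↦ A X) (mvfderiv_congr_of_eventuallyEq ?_)
  have h4 : ∀ᶠ a : G in 𝓝 (1 : G), (s (a : G ⧸ H) : G ⧸ H) = (a : G ⧸ H) :=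
    (hπ.contMDiff.continuous.tendsto (1 : G)).eventually hsec
  filter_upwards [h4] with a ha
  exact h _ (QuotientGroup.eq.1 ha)

end HomogeneousSpace

/-! ### Negative definiteness of the Killing form of a compact group -/

section CompactForm

variable {L : Type*} [LieRing L] [LieAlgebra ℝ L] [Module.Finite ℝ L]

/-- If a Lie algebra with trivial centre carries an inner product for which the operators `ad X` are
skew, then the Killing form is negative definite. -/
lemma negKilling_pos_of_skew (hL : LieAlgebra.center ℝ L = ⊥) (q : L →ₗ[ℝ] L →ₗ[ℝ] ℝ)
    (hsymm : ∀ X Y, q X Y = q Y X) (hpos : ∀ X, X ≠ 0 → 0 < q X X)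
    (hskew : ∀ X Y Z : L, q ⁅X, Y⁆ Z + q Y ⁅X, Z⁆ = 0) {X : L} (hX : X ≠ 0) :
    0 < negKilling L X X := by
  let core : InnerProductSpace.Core ℝ L :=
    { inner := fun X Y ↦ q X Y
      conj_inner_symm := fun X Y ↦ by simpa using hsymm Y X
      re_inner_nonneg := fun X ↦ by
        by_cases h : X = 0
        · simp [h]
        · simpa using (hpos X h).le
      add_left := fun X Y Z ↦ by simp
      smul_left := fun X Y r ↦ by simp
      definite := fun X h ↦ by
        by_contra h'
        exact (hpos X h').ne' h }
  let _ : NormedAddCommGroup L := core.toNormedAddCommGroup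
  let _ : InnerProductSpace ℝ L := InnerProductSpace.ofCore core.toCore
  let b := stdOrthonormalBasis ℝ L
  have h1 : negKilling L X X = ∑ i, q ⁅X, b i⁆ ⁅X, b i⁆ := by
    rw [negKilling_apply, killingForm_apply_apply, LinearMap.trace_eq_sum_inner _ b,
      ← Finset.sum_neg_distrib]
    refine Finset.sum_congr rfl fun i _ ↦ ?_
    change -(q (b i) ⁅X, ⁅X, b i⁆⁆) = _
    linarith [hskew X (b i) ⁅X, b i⁆]
  have h0 : ∀ Y, 0 ≤ q Y Y := fun Y ↦ by
    by_cases h : Y = 0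
    · simp [h]
    · exact (hpos Y h).le
  rw [h1]
  refine lt_of_le_of_ne (Finset.sum_nonneg fun i _ ↦ h0 _) fun h ↦ hX ?_
  have h2 := (Finset.sum_eq_zero_iff_of_nonneg fun i _ ↦ h0 ⁅X, b i⁆).1 h.symm
  have h3 : ∀ i, ⁅X, b i⁆ = 0 := fun i ↦ by
    by_contra h'
    exact (hpos _ h').ne' (h2 i (Finset.mem_univ i))
  have h4 : LieAlgebra.ad ℝ L X = 0 := b.toBasis.ext fun i ↦ by simpa using h3 i
  have h5 : X ∈ LieAlgebra.center ℝ L := by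
    rw [LieModule.mem_maxTrivSubmodule]
    intro Y
    rw [← lie_skew, ← LieAlgebra.ad_apply ℝ, h4]
    simp
  rw [hL] at h5
  simpa using h5

end CompactForm

section InvariantInnerProduct

open MeasureTheory

variable {n : ℕ} {G : Type*} [TopologicalSpace G] [ChartedSpace (EuclideanSpace ℝ (Fin n)) G]
  [Group G] [LieGroup (𝓡 n) ∞ G]

lemma continuous_dual_adjointRep (ℓ : Module.Dual ℝ (GroupLieAlgebra (𝓡 n) G))
    (X : GroupLieAlgebra (𝓡 n) G) : Continuous fun a : G ↦ ℓ (adjointRep a X) :=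
  continuous_iff_continuousAt.2 fun a ↦ (dualMDifferentiableAt_adjointRep a X ℓ).continuousAt

/-- Averaging over a compact group produces an `Ad`-invariant inner product. -/
lemma exists_adjointRep_invariant_form [CompactSpace G] [T2Space G] :
    ∃ q : GroupLieAlgebra (𝓡 n) G →ₗ[ℝ] GroupLieAlgebra (𝓡 n) G →ₗ[ℝ] ℝ,
      (∀ X Y, q X Y = q Y X) ∧ (∀ X, X ≠ 0 → 0 < q X X) ∧
        ∀ (a : G) X Y, q (adjointRep a X) (adjointRep a Y) = q X Y := by
  have : IsTopologicalGroup G := topologicalGroup_of_lieGroup (𝓡 n) ∞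
  let _ : MeasurableSpace G := borel G
  have : BorelSpace G := ⟨rfl⟩
  let μ : Measure G := Measure.haar
  let c := (Module.finBasis ℝ (GroupLieAlgebra (𝓡 n) G)).coord
  let F : GroupLieAlgebra (𝓡 n) G → GroupLieAlgebra (𝓡 n) G → G → ℝ :=
    fun X Y a ↦ ∑ k, c k (adjointRep a⁻¹ X) * c k (adjointRep a⁻¹ Y)
  have hcont : ∀ X Y, Continuous (F X Y) := fun X Y ↦ continuous_finsetSum _ fun k _ ↦
    ((continuous_dual_adjointRep _ X).comp continuous_inv).mul
      ((continuous_dual_adjointRep _ Y).comp continuous_inv)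
  have hint : ∀ X Y, Integrable (F X Y) μ := fun X Y ↦
    (hcont X Y).integrable_of_hasCompactSupport (HasCompactSupport.of_compactSpace _)
  have hadd : ∀ (X X' : GroupLieAlgebra (𝓡 n) G) (a : G),
      adjointRep a (X + X') = adjointRep a X + adjointRep a X' :=
    fun X X' a ↦ map_add (adjointRepLinear a) X X'
  have hsmul : ∀ (r : ℝ) (X : GroupLieAlgebra (𝓡 n) G) (a : G),
      adjointRep a (r • X) = r • adjointRep a X :=
    fun r X a ↦ map_smul (adjointRepLinear a) r X
  have hFadd : ∀ X X' Y, F (X + X') Y = fun a ↦ F X Y a + F X' Y a := by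
    intro X X' Y
    ext a
    simp only [F, hadd, map_add, add_mul, Finset.sum_add_distrib]
  have hFsmul : ∀ (r : ℝ) X Y, F (r • X) Y = fun a ↦ r * F X Y a := by
    intro r X Y
    ext a
    simp only [F, hsmul, map_smul, smul_eq_mul, mul_assoc, Finset.mul_sum]
  have hFsymm : ∀ X Y, F X Y = F Y X := fun X Y ↦ by
    ext a
    simp only [F, mul_comm]
  refine ⟨LinearMap.mk₂ ℝ (fun X Y ↦ ∫ a, F X Y a ∂μ) ?_ ?_ ?_ ?_, ?_, ?_, ?_⟩
  · intro X X' Y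
    rw [hFadd, integral_add (hint X Y) (hint X' Y)]
  · intro r X Y
    rw [hFsmul, integral_const_mul, smul_eq_mul]
  · intro X Y Y'
    rw [hFsymm X (Y + Y'), hFadd, integral_add (hint Y X) (hint Y' X), hFsymm Y, hFsymm Y']
  · intro r X Y
    rw [hFsymm X, hFsmul, integral_const_mul, smul_eq_mul, hFsymm Y]
  · intro X Y
    simp only [LinearMap.mk₂_apply, hFsymm X Y]
  · intro X hX
    rw [LinearMap.mk₂_apply]
    refine (hcont X X).integral_pos_of_hasCompactSupport_nonneg_nonzero
      (HasCompactSupport.of_compactSpace _)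
      (fun a ↦ Finset.sum_nonneg fun k _ ↦ mul_self_nonneg _) (x := 1) ?_
    intro h
    refine hX ?_
    have h2 := (Finset.sum_eq_zero_iff_of_nonneg fun k _ ↦ mul_self_nonneg _).1 h
    refine (Module.finBasis ℝ (GroupLieAlgebra (𝓡 n) G)).ext_elem fun k ↦ ?_
    have h3 := mul_self_eq_zero.1 (h2 k (Finset.mem_univ k))
    rw [inv_one, adjointRep_one] at h3
    simpa [c] using h3
  · intro a X Y
    simp only [LinearMap.mk₂_apply]
    rw [← integral_mul_left_eq_self (F X Y) a⁻¹]
    congr 1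
    ext b
    simp only [F, ← adjointRep_mul, mul_inv_rev, inv_inv]

/-- The Killing form of a compact Lie group with semisimple Lie algebra is negative definite. -/
lemma negKilling_pos [CompactSpace G] [T2Space G]
    (hss : LieAlgebra.IsSemisimple ℝ (GroupLieAlgebra (𝓡 n) G))
    {X : GroupLieAlgebra (𝓡 n) G} (hX : X ≠ 0) :
    0 < negKilling (GroupLieAlgebra (𝓡 n) G) X X := by
  obtain ⟨q, hsymm, hpos, hinv⟩ := exists_adjointRep_invariant_form (n := n) (G := G)
  -- differentiating the invariance of `q` at the identity makes `ad Z` skew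
  refine negKilling_pos_of_skew (LieAlgebra.center_eq_bot ℝ _)
    q hsymm hpos (fun Z Y W ↦ ?_) hX
  have h1 := (mvfderiv_bilinear (dualMDifferentiableAt_adjointRep (1 : G) Y)
    (dualMDifferentiableAt_adjointRep (1 : G) W) q Z).2
  rw [dualDeriv_adjointRep_one, dualDeriv_adjointRep_one, adjointRep_one, adjointRep_one] at h1
  rw [← h1]
  simp only [hinv, mvfderiv_const]
  rfl

end InvariantInnerProduct

/-! ### Smoothness of left-invariant frames and of fields of linear maps -/

section SmoothFrames

set_option linter.unusedSectionVars false

open Set Filter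
open scoped Topology

variable {n k : ℕ} {G : Type*} [TopologicalSpace G] [ChartedSpace (EuclideanSpace ℝ (Fin n)) G]
  [Group G] [LieGroup (𝓡 n) ∞ G]

/-- Left-invariant vector fields are smooth: `dL_b X` is the value of the differential of the
multiplication at `(0, X)`, where `0` is a tangent vector at `b`. -/
lemma contMDiff_leftTranslation (X : GroupLieAlgebra (𝓡 n) G) :
    ContMDiff (𝓡 n) (𝓡 n).tangent ∞
      (fun b : G ↦ (⟨b, leftTranslation b X⟩ : TangentBundle (𝓡 n) G)) := by
  let E := EuclideanSpace ℝ (Fin n)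
  let fg : G → TangentBundle (𝓡 n) G := fun g ↦ TotalSpace.mk' E g 0
  have sfg : ContMDiff (𝓡 n) (𝓡 n).tangent ∞ fg := contMDiff_zeroSection _ _
  let fv : G → TangentBundle (𝓡 n) G := fun _ ↦ TotalSpace.mk' E 1 X
  have sfv : ContMDiff (𝓡 n) (𝓡 n).tangent ∞ fv := contMDiff_const
  let F₁ : G → (TangentBundle (𝓡 n) G × TangentBundle (𝓡 n) G) := fun g ↦ (fg g, fv g)
  have S₁ : ContMDiff (𝓡 n) ((𝓡 n).tangent.prod (𝓡 n).tangent) ∞ F₁ := sfg.prodMk sfv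
  let F₂ : (TangentBundle (𝓡 n) G × TangentBundle (𝓡 n) G) →
      TangentBundle ((𝓡 n).prod (𝓡 n)) (G × G) :=
    (equivTangentBundleProd (𝓡 n) G (𝓡 n) G).symm
  have S₂ : ContMDiff ((𝓡 n).tangent.prod (𝓡 n).tangent) ((𝓡 n).prod (𝓡 n)).tangent ∞ F₂ :=
    contMDiff_equivTangentBundleProd_symm
  let F₃ : TangentBundle ((𝓡 n).prod (𝓡 n)) (G × G) → TangentBundle (𝓡 n) G :=
    tangentMap ((𝓡 n).prod (𝓡 n)) (𝓡 n) (fun p : G × G ↦ p.1 * p.2)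
  have S₃ : ContMDiff ((𝓡 n).prod (𝓡 n)).tangent (𝓡 n).tangent ∞ F₃ :=
    ContMDiff.contMDiff_tangentMap (contMDiff_mul (𝓡 n) ∞) (m := ∞) le_rfl
  have S := (S₃.comp S₂).comp S₁
  convert! S with g
  · simp [F₁, F₂, F₃, fg, fv]
  · simp only [Function.comp_apply, tangentMap, F₃, F₂, F₁, fg, fv]
    rw [mfderiv_prod_eq_add_apply ((contMDiff_mul (𝓡 n) ∞).mdifferentiableAt (by simp))]
    symm
    exact (congrArg (· + _) (map_zero _)).trans (zero_add _)

variable {H : Subgroup G} [ChartedSpace (EuclideanSpace ℝ (Fin k)) (G ⧸ H)]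
  [IsManifold (𝓡 k) ∞ (G ⧸ H)]
  (hπ : Manifold.IsSubmersion (𝓡 n) (𝓡 k) ∞ (fun a : G ↦ (a : G ⧸ H)))

include hπ in
lemma contMDiff_projFrame (X : GroupLieAlgebra (𝓡 n) G) :
    ContMDiff (𝓡 n) (𝓡 k).tangent ∞
      (fun b : G ↦ (⟨(b : G ⧸ H), projFrame (b : G ⧸ H) b X⟩ : TangentBundle (𝓡 k) (G ⧸ H))) :=
  (ContMDiff.contMDiff_tangentMap hπ.contMDiff (m := ∞) le_rfl).comp (contMDiff_leftTranslation X)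

end SmoothFrames

section HomBundle

set_option linter.unusedSectionVars false

open Filter
open scoped Topology

variable {k : ℕ} {M : Type*} [TopologicalSpace M] [ChartedSpace (EuclideanSpace ℝ (Fin k)) M]
  [IsManifold (𝓡 k) ∞ M]
  {F : Type*} [NormedAddCommGroup F] [NormedSpace ℝ F] {E : M → Type*}
  [∀ x, AddCommGroup (E x)] [∀ x, Module ℝ (E x)] [∀ x, TopologicalSpace (E x)]
  [∀ x, IsTopologicalAddGroup (E x)] [∀ x, ContinuousSMul ℝ (E x)]
  [TopologicalSpace (TotalSpace F E)] [FiberBundle F E] [VectorBundle ℝ F E]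

/-- Operator-valued functions on a finite-dimensional space are smooth if they are smooth
pointwise. -/
lemma contMDiffAt_clm_of_apply {f : M → (EuclideanSpace ℝ (Fin k) →L[ℝ] F)} {x : M} {r : ℕ∞ω}
    (h : ∀ v, ContMDiffAt (𝓡 k) 𝓘(ℝ, F) r (fun y ↦ f y v) x) :
    ContMDiffAt (𝓡 k) 𝓘(ℝ, EuclideanSpace ℝ (Fin k) →L[ℝ] F) r f x := by
  have h1 : f = fun y ↦ ∑ i, ContinuousLinearMap.smulRightL ℝ (EuclideanSpace ℝ (Fin k)) F
      (EuclideanSpace.proj i) (f y (EuclideanSpace.single i 1)) := by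
    ext1 y
    refine ContinuousLinearMap.coe_injective ((EuclideanSpace.basisFun (Fin k) ℝ).toBasis.ext ?_)
    intro j
    simp [Finset.sum_apply]
  rw [h1]
  refine contMDiffAt_finsetSum fun i _ ↦ ?_
  exact (ContinuousLinearMap.contMDiff _).contMDiffAt.comp x (h _)

/-- A field of linear maps on the tangent spaces is smooth if it maps smooth vector fields to
smooth sections. -/
lemma contMDiffAt_hom_of_apply {φ : Π x : M, TangentSpace (𝓡 k) x →L[ℝ] E x} {x : M}
    (h : ∀ V : Π y : M, TangentSpace (𝓡 k) y, ContMDiffAt (𝓡 k) (𝓡 k).tangent ∞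
        (fun y ↦ (⟨y, V y⟩ : TangentBundle (𝓡 k) M)) x →
      ContMDiffAt (𝓡 k) ((𝓡 k).prod 𝓘(ℝ, F)) ∞ (fun y ↦ TotalSpace.mk' F y (φ y (V y))) x) :
    ContMDiffAt (𝓡 k) ((𝓡 k).prod 𝓘(ℝ, EuclideanSpace ℝ (Fin k) →L[ℝ] F)) ∞
      (fun y ↦ TotalSpace.mk' (EuclideanSpace ℝ (Fin k) →L[ℝ] F)
        (E := fun y ↦ TangentSpace (𝓡 k) y →L[ℝ] E y) y (φ y)) x := by
  rw [contMDiffAt_hom_bundle]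
  refine ⟨contMDiffAt_id, contMDiffAt_clm_of_apply fun v ↦ ?_⟩
  let t := trivializationAt (EuclideanSpace ℝ (Fin k)) (TangentSpace (𝓡 k) : M → Type _) x
  have hV := h (fun y ↦ t.symmL ℝ y v) ((t.contMDiffAt_symmL
    (FiberBundle.mem_baseSet_trivializationAt' x)).clm_bundle_apply
      (E₁ := Bundle.Trivial M (EuclideanSpace ℝ (Fin k))) (v := fun _ ↦ v) ?_)
  · refine (contMDiffAt_totalSpace.1 hV).2.congr_of_eventuallyEq ?_
    filter_upwards [(trivializationAt F E x).open_baseSet.mem_nhds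
      (FiberBundle.mem_baseSet_trivializationAt' x)] with y hy
    rw [ContinuousLinearMap.inCoordinates]
    simp [Bundle.Trivialization.coe_linearMapAt_of_mem _ hy, t]
  · rw [contMDiffAt_totalSpace]
    exact ⟨contMDiffAt_id, contMDiffAt_const⟩

end HomBundle

/-! ### Horizontal lifts of vector fields -/

section HorizontalLift

set_option linter.unusedSectionVars false

open Set Filter
open scoped Topology

variable {n k : ℕ} {G : Type*} [TopologicalSpace G] [ChartedSpace (EuclideanSpace ℝ (Fin n)) G]
  [Group G] [LieGroup (𝓡 n) ∞ G] {H : Subgroup G}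
  [ChartedSpace (EuclideanSpace ℝ (Fin k)) (G ⧸ H)] [IsManifold (𝓡 k) ∞ (G ⧸ H)]

instance finite_tangentSpace (x : G ⧸ H) : Module.Finite ℝ (TangentSpace (𝓡 k) x) :=
  inferInstanceAs (Module.Finite ℝ (EuclideanSpace ℝ (Fin k)))

instance t2Space_tangentSpace (x : G ⧸ H) : T2Space (TangentSpace (𝓡 k) x) :=
  inferInstanceAs (T2Space (EuclideanSpace ℝ (Fin k)))

/-- `G ⧸ H` is a smooth quotient whose isotropy representation preserves a Wallach decomposition of
the Lie algebra, and `T` is the invariant metric with parameters `z` on it. -/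
structure IsWallachQuotient (H : Subgroup G)
    [ChartedSpace (EuclideanSpace ℝ (Fin k)) (G ⧸ H)] [IsManifold (𝓡 k) ∞ (G ⧸ H)]
    (m : Fin 3 → Submodule ℝ (GroupLieAlgebra (𝓡 n) G)) {d : Fin 3 → ℕ}
    (e : ∀ i, Fin (d i) → GroupLieAlgebra (𝓡 n) G) (T : SmoothMetric k (G ⧸ H))
    (z : Fin 3 → ℝ) : Prop where
  submersion : Manifold.IsSubmersion (𝓡 n) (𝓡 k) ∞ (fun a : G ↦ (a : G ⧸ H))
  decomposition : IsWallachDecomposition (subgroupLieAlgebra k H) m e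
  preserves : ∀ a ∈ H, PreservesSummands m (adjointLieEquiv a)
  pos : ∀ i, 0 < z i
  metric : ∀ (x : G ⧸ H) (b : G), (b : G ⧸ H) = x → ∀ X Y,
    T.inner x (projFrame x b X) (projFrame x b Y) = diagForm e z X Y

/-- The lift of tangent vectors at `x = π b` to vectors `X` in `m 0 ⊕ m 1 ⊕ m 2` with
`dπ (dL_b X) = v`.  It is expressed through the metric `T`, so that its smoothness in `b` follows
from the smoothness of `T`. -/
noncomputable def horizontalLift (T : SmoothMetric k (G ⧸ H)) (z : Fin 3 → ℝ) {d : Fin 3 → ℕ}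
    (e : ∀ i, Fin (d i) → GroupLieAlgebra (𝓡 n) G) (x : G ⧸ H) (b : G) :
    TangentSpace (𝓡 k) x →ₗ[ℝ] GroupLieAlgebra (𝓡 n) G :=
  ∑ i, ∑ a, ((z i)⁻¹ • (T.inner x (projFrame x b (e i a))).toLinearMap).smulRight (e i a)

lemma horizontalLift_apply (T : SmoothMetric k (G ⧸ H)) (z : Fin 3 → ℝ) {d : Fin 3 → ℕ}
    (e : ∀ i, Fin (d i) → GroupLieAlgebra (𝓡 n) G) (x : G ⧸ H) (b : G)
    (v : TangentSpace (𝓡 k) x) :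
    horizontalLift T z e x b v =
      ∑ i, ∑ a, ((z i)⁻¹ * T.inner x (projFrame x b (e i a)) v) • e i a := by
  simp [horizontalLift]

/-- The function on `G` with values in the Lie algebra which represents a vector field on
`G ⧸ H`. -/
noncomputable def liftField (T : SmoothMetric k (G ⧸ H)) (z : Fin 3 → ℝ) {d : Fin 3 → ℕ}
    (e : ∀ i, Fin (d i) → GroupLieAlgebra (𝓡 n) G) (Y : Π x : G ⧸ H, TangentSpace (𝓡 k) x) (a : G) :
    GroupLieAlgebra (𝓡 n) G :=
  horizontalLift T z e (a : G ⧸ H) a (Y (a : G ⧸ H))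

namespace IsWallachQuotient

variable {m : Fin 3 → Submodule ℝ (GroupLieAlgebra (𝓡 n) G)} {d : Fin 3 → ℕ}
  {e : ∀ i, Fin (d i) → GroupLieAlgebra (𝓡 n) G} {T : SmoothMetric k (G ⧸ H)} {z : Fin 3 → ℝ}
  (Q : IsWallachQuotient H m e T z)

include Q

lemma horizontalLift_projFrame {x : G ⧸ H} {b : G} (hb : (b : G ⧸ H) = x)
    (X : GroupLieAlgebra (𝓡 n) G) :
    horizontalLift T z e x b (projFrame x b X) = wallachProjM e X := by
  rw [horizontalLift_apply, wallachProjM_apply]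
  refine Finset.sum_congr rfl fun i _ ↦ ?_
  rw [wallachProj_apply]
  refine Finset.sum_congr rfl fun a _ ↦ ?_
  have hz := (Q.pos i).ne'
  have hea := Q.decomposition.mem_basis i a
  have h1 : diagForm e z (e i a) X = z i * negKilling _ (e i a) X := by
    rw [diagForm_apply, Finset.sum_eq_single i, Q.decomposition.proj_of_mem hea,
      ← IsWallachDecomposition.negKilling_proj, Q.decomposition.proj_of_mem hea]
    · intro j _ hj
      rw [Q.decomposition.proj_of_mem_ne hj hea]
      simp
    · simp
  rw [Q.metric x b hb, h1]
  congr 1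
  field_simp

lemma projFrame_projM {x : G ⧸ H} {b : G} (hb : (b : G ⧸ H) = x)
    (X : GroupLieAlgebra (𝓡 n) G) :
    projFrame (k := k) x b (wallachProjM e X) = projFrame x b X := by
  have h := (projFrame_eq_zero_iff Q.submersion hb _).2 (Q.decomposition.sub_projM_mem X)
  rw [map_sub, sub_eq_zero] at h
  exact h.symm

lemma projFrame_horizontalLift {x : G ⧸ H} {b : G} (hb : (b : G ⧸ H) = x)
    (v : TangentSpace (𝓡 k) x) : projFrame x b (horizontalLift T z e x b v) = v := by
  obtain ⟨X, rfl⟩ := surjective_projFrame Q.submersion hb v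
  rw [Q.horizontalLift_projFrame hb, Q.projFrame_projM hb]

lemma horizontalLift_mem {x : G ⧸ H} {b : G} (hb : (b : G ⧸ H) = x)
    (v : TangentSpace (𝓡 k) x) : horizontalLift T z e x b v ∈ ⨆ i, m i := by
  obtain ⟨X, rfl⟩ := surjective_projFrame Q.submersion hb v
  rw [Q.horizontalLift_projFrame hb]
  exact Q.decomposition.projM_mem X

lemma horizontalLift_mul_right {x : G ⧸ H} {b : G} (hb : (b : G ⧸ H) = x) {a : G} (ha : a ∈ H)
    (v : TangentSpace (𝓡 k) x) :
    horizontalLift T z e x (b * a) v = adjointRep a⁻¹ (horizontalLift T z e x b v) := by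
  obtain ⟨X, rfl⟩ := surjective_projFrame Q.submersion hb v
  have hba : ((b * a : G) : G ⧸ H) = x := by rw [← hb, QuotientGroup.mk_mul_of_mem b ha]
  have h1 : projFrame (k := k) x b X = projFrame x (b * a) (adjointRep a⁻¹ X) := by
    rw [projFrame_mul_right Q.submersion hb ha, ← adjointRep_mul, mul_inv_cancel, adjointRep_one]
  rw [Q.horizontalLift_projFrame hb, h1, Q.horizontalLift_projFrame hba]
  exact Q.decomposition.projM_equiv (Q.preserves a⁻¹ (inv_mem ha)) X

/-- Horizontal lifts are invariant under the action of `G`. -/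
lemma horizontalLift_smul {x : G ⧸ H} {b : G} (hb : (b : G ⧸ H) = x) (a : G)
    (v : TangentSpace (𝓡 k) x) :
    horizontalLift T z e (a • x) (a * b)
      (mfderiv (𝓡 k) (𝓡 k) (fun y : G ⧸ H ↦ a • y) x v) = horizontalLift T z e x b v := by
  obtain ⟨X, rfl⟩ := surjective_projFrame Q.submersion hb v
  rw [mfderiv_smul_projFrame Q.submersion hb, Q.horizontalLift_projFrame hb,
    Q.horizontalLift_projFrame (by rw [← hb]; rfl)]

lemma projFrame_liftField (Y : Π x : G ⧸ H, TangentSpace (𝓡 k) x) (a : G) :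
    projFrame (a : G ⧸ H) a (liftField T z e Y a) = Y (a : G ⧸ H) :=
  Q.projFrame_horizontalLift rfl _

lemma liftField_mem (Y : Π x : G ⧸ H, TangentSpace (𝓡 k) x) (a : G) :
    liftField T z e Y a ∈ ⨆ i, m i :=
  Q.horizontalLift_mem rfl _

omit Q in
lemma liftField_eq_horizontalLift (Y : Π x : G ⧸ H, TangentSpace (𝓡 k) x) {x : G ⧸ H} {b : G}
    (hb : (b : G ⧸ H) = x) : liftField T z e Y b = horizontalLift T z e x b (Y x) := by
  subst hb
  rfl

/-- The functions which represent vector fields are `H`-equivariant. -/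
lemma liftField_mul_right (Y : Π x : G ⧸ H, TangentSpace (𝓡 k) x) (b : G) {a : G} (ha : a ∈ H) :
    liftField T z e Y (b * a) = adjointRep a⁻¹ (liftField T z e Y b) := by
  rw [liftField_eq_horizontalLift Y (QuotientGroup.mk_mul_of_mem b ha),
    Q.horizontalLift_mul_right rfl ha]
  rfl

lemma dualContMDiffAt_liftField {Y : Π x : G ⧸ H, TangentSpace (𝓡 k) x} {b : G} {r : ℕ∞ω}
    (hr : r ≤ ∞) (hY : ContMDiffAt (𝓡 k) (𝓡 k).tangent r
      (fun y ↦ (⟨y, Y y⟩ : TangentBundle (𝓡 k) (G ⧸ H))) (b : G ⧸ H)) :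
    DualContMDiffAt n r (liftField T z e Y) b := by
  intro ℓ
  have hπ : ContMDiffAt (𝓡 n) (𝓡 k) r (fun a : G ↦ (a : G ⧸ H)) b :=
    (Q.submersion.contMDiff.of_le hr).contMDiffAt
  have h1 : ∀ i a, ContMDiffAt (𝓡 n) 𝓘(ℝ) r (fun c : G ↦
      T.inner (c : G ⧸ H) (projFrame (c : G ⧸ H) c (e i a)) (Y (c : G ⧸ H))) b := by
    intro i a
    have hT : ContMDiffAt (𝓡 n) ((𝓡 k).prod 𝓘(ℝ, EuclideanSpace ℝ (Fin k) →L[ℝ]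
        EuclideanSpace ℝ (Fin k) →L[ℝ] ℝ)) r (fun c : G ↦ TotalSpace.mk'
          (EuclideanSpace ℝ (Fin k) →L[ℝ] EuclideanSpace ℝ (Fin k) →L[ℝ] ℝ)
          (E := fun y : G ⧸ H ↦ TangentSpace (𝓡 k) y →L[ℝ] TangentSpace (𝓡 k) y →L[ℝ] ℝ)
          (c : G ⧸ H) (T.inner (c : G ⧸ H))) b :=
      ((T.contMDiff.of_le hr).contMDiffAt (x := (b : G ⧸ H))).comp b hπ
    have := hT.clm_bundle_apply₂ (E₃ := Bundle.Trivial (G ⧸ H) ℝ)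
      (((contMDiff_projFrame Q.submersion (e i a)).of_le hr).contMDiffAt (x := b))
      (hY.comp b hπ)
    exact (contMDiffAt_totalSpace.1 this).2
  have h2 : (fun c : G ↦ ℓ (liftField T z e Y c)) = fun c : G ↦ ∑ i, ∑ a, ((z i)⁻¹ *
      T.inner (c : G ⧸ H) (projFrame (c : G ⧸ H) c (e i a)) (Y (c : G ⧸ H))) * ℓ (e i a) := by
    ext c
    rw [liftField, horizontalLift_apply]
    simp only [map_sum, map_smul, smul_eq_mul]
  rw [h2]
  exact contMDiffAt_finsetSum fun i _ ↦ contMDiffAt_finsetSum fun a _ ↦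
    (contMDiffAt_const.mul (h1 i a)).mul contMDiffAt_const

lemma dualMDifferentiableAt_liftField {Y : Π x : G ⧸ H, TangentSpace (𝓡 k) x} {b : G}
    (hY : MDifferentiableAt (𝓡 k) (𝓡 k).tangent
      (fun y ↦ (⟨y, Y y⟩ : TangentBundle (𝓡 k) (G ⧸ H))) (b : G ⧸ H)) :
    DualMDifferentiableAt n (liftField T z e Y) b := by
  intro ℓ
  have hπ : MDifferentiableAt (𝓡 n) (𝓡 k) (fun a : G ↦ (a : G ⧸ H)) b :=
    Q.submersion.contMDiff.mdifferentiableAt (by simp)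
  have h1 : ∀ i a, MDifferentiableAt (𝓡 n) 𝓘(ℝ) (fun c : G ↦
      T.inner (c : G ⧸ H) (projFrame (c : G ⧸ H) c (e i a)) (Y (c : G ⧸ H))) b := by
    intro i a
    have hT : MDifferentiableAt (𝓡 n) ((𝓡 k).prod 𝓘(ℝ, EuclideanSpace ℝ (Fin k) →L[ℝ]
        EuclideanSpace ℝ (Fin k) →L[ℝ] ℝ)) (fun c : G ↦ TotalSpace.mk'
          (EuclideanSpace ℝ (Fin k) →L[ℝ] EuclideanSpace ℝ (Fin k) →L[ℝ] ℝ)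
          (E := fun y : G ⧸ H ↦ TangentSpace (𝓡 k) y →L[ℝ] TangentSpace (𝓡 k) y →L[ℝ] ℝ)
          (c : G ⧸ H) (T.inner (c : G ⧸ H))) b :=
      (T.contMDiff.mdifferentiableAt (x := (b : G ⧸ H)) (by simp)).comp b hπ
    have := hT.clm_bundle_apply₂ (E₃ := Bundle.Trivial (G ⧸ H) ℝ)
      ((contMDiff_projFrame Q.submersion (e i a)).mdifferentiableAt (x := b) (by simp))
      (hY.comp b hπ)
    exact ((mdifferentiableAt_totalSpace _ _).1 this).2
  have h2 : (fun c : G ↦ ℓ (liftField T z e Y c)) = fun c : G ↦ ∑ i, ∑ a, ℓ (e i a) * ((z i)⁻¹ *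
      T.inner (c : G ⧸ H) (projFrame (c : G ⧸ H) c (e i a)) (Y (c : G ⧸ H))) := by
    ext c
    rw [liftField, horizontalLift_apply]
    simp only [map_sum, map_smul, smul_eq_mul, mul_comm]
  rw [h2]
  have h3 : ∀ i a, MDifferentiableAt (𝓡 n) 𝓘(ℝ) (fun c : G ↦ ℓ (e i a) * ((z i)⁻¹ *
      T.inner (c : G ⧸ H) (projFrame (c : G ⧸ H) c (e i a)) (Y (c : G ⧸ H)))) b := fun i a ↦
    (mvfderiv_const_mul (mvfderiv_const_mul (h1 i a) _ 0).1 _ 0).1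
  exact (mvfderiv_sum_apply Finset.univ (fun i _ ↦
    (mvfderiv_sum_apply Finset.univ (fun a _ ↦ h3 i a) 0).1) 0).1

end IsWallachQuotient

end HorizontalLift

/-! ### Diagonal invariant metrics -/

section DiagonalMetric

set_option linter.unusedSectionVars false

open Set Filter
open scoped Topology

variable {n k : ℕ} {G : Type*} [TopologicalSpace G] [ChartedSpace (EuclideanSpace ℝ (Fin n)) G]
  [Group G] [LieGroup (𝓡 n) ∞ G] {H : Subgroup G}
  [ChartedSpace (EuclideanSpace ℝ (Fin k)) (G ⧸ H)] [IsManifold (𝓡 k) ∞ (G ⧸ H)]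
  {m : Fin 3 → Submodule ℝ (GroupLieAlgebra (𝓡 n) G)} {d : Fin 3 → ℕ}
  {e : ∀ i, Fin (d i) → GroupLieAlgebra (𝓡 n) G} {T : SmoothMetric k (G ⧸ H)} {z : Fin 3 → ℝ}

variable (e T z) in
/-- The scalar product on `T_y (G ⧸ H)` which corresponds to `∑ i, x i * Q` on
`m 0 ⊕ m 1 ⊕ m 2`, where `Q` is minus the Killing form.  It is computed with the representative
`y.out` of `y`; see `IsWallachQuotient.diagonalInner_eq` for other representatives. -/
noncomputable def diagonalInner (x : Fin 3 → ℝ) (y : G ⧸ H) :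
    TangentSpace (𝓡 k) y →ₗ[ℝ] TangentSpace (𝓡 k) y →ₗ[ℝ] ℝ :=
  (diagForm e x).compl₁₂ (horizontalLift T z e y y.out) (horizontalLift T z e y y.out)

lemma diagonalInner_apply (x : Fin 3 → ℝ) (y : G ⧸ H) (v w : TangentSpace (𝓡 k) y) :
    diagonalInner e T z x y v w =
      diagForm e x (horizontalLift T z e y y.out v) (horizontalLift T z e y y.out w) := rfl

namespace IsWallachQuotient

variable (Q : IsWallachQuotient H m e T z)

include Q

/-- The scalar product does not depend on the representative of the point. -/
lemma diagonalInner_eq (x : Fin 3 → ℝ) {y : G ⧸ H} {b : G} (hb : (b : G ⧸ H) = y)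
    (v w : TangentSpace (𝓡 k) y) :
    diagonalInner e T z x y v w =
      diagForm e x (horizontalLift T z e y b v) (horizontalLift T z e y b w) := by
  have hy : ((y.out : G) : G ⧸ H) = y := Quotient.out_eq y
  have hmem : b⁻¹ * y.out ∈ H := QuotientGroup.eq.1 (hb.trans hy.symm)
  have h1 : y.out = b * (b⁻¹ * y.out) := by group
  rw [diagonalInner_apply, h1, Q.horizontalLift_mul_right hb hmem,
    Q.horizontalLift_mul_right hb hmem]
  exact Q.decomposition.diagForm_equiv (Q.preserves _ (inv_mem hmem)) x _ _

lemma diagForm_pos {x : Fin 3 → ℝ} (hx : ∀ i, 0 < x i) {X : GroupLieAlgebra (𝓡 n) G}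
    (hX : X ∈ ⨆ i, m i) (hX0 : X ≠ 0) : 0 < diagForm e x X X := by
  have h0 : ∀ Y : GroupLieAlgebra (𝓡 n) G, 0 ≤ negKilling _ Y Y := fun Y ↦ by
    by_cases h : Y = 0
    · simp [h]
    · exact (Q.decomposition.pos Y h).le
  rw [diagForm_apply]
  refine lt_of_le_of_ne (Finset.sum_nonneg fun i _ ↦ mul_nonneg (hx i).le (h0 _)) fun h ↦ hX0 ?_
  have h1 := (Finset.sum_eq_zero_iff_of_nonneg
    fun i _ ↦ mul_nonneg (hx i).le (h0 (wallachProj e i X))).1 h.symm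
  rw [← Q.decomposition.projM_of_mem hX, wallachProjM_apply]
  refine Finset.sum_eq_zero fun i hi ↦ Q.decomposition.eq_zero_of_self ?_
  exact (mul_eq_zero.1 (h1 i hi)).resolve_left (hx i).ne'

lemma diagonalInner_pos {x : Fin 3 → ℝ} (hx : ∀ i, 0 < x i) (y : G ⧸ H)
    (v : TangentSpace (𝓡 k) y) (hv : v ≠ 0) : 0 < diagonalInner e T z x y v v := by
  have hy : ((y.out : G) : G ⧸ H) = y := Quotient.out_eq y
  refine Q.diagForm_pos hx (Q.horizontalLift_mem hy v) fun h ↦ hv ?_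
  rw [← Q.projFrame_horizontalLift hy v, h, map_zero]

omit Q in
lemma diagForm_comm (x : Fin 3 → ℝ) (X Y : GroupLieAlgebra (𝓡 n) G) :
    diagForm e x X Y = diagForm e x Y X := by
  rw [diagForm_apply, diagForm_apply]
  exact Finset.sum_congr rfl fun i _ ↦ by rw [negKilling_comm]

end IsWallachQuotient

/-- A positive definite bilinear form on a finite-dimensional space has bounded unit ball. -/
lemma isVonNBounded_of_posDef {j : ℕ}
    (β : EuclideanSpace ℝ (Fin j) →L[ℝ] EuclideanSpace ℝ (Fin j) →L[ℝ] ℝ)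
    (hβ : ∀ v, v ≠ 0 → 0 < β v v) : Bornology.IsVonNBounded ℝ {v | β v v < 1} := by
  rw [NormedSpace.isVonNBounded_iff]
  have hc : Continuous fun v ↦ β v v := (β.continuous.clm_apply continuous_id)
  rcases (Metric.sphere (0 : EuclideanSpace ℝ (Fin j)) 1).eq_empty_or_nonempty with h | h
  · have : Subsingleton (EuclideanSpace ℝ (Fin j)) := by
      by_contra h'
      rw [not_subsingleton_iff_nontrivial] at h'
      exact (NormedSpace.sphere_nonempty.2 zero_le_one).ne_empty h
    exact (Set.toFinite _).isBounded
  · obtain ⟨u, hu, hmin⟩ := (isCompact_sphere (0 : EuclideanSpace ℝ (Fin j)) 1).exists_isMinOn h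
      hc.continuousOn
    have hu0 : 0 < β u u := hβ u (by
      rintro rfl
      simp at hu)
    refine (Metric.isBounded_closedBall (x := (0 : EuclideanSpace ℝ (Fin j)))
      (r := 1 / β u u + 1)).subset fun v hv ↦ ?_
    rw [mem_closedBall_zero_iff]
    by_cases hv0 : v = 0
    · rw [hv0, norm_zero]
      positivity
    have hn : 0 < ‖v‖ := norm_pos_iff.2 hv0
    have h1 : ‖v‖⁻¹ • v ∈ Metric.sphere (0 : EuclideanSpace ℝ (Fin j)) 1 := by
      rw [mem_sphere_zero_iff_norm, norm_smul, norm_inv, norm_norm, inv_mul_cancel₀ hn.ne']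
    have h2 : β u u ≤ β (‖v‖⁻¹ • v) (‖v‖⁻¹ • v) := hmin h1
    simp only [map_smul, smul_apply, smul_eq_mul] at h2
    have h3 : β u u * (‖v‖ * ‖v‖) ≤ β v v := by
      calc β u u * (‖v‖ * ‖v‖) ≤ (‖v‖⁻¹ * (‖v‖⁻¹ * β v v)) * (‖v‖ * ‖v‖) := by gcongr
        _ = β v v := by field_simp
    have hv1 : β v v < 1 := hv
    by_contra! h4
    have h5 : 1 / β u u * 1 ≤ ‖v‖ * ‖v‖ := by
      have : 0 < 1 / β u u := by positivity
      gcongr <;> linarith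
    have h6 : 1 ≤ β u u * (‖v‖ * ‖v‖) := by
      calc (1 : ℝ) = β u u * (1 / β u u * 1) := by field_simp
        _ ≤ _ := by gcongr
    linarith

variable (e T z) in
/-- The scalar product `diagonalInner` as a continuous bilinear form. -/
noncomputable def diagonalInnerCLM (x : Fin 3 → ℝ) (y : G ⧸ H) :
    TangentSpace (𝓡 k) y →L[ℝ] TangentSpace (𝓡 k) y →L[ℝ] ℝ :=
  LinearMap.toContinuousLinearMap
    (LinearMap.toContinuousLinearMap.toLinearMap ∘ₗ diagonalInner e T z x y :
      EuclideanSpace ℝ (Fin k) →ₗ[ℝ] EuclideanSpace ℝ (Fin k) →L[ℝ] ℝ)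

lemma diagonalInnerCLM_apply (x : Fin 3 → ℝ) (y : G ⧸ H) (v w : TangentSpace (𝓡 k) y) :
    diagonalInnerCLM e T z x y v w = diagonalInner e T z x y v w := rfl

/-- The invariant metric with parameters `x` on the quotient. -/
noncomputable def IsWallachQuotient.diagonalMetric (Q : IsWallachQuotient H m e T z)
    (x : Fin 3 → ℝ) (hx : ∀ i, 0 < x i) : SmoothMetric k (G ⧸ H) where
  inner y := diagonalInnerCLM e T z x y
  symm y v w := by
    rw [diagonalInnerCLM_apply, diagonalInnerCLM_apply, diagonalInner_apply, diagonalInner_apply,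
      IsWallachQuotient.diagForm_comm]
  pos y v hv := by
    rw [diagonalInnerCLM_apply]
    exact Q.diagonalInner_pos hx y v hv
  isVonNBounded y := isVonNBounded_of_posDef (diagonalInnerCLM e T z x y) fun v hv ↦
    Q.diagonalInner_pos hx y v hv
  contMDiff := by
    intro y
    refine contMDiffAt_hom_of_apply (E := fun y : G ⧸ H ↦ TangentSpace (𝓡 k) y →L[ℝ] ℝ)
      fun V hV ↦ ?_
    refine contMDiffAt_hom_of_apply (E := Bundle.Trivial (G ⧸ H) ℝ) fun V' hV' ↦ ?_
    rw [contMDiffAt_totalSpace]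
    refine ⟨contMDiffAt_id, ?_⟩
    change ContMDiffAt (𝓡 k) 𝓘(ℝ) ∞ (fun y ↦ diagonalInner e T z x y (V y) (V' y)) y
    induction y using QuotientGroup.induction_on with
    | H b =>
      refine contMDiffAt_of_comp_mk Q.submersion le_rfl ?_
      have h : (fun a : G ↦ diagonalInner e T z x (a : G ⧸ H) (V (a : G ⧸ H)) (V' (a : G ⧸ H))) =
          fun a ↦ diagForm e x (liftField T z e V a) (liftField T z e V' a) :=
        funext fun a ↦ Q.diagonalInner_eq x rfl _ _
      rw [h]
      exact (Q.dualContMDiffAt_liftField le_rfl hV).bilinear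
        (Q.dualContMDiffAt_liftField le_rfl hV') _

lemma IsWallachQuotient.diagonalMetric_inner (Q : IsWallachQuotient H m e T z) {x : Fin 3 → ℝ}
    (hx : ∀ i, 0 < x i) {y : G ⧸ H} {b : G} (hb : (b : G ⧸ H) = y) (v w : TangentSpace (𝓡 k) y) :
    (Q.diagonalMetric x hx).inner y v w =
      diagForm e x (horizontalLift T z e y b v) (horizontalLift T z e y b w) :=
  Q.diagonalInner_eq x hb v w

lemma IsWallachQuotient.isInvariantMetric_diagonalMetric (Q : IsWallachQuotient H m e T z)
    {x : Fin 3 → ℝ} (hx : ∀ i, 0 < x i) : IsInvariantMetric G (Q.diagonalMetric x hx) := by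
  intro a y v w
  induction y using QuotientGroup.induction_on with
  | H b =>
    refine (Q.diagonalMetric_inner hx (b := a * b) rfl _ _).trans ?_
    rw [Q.diagonalMetric_inner hx (b := b) rfl]
    exact congrArg₂ (fun X Y ↦ diagForm e x X Y) (Q.horizontalLift_smul rfl a v)
      (Q.horizontalLift_smul rfl a w)

end DiagonalMetric

/-! ### The product rule in the left-invariant frame -/

section DerivativeAlongFields

set_option linter.unusedSectionVars false

open Set Filter
open scoped Topology

variable {n : ℕ} {N : Type*} [TopologicalSpace N] [ChartedSpace (EuclideanSpace ℝ (Fin n)) N]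
  {V W : Type*} [AddCommGroup V] [Module ℝ V] [Module.Finite ℝ V]
  [AddCommGroup W] [Module ℝ W] [Module.Finite ℝ W]

/-- A family of linear maps is differentiable if it is so pointwise. -/
lemma dualMDifferentiableAt_hom_of_apply {A : N → (W →ₗ[ℝ] V)} {x : N}
    (hA : ∀ w, DualMDifferentiableAt n (fun y ↦ A y w) x) : DualMDifferentiableAt n A x := by
  intro ℓ
  have h : (fun y ↦ ℓ (A y)) = fun y ↦ ∑ i, (ℓ ∘ₗ
      (LinearMap.smulRightₗ ((Module.finBasis ℝ W).coord i) : V →ₗ[ℝ] W →ₗ[ℝ] V))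
        (A y (Module.finBasis ℝ W i)) := by
    ext y
    have h1 : A y = ∑ i, LinearMap.smulRightₗ ((Module.finBasis ℝ W).coord i)
        (A y (Module.finBasis ℝ W i)) := by
      ext w
      rw [LinearMap.sum_apply]
      conv_lhs => rw [← (Module.finBasis ℝ W).sum_repr w, map_sum]
      exact Finset.sum_congr rfl fun i _ ↦ map_smul (A y) _ _
    conv_lhs => rw [h1]
    simp
  rw [h]
  exact (mvfderiv_sum_apply Finset.univ (fun i _ ↦ hA _ _) 0).1

variable {G : Type*} [TopologicalSpace G] [ChartedSpace (EuclideanSpace ℝ (Fin n)) G]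
  [Group G] [LieGroup (𝓡 n) ∞ G]

/-- The product rule for the derivative of `F` along the vector field on `G` which `Y` defines in
the left-invariant frame. -/
lemma leftDeriv_leftDeriv {F : G → V} {Y : G → GroupLieAlgebra (𝓡 n) G} {b : G}
    (hF : DualContMDiffAt n 2 F b) (hY : DualMDifferentiableAt n Y b) :
    DualMDifferentiableAt n (fun a ↦ leftDeriv n F a (Y a)) b ∧
    ∀ X, leftDeriv n (fun a ↦ leftDeriv n F a (Y a)) b X =
      leftDeriv n (fun a ↦ leftDeriv n F a (Y b)) b X + leftDeriv n F b (leftDeriv n Y b X) := by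
  have h : DualMDifferentiableAt n (fun a ↦ leftDeriv n F a) b :=
    dualMDifferentiableAt_hom_of_apply fun X ↦ hF.leftDeriv_apply X
  refine ⟨h.bilinear hY (LinearMap.id : (GroupLieAlgebra (𝓡 n) G →ₗ[ℝ] V) →ₗ[ℝ] _), fun X ↦ ?_⟩
  have h1 := dualDeriv_bilinear h hY
    (LinearMap.id : (GroupLieAlgebra (𝓡 n) G →ₗ[ℝ] V) →ₗ[ℝ] _) (leftTranslation b X)
  have h2 := dualDeriv_linearMap_comp h (LinearMap.applyₗ (R := ℝ) (M₂ := V) (Y b))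
    (leftTranslation b X)
  exact h1.trans (congrArg₂ (· + ·) h2.symm rfl)

end DerivativeAlongFields

/-! ### The Levi-Civita connection of a diagonal metric -/

section DiagonalConnection

set_option linter.unusedSectionVars false

open Set Filter VectorField
open scoped Topology

variable {n k : ℕ} {G : Type*} [TopologicalSpace G] [ChartedSpace (EuclideanSpace ℝ (Fin n)) G]
  [Group G] [LieGroup (𝓡 n) ∞ G] {H : Subgroup G}
  [ChartedSpace (EuclideanSpace ℝ (Fin k)) (G ⧸ H)] [IsManifold (𝓡 k) ∞ (G ⧸ H)]
  {m : Fin 3 → Submodule ℝ (GroupLieAlgebra (𝓡 n) G)} {d : Fin 3 → ℕ}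
  {e : ∀ i, Fin (d i) → GroupLieAlgebra (𝓡 n) G} {T : SmoothMetric k (G ⧸ H)} {z : Fin 3 → ℝ}

variable (e T z) in
/-- The function on `G` with values in the Lie algebra which represents `∇_v Y`, where `v` is the
tangent vector with horizontal lift `X` at `b`: the derivative of the function representing `Y`,
corrected by Nomizu's map of the metric with parameters `r`. -/
noncomputable def liftCov (r : Fin 3 → ℝ) (Y : Π x : G ⧸ H, TangentSpace (𝓡 k) x) (b : G) :
    GroupLieAlgebra (𝓡 n) G →ₗ[ℝ] GroupLieAlgebra (𝓡 n) G :=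
  leftDeriv n (liftField T z e Y) b + (nomizuMap e r).flip (liftField T z e Y b)

lemma liftCov_apply (r : Fin 3 → ℝ) (Y : Π x : G ⧸ H, TangentSpace (𝓡 k) x) (b : G)
    (X : GroupLieAlgebra (𝓡 n) G) :
    liftCov e T z r Y b X =
      leftDeriv n (liftField T z e Y) b X + nomizuMap e r X (liftField T z e Y b) := rfl

variable (e T z) in
/-- The Levi-Civita connection of the metric with parameters `r`, as an operator on vector fields.
It is computed with the representative `x.out` of `x`; for fields which are differentiable at `x`
every representative gives the same value, see `IsWallachQuotient.diagonalCov_eq`. -/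
noncomputable def diagonalCov (r : Fin 3 → ℝ) (Y : Π x : G ⧸ H, TangentSpace (𝓡 k) x)
    (x : G ⧸ H) : TangentSpace (𝓡 k) x →L[ℝ] TangentSpace (𝓡 k) x :=
  LinearMap.toContinuousLinearMap
    (projFrame x x.out ∘ₗ liftCov e T z r Y x.out ∘ₗ horizontalLift T z e x x.out)

lemma diagonalCov_apply (r : Fin 3 → ℝ) (Y : Π x : G ⧸ H, TangentSpace (𝓡 k) x)
    (x : G ⧸ H) (v : TangentSpace (𝓡 k) x) :
    diagonalCov e T z r Y x v =
      projFrame x x.out (liftCov e T z r Y x.out (horizontalLift T z e x x.out v)) := rfl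

namespace IsWallachQuotient

variable (Q : IsWallachQuotient H m e T z)

include Q

/-- The covariant derivative is `H`-equivariant on the level of functions on `G`. -/
lemma liftCov_mul_right (r : Fin 3 → ℝ) {Y : Π x : G ⧸ H, TangentSpace (𝓡 k) x} {b : G}
    (hY : MDifferentiableAt (𝓡 k) (𝓡 k).tangent
      (fun y ↦ (⟨y, Y y⟩ : TangentBundle (𝓡 k) (G ⧸ H))) (b : G ⧸ H)) {a : G} (ha : a ∈ H)
    (X : GroupLieAlgebra (𝓡 n) G) :
    liftCov e T z r Y (b * a) (adjointRep a⁻¹ X) = adjointRep a⁻¹ (liftCov e T z r Y b X) := by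
  have hba : ((b * a : G) : G ⧸ H) = b := QuotientGroup.mk_mul_of_mem b ha
  have h1 : DualMDifferentiableAt n (liftField T z e Y) b := Q.dualMDifferentiableAt_liftField hY
  have h2 : DualMDifferentiableAt n (liftField T z e Y) (b * a) :=
    Q.dualMDifferentiableAt_liftField (by rw [hba]; exact hY)
  have h3 : leftDeriv n (liftField T z e Y) (b * a) (adjointRep a⁻¹ X) =
      adjointRep a⁻¹ (leftDeriv n (liftField T z e Y) b X) := by
    rw [← leftDeriv_comp_mul_right h2]
    have : (fun y ↦ liftField T z e Y (y * a)) =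
        fun y ↦ adjointRepLinear a⁻¹ (liftField T z e Y y) :=
      funext fun y ↦ Q.liftField_mul_right Y y ha
    rw [this]
    exact dualDeriv_linearMap_comp h1 _ _
  have h4 : nomizuMap e r (adjointRep a⁻¹ X) (adjointRep a⁻¹ (liftField T z e Y b)) =
      adjointRep a⁻¹ (nomizuMap e r X (liftField T z e Y b)) :=
    Q.decomposition.nomizuMap_equiv (Q.preserves a⁻¹ (inv_mem ha)) r X _
  rw [liftCov_apply, liftCov_apply, h3, Q.liftField_mul_right Y b ha, h4]
  exact (map_add (adjointRepLinear a⁻¹) _ _).symm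

/-- The connection does not depend on the representative of the point. -/
lemma diagonalCov_eq (r : Fin 3 → ℝ) {Y : Π x : G ⧸ H, TangentSpace (𝓡 k) x} {x : G ⧸ H}
    (hY : MDifferentiableAt (𝓡 k) (𝓡 k).tangent
      (fun y ↦ (⟨y, Y y⟩ : TangentBundle (𝓡 k) (G ⧸ H))) x) {b : G} (hb : (b : G ⧸ H) = x)
    (v : TangentSpace (𝓡 k) x) :
    diagonalCov e T z r Y x v =
      projFrame x b (liftCov e T z r Y b (horizontalLift T z e x b v)) := by
  have hx : ((x.out : G) : G ⧸ H) = x := Quotient.out_eq x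
  have hmem : b⁻¹ * x.out ∈ H := QuotientGroup.eq.1 (hb.trans hx.symm)
  have h1 : x.out = b * (b⁻¹ * x.out) := by group
  rw [diagonalCov_apply, h1, Q.horizontalLift_mul_right hb hmem,
    Q.liftCov_mul_right r (by rw [hb]; exact hY) hmem, projFrame_mul_right Q.submersion hb hmem,
    ← adjointRep_mul, mul_inv_cancel, adjointRep_one]

lemma liftField_add (Y Y' : Π x : G ⧸ H, TangentSpace (𝓡 k) x) (b : G) :
    liftField T z e (Y + Y') b = liftField T z e Y b + liftField T z e Y' b :=
  (horizontalLift T z e (b : G ⧸ H) b).map_add _ _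

lemma liftField_smul (f : G ⧸ H → ℝ) (Y : Π x : G ⧸ H, TangentSpace (𝓡 k) x) (b : G) :
    liftField T z e (f • Y) b = f (b : G ⧸ H) • liftField T z e Y b :=
  (horizontalLift T z e (b : G ⧸ H) b).map_smul _ _

lemma leftDeriv_comp_mk {f : G ⧸ H → ℝ} {x : G ⧸ H} {b : G} (hb : (b : G ⧸ H) = x)
    (hf : MDifferentiableAt (𝓡 k) 𝓘(ℝ) f x) (X : GroupLieAlgebra (𝓡 n) G) :
    leftDeriv n (fun a : G ↦ f (a : G ⧸ H)) b X = mvfderiv (𝓡 k) f x (projFrame x b X) := by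
  have h : MDifferentiableAt (𝓡 n) 𝓘(ℝ) (fun a : G ↦ f (a : G ⧸ H)) b :=
    mdifferentiableAt_comp_mk Q.submersion (by rw [hb]; exact hf)
  rw [mvfderiv_projFrame Q.submersion hb hf, leftDeriv_apply, dualDeriv_eq_mvfderiv h]

lemma isCovariantDerivativeOn_diagonalCov (r : Fin 3 → ℝ) :
    IsCovariantDerivativeOn (EuclideanSpace ℝ (Fin k))
      (V := fun x : G ⧸ H ↦ TangentSpace (𝓡 k) x) (I := 𝓡 k) (diagonalCov e T z r) univ where
  add {Y Y' x} hY hY' _ := by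
    ext1 v
    have hx : ((x.out : G) : G ⧸ H) = x := Quotient.out_eq x
    have h := Q.dualMDifferentiableAt_liftField (b := x.out) (Y := Y) (by rw [hx]; exact hY)
    have h' := Q.dualMDifferentiableAt_liftField (b := x.out) (Y := Y') (by rw [hx]; exact hY')
    rw [add_apply, diagonalCov_apply, diagonalCov_apply, diagonalCov_apply, ← map_add]
    congr 1
    rw [liftCov_apply, liftCov_apply, liftCov_apply, Q.liftField_add, map_add]
    have h1 : liftField T z e (Y + Y') = fun b ↦ liftField T z e Y b + liftField T z e Y' b :=
      funext (Q.liftField_add Y Y')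
    have h2 := dualDeriv_add h h' (leftTranslation x.out (horizontalLift T z e x x.out v))
    rw [h1, leftDeriv_apply, h2]
    exact add_add_add_comm _ _ _ _
  leibniz {Y f x} hY hf _ := by
    ext1 v
    have hx : ((x.out : G) : G ⧸ H) = x := Quotient.out_eq x
    have h := Q.dualMDifferentiableAt_liftField (b := x.out) (Y := Y) (by rw [hx]; exact hY)
    have hf' : DualMDifferentiableAt n (fun a : G ↦ f (a : G ⧸ H)) x.out :=
      mdifferentiableAt_iff_dualMDifferentiableAt.2
        (mdifferentiableAt_comp_mk Q.submersion (by rw [hx]; exact hf))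
    have h1 : liftField T z e (f • Y) = fun b : G ↦ (LinearMap.lsmul ℝ (GroupLieAlgebra (𝓡 n) G))
        (f (b : G ⧸ H)) (liftField T z e Y b) := funext (Q.liftField_smul f Y)
    have h2 := dualDeriv_bilinear hf' h (LinearMap.lsmul ℝ (GroupLieAlgebra (𝓡 n) G))
      (leftTranslation x.out (horizontalLift T z e x x.out v))
    have h3 := Q.leftDeriv_comp_mk hx hf (horizontalLift T z e x x.out v)
    rw [Q.projFrame_horizontalLift hx] at h3
    have h4 : liftCov e T z r (f • Y) x.out (horizontalLift T z e x x.out v) =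
        f x • liftCov e T z r Y x.out (horizontalLift T z e x x.out v) +
          mvfderiv (𝓡 k) f x v • liftField T z e Y x.out := by
      rw [liftCov_apply, liftCov_apply, Q.liftField_smul, map_smul, hx, h1, ← h3]
      refine (congrArg (· + _) h2).trans ?_
      simp only [LinearMap.lsmul_apply, smul_add, hx]
      exact add_rotate _ _ _
    have h5 : projFrame x x.out (liftField T z e Y x.out) = Y x := by
      rw [liftField_eq_horizontalLift Y hx, Q.projFrame_horizontalLift hx]
    have h6 := congrArg (projFrame (k := k) x x.out) h4
    rw [map_add, map_smul, map_smul, h5] at h6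
    exact h6

/-- The Levi-Civita connection of the metric with parameters `r`. -/
noncomputable def diagonalConnection (r : Fin 3 → ℝ) : AffineConnection k (G ⧸ H) where
  toFun := diagonalCov e T z r
  isCovariantDerivativeOnUniv := Q.isCovariantDerivativeOn_diagonalCov r

lemma leftDeriv_liftField_mem {Y : Π x : G ⧸ H, TangentSpace (𝓡 k) x} {b : G}
    (hY : MDifferentiableAt (𝓡 k) (𝓡 k).tangent
      (fun y ↦ (⟨y, Y y⟩ : TangentBundle (𝓡 k) (G ⧸ H))) (b : G ⧸ H))
    (X : GroupLieAlgebra (𝓡 n) G) : leftDeriv n (liftField T z e Y) b X ∈ ⨆ i, m i := by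
  have h : liftField T z e Y = fun a ↦ wallachProjM e (liftField T z e Y a) :=
    funext fun a ↦ (Q.decomposition.projM_of_mem (Q.liftField_mem Y a)).symm
  have h1 := dualDeriv_linearMap_comp (Q.dualMDifferentiableAt_liftField hY) (wallachProjM e)
    (leftTranslation b X)
  rw [← h] at h1
  rw [leftDeriv_apply, h1]
  exact Q.decomposition.projM_mem _

lemma liftCov_mem (r : Fin 3 → ℝ) {Y : Π x : G ⧸ H, TangentSpace (𝓡 k) x} {b : G}
    (hY : MDifferentiableAt (𝓡 k) (𝓡 k).tangent
      (fun y ↦ (⟨y, Y y⟩ : TangentBundle (𝓡 k) (G ⧸ H))) (b : G ⧸ H))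
    (X : GroupLieAlgebra (𝓡 n) G) : liftCov e T z r Y b X ∈ ⨆ i, m i := by
  have h1 := Q.leftDeriv_liftField_mem hY X
  have h2 := Q.decomposition.nomizuMap_mem r X (liftField T z e Y b)
  rw [liftCov_apply]
  exact Submodule.add_mem _ h1 h2

lemma horizontalLift_diagonalCov (r : Fin 3 → ℝ) {Y : Π x : G ⧸ H, TangentSpace (𝓡 k) x}
    {x : G ⧸ H} (hY : MDifferentiableAt (𝓡 k) (𝓡 k).tangent
      (fun y ↦ (⟨y, Y y⟩ : TangentBundle (𝓡 k) (G ⧸ H))) x) {b : G} (hb : (b : G ⧸ H) = x)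
    (v : TangentSpace (𝓡 k) x) :
    horizontalLift T z e x b (diagonalCov e T z r Y x v) =
      liftCov e T z r Y b (horizontalLift T z e x b v) := by
  rw [Q.diagonalCov_eq r hY hb, Q.horizontalLift_projFrame hb, Q.decomposition.projM_of_mem
    (Q.liftCov_mem r (by rw [hb]; exact hY) _)]

/-- The connection is metric, because the Nomizu map takes values in skew operators and functions
are differentiated along the horizontal lift. -/
lemma mvfderiv_diagonalMetric {r : Fin 3 → ℝ} (hr : ∀ i, 0 < r i)
    {Y Z : Π x : G ⧸ H, TangentSpace (𝓡 k) x} {x : G ⧸ H}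
    (hY : MDifferentiableAt (𝓡 k) (𝓡 k).tangent
      (fun y ↦ (⟨y, Y y⟩ : TangentBundle (𝓡 k) (G ⧸ H))) x)
    (hZ : MDifferentiableAt (𝓡 k) (𝓡 k).tangent
      (fun y ↦ (⟨y, Z y⟩ : TangentBundle (𝓡 k) (G ⧸ H))) x) (v : TangentSpace (𝓡 k) x) :
    mvfderiv (𝓡 k) (fun y ↦ (Q.diagonalMetric r hr).inner y (Y y) (Z y)) x v =
      (Q.diagonalMetric r hr).inner x (diagonalCov e T z r Y x v) (Z x) +
        (Q.diagonalMetric r hr).inner x (Y x) (diagonalCov e T z r Z x v) := by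
  induction x using QuotientGroup.induction_on with
  | H b =>
    have hf : MDifferentiableAt (𝓡 k) 𝓘(ℝ)
        (fun y ↦ (Q.diagonalMetric r hr).inner y (Y y) (Z y)) (b : G ⧸ H) := by
      have := ((Q.diagonalMetric r hr).contMDiff.mdifferentiableAt (x := (b : G ⧸ H))
        (by simp)).clm_bundle_apply₂ (E₃ := Bundle.Trivial (G ⧸ H) ℝ) hY hZ
      exact ((mdifferentiableAt_totalSpace _ _).1 this).2
    have hY' := Q.dualMDifferentiableAt_liftField hY
    have hZ' := Q.dualMDifferentiableAt_liftField hZ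
    set X := horizontalLift T z e (b : G ⧸ H) b v with hX
    have hXm : X ∈ ⨆ i, m i := Q.horizontalLift_mem rfl v
    have h1 := Q.leftDeriv_comp_mk rfl hf X
    rw [hX, Q.projFrame_horizontalLift rfl, ← hX] at h1
    have h2 : (fun a : G ↦ (Q.diagonalMetric r hr).inner (a : G ⧸ H) (Y a) (Z a)) =
        fun a ↦ diagForm e r (liftField T z e Y a) (liftField T z e Z a) :=
      funext fun a ↦ Q.diagonalMetric_inner hr rfl _ _
    have h3 := mvfderiv_bilinear hY' hZ' (diagForm e r) (leftTranslation b X)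
    have h4 := Q.decomposition.diagForm_nomizuMap hr hXm (Q.liftField_mem Y b)
      (Q.liftField_mem Z b)
    rw [← h1, h2, leftDeriv_apply, dualDeriv_eq_mvfderiv h3.1, h3.2,
      Q.diagonalMetric_inner hr rfl, Q.diagonalMetric_inner hr rfl,
      Q.horizontalLift_diagonalCov r hY rfl, Q.horizontalLift_diagonalCov r hZ rfl, ← hX,
      liftCov_apply, liftCov_apply, map_add, map_add, LinearMap.add_apply, leftDeriv_apply,
      leftDeriv_apply]
    change _ = diagForm e r _ (liftField T z e Z b) +
      diagForm e r (nomizuMap e r X (liftField T z e Y b)) (liftField T z e Z b) +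
      (diagForm e r (liftField T z e Y b) _ +
        diagForm e r (liftField T z e Y b) (nomizuMap e r X (liftField T z e Z b)))
    linear_combination -h4

/-- The Lie bracket of vector fields in terms of the functions which represent them. -/
lemma mlieBracket_eq {Y Z : Π x : G ⧸ H, TangentSpace (𝓡 k) x} {b : G}
    (hY : MDifferentiableAt (𝓡 k) (𝓡 k).tangent
      (fun y ↦ (⟨y, Y y⟩ : TangentBundle (𝓡 k) (G ⧸ H))) (b : G ⧸ H))
    (hZ : MDifferentiableAt (𝓡 k) (𝓡 k).tangent
      (fun y ↦ (⟨y, Z y⟩ : TangentBundle (𝓡 k) (G ⧸ H))) (b : G ⧸ H)) :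
    mlieBracket (𝓡 k) Y Z (b : G ⧸ H) = projFrame (b : G ⧸ H) b
      (leftDeriv n (liftField T z e Z) b (liftField T z e Y b) -
        leftDeriv n (liftField T z e Y) b (liftField T z e Z b) +
        ⁅liftField T z e Y b, liftField T z e Z b⁆) := by
  refine eq_of_mvfderiv_eq fun f hf ↦ ?_
  have hf2 : ContMDiffAt (𝓡 k) 𝓘(ℝ) 2 f (b : G ⧸ H) := hf.of_le ENat.LEInfty.out
  have hf' : DualContMDiffAt n 2 (fun a : G ↦ f (a : G ⧸ H)) b := fun ℓ ↦ by
    have h1 : ContMDiffAt (𝓡 n) 𝓘(ℝ) 2 (fun a : G ↦ f (a : G ⧸ H)) b :=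
      hf2.comp b ((Q.submersion.contMDiff.of_le ENat.LEInfty.out).contMDiffAt)
    have h2 : (fun a : G ↦ ℓ (f (a : G ⧸ H))) = fun a : G ↦ f (a : G ⧸ H) * ℓ 1 := by
      ext a
      rw [← smul_eq_mul, ← map_smul, smul_eq_mul, mul_one]
    rw [h2]
    exact h1.mul contMDiffAt_const
  -- the derivative of `f` along a vector field, and its derivative
  have key : ∀ {V W : Π x : G ⧸ H, TangentSpace (𝓡 k) x},
      MDifferentiableAt (𝓡 k) (𝓡 k).tangent
        (fun y ↦ (⟨y, W y⟩ : TangentBundle (𝓡 k) (G ⧸ H))) (b : G ⧸ H) →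
      mvfderiv (𝓡 k) (fun y ↦ mvfderiv (𝓡 k) f y (W y)) (b : G ⧸ H) (V (b : G ⧸ H)) =
        leftDeriv n (fun a ↦ leftDeriv n (fun a : G ↦ f (a : G ⧸ H)) a (liftField T z e W b)) b
          (liftField T z e V b) + leftDeriv n (fun a : G ↦ f (a : G ⧸ H)) b
            (leftDeriv n (liftField T z e W) b (liftField T z e V b)) := by
    intro V W hW
    rw [← (leftDeriv_leftDeriv hf' (Q.dualMDifferentiableAt_liftField hW)).2]
    have h1 := Q.leftDeriv_comp_mk rfl (mdifferentiableAt_mvfderiv_apply hf2 hW)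
      (liftField T z e V b)
    rw [Q.projFrame_liftField] at h1
    rw [← h1, leftDeriv_apply, leftDeriv_apply]
    refine LinearMap.congr_fun (dualDeriv_congr ?_) (leftTranslation b (liftField T z e V b))
    have hd : ∀ᶠ y in 𝓝 (b : G ⧸ H), MDifferentiableAt (𝓡 k) 𝓘(ℝ) f y :=
      ((contMDiffAt_iff_contMDiffAt_nhds (by simp)).1 hf2).mono fun y hy ↦
        hy.mdifferentiableAt (by simp)
    filter_upwards [(Q.submersion.contMDiff.continuous.tendsto b).eventually hd] with a ha
    have h2 := Q.leftDeriv_comp_mk rfl ha (liftField T z e W a)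
    rw [Q.projFrame_liftField] at h2
    exact h2.symm
  rw [mvfderiv_mlieBracket hf2 hY hZ, key hZ, key hY,
    ← Q.leftDeriv_comp_mk rfl (hf2.mdifferentiableAt (by simp)), map_add, map_sub,
    leftDeriv_lie hf']
  ring

/-- The torsion vanishes by `mlieBracket_eq` and `nomizuMap_sub_swap`. -/
lemma isLeviCivita_diagonalConnection {r : Fin 3 → ℝ} (hr : ∀ i, 0 < r i) :
    IsLeviCivita (Q.diagonalMetric r hr) (Q.diagonalConnection r) := by
  refine ⟨(CovariantDerivative.torsion_eq_zero_iff _).2 ?_, fun Y Z x v hY hZ ↦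
    Q.mvfderiv_diagonalMetric hr hY hZ v⟩
  intro Y Z x hY hZ
  induction x using QuotientGroup.induction_on with
  | H b =>
    change diagonalCov e T z r Z (b : G ⧸ H) (Y (b : G ⧸ H)) -
      diagonalCov e T z r Y (b : G ⧸ H) (Z (b : G ⧸ H)) = _
    rw [Q.mlieBracket_eq hY hZ, Q.diagonalCov_eq r hZ rfl, Q.diagonalCov_eq r hY rfl, ← map_sub]
    change projFrame (b : G ⧸ H) b (liftCov e T z r Z b (liftField T z e Y b) -
      liftCov e T z r Y b (liftField T z e Z b)) = _
    rw [liftCov_apply, liftCov_apply, add_sub_add_comm, Q.decomposition.nomizuMap_sub_swap hr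
      (Q.liftField_mem Y b) (Q.liftField_mem Z b), map_add, map_add, Q.projFrame_projM rfl]

end IsWallachQuotient

end DiagonalConnection

/-! ### The curvature of a diagonal metric -/

section DiagonalCurvature

set_option linter.unusedSectionVars false

open Set Filter VectorField
open scoped Topology

variable {n k : ℕ} {G : Type*} [TopologicalSpace G] [ChartedSpace (EuclideanSpace ℝ (Fin n)) G]
  [Group G] [LieGroup (𝓡 n) ∞ G] {H : Subgroup G}
  [ChartedSpace (EuclideanSpace ℝ (Fin k)) (G ⧸ H)] [IsManifold (𝓡 k) ∞ (G ⧸ H)]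
  {m : Fin 3 → Submodule ℝ (GroupLieAlgebra (𝓡 n) G)} {d : Fin 3 → ℕ}
  {e : ∀ i, Fin (d i) → GroupLieAlgebra (𝓡 n) G} {T : SmoothMetric k (G ⧸ H)} {z : Fin 3 → ℝ}

section

variable (hπ : Manifold.IsSubmersion (𝓡 n) (𝓡 k) ∞ (fun a : G ↦ (a : G ⧸ H)))

include hπ

/-- Along the fibres of the projection, the function representing a vector field is determined by
its equivariance. -/
lemma leftDeriv_of_equivariant {F : G → GroupLieAlgebra (𝓡 n) G} {b : G}
    (hF : DualMDifferentiableAt n F b) (hFH : ∀ a ∈ H, F (b * a) = adjointRep a⁻¹ (F b))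
    {U : GroupLieAlgebra (𝓡 n) G} (hU : U ∈ subgroupLieAlgebra k H) :
    leftDeriv n F b U = -⁅U, F b⁆ := by
  have h1 : DualMDifferentiableAt n (fun a : G ↦ F (b * a)) 1 :=
    DualMDifferentiableAt.comp (n' := n) (by rw [mul_one]; exact hF)
      ((contMDiff_left_mul b).mdifferentiableAt (by simp))
  have h2 : DualMDifferentiableAt n (fun a : G ↦ adjointRepLinear (n := n) a) 1 :=
    dualMDifferentiableAt_hom_of_apply fun X ↦ dualMDifferentiableAt_adjointRep 1 X
  have h3 : DualMDifferentiableAt n (fun a : G ↦ adjointRep a (F (b * a))) 1 :=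
    h2.bilinear h1 LinearMap.id
  have h4 : dualDeriv n (fun a : G ↦ adjointRep a (F (b * a))) 1 U =
      dualDeriv n (fun a : G ↦ adjointRepLinear (n := n) a) 1 U (F (b * 1)) +
        adjointRep 1 (dualDeriv n (fun a : G ↦ F (b * a)) 1 U) :=
    dualDeriv_bilinear h2 h1 LinearMap.id U
  have h5 : dualDeriv n (fun a : G ↦ adjointRep a (F (b * a))) 1 U = 0 := by
    refine eq_of_dual_eq fun ℓ ↦ ?_
    rw [h3.dual_dualDeriv, mvfderiv_eq_of_eqOn_subgroup hπ (h3 ℓ)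
      (dualMDifferentiableAt_const (F b) 1 ℓ) (fun a ha ↦ by
        beta_reduce
        rw [hFH a ha, ← adjointRep_mul, mul_inv_cancel, adjointRep_one]) hU,
      ← (dualMDifferentiableAt_const (F b) 1).dual_dualDeriv, dualDeriv_const]
  have h6 : leftDeriv n F b U = dualDeriv n (fun a : G ↦ F (b * a)) 1 U :=
    eq_of_dual_eq fun ℓ ↦ by
      rw [dual_leftDeriv hF, h1.dual_dualDeriv, mvfderiv_leftTranslation (hF ℓ)]
  have h7 : dualDeriv n (fun a : G ↦ adjointRepLinear (n := n) a) 1 U (F b) = ⁅U, F b⁆ := by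
    rw [← dualDeriv_adjointRep_one]
    exact (dualDeriv_linearMap_comp h2 (LinearMap.applyₗ (R := ℝ)
      (M₂ := GroupLieAlgebra (𝓡 n) G) (F b)) U).symm
  rw [h5, mul_one, h7, adjointRep_one, ← h6] at h4
  exact eq_neg_of_add_eq_zero_right h4.symm

end

namespace IsWallachQuotient

variable (Q : IsWallachQuotient H m e T z)

include Q

/-- The iterated covariant derivative in terms of the functions which represent vector fields. -/
lemma liftCov_diagonalCov (r : Fin 3 → ℝ) {X Y Z : Π x : G ⧸ H, TangentSpace (𝓡 k) x} {b : G}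
    (hY : MDifferentiableAt (𝓡 k) (𝓡 k).tangent
      (fun y ↦ (⟨y, Y y⟩ : TangentBundle (𝓡 k) (G ⧸ H))) (b : G ⧸ H))
    (hZ : ContMDiffAt (𝓡 k) (𝓡 k).tangent 2
      (fun y ↦ (⟨y, Z y⟩ : TangentBundle (𝓡 k) (G ⧸ H))) (b : G ⧸ H)) :
    liftCov e T z r (fun y ↦ diagonalCov e T z r Z y (Y y)) b (liftField T z e X b) =
      leftDeriv n (fun a ↦ leftDeriv n (liftField T z e Z) a (liftField T z e Y b)) b
          (liftField T z e X b) +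
        liftCov e T z r Z b (leftDeriv n (liftField T z e Y) b (liftField T z e X b)) +
        nomizuMap e r (liftField T z e Y b)
          (leftDeriv n (liftField T z e Z) b (liftField T z e X b)) +
        nomizuMap e r (liftField T z e X b)
          (leftDeriv n (liftField T z e Z) b (liftField T z e Y b)) +
        nomizuMap e r (liftField T z e X b)
          (nomizuMap e r (liftField T z e Y b) (liftField T z e Z b)) := by
  have hY' := Q.dualMDifferentiableAt_liftField hY
  have hZ2 : DualContMDiffAt n 2 (liftField T z e Z) b :=
    Q.dualContMDiffAt_liftField ENat.LEInfty.out hZ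
  have hZ' := hZ2.dualMDifferentiableAt (by simp)
  have h1 : ∀ᶠ a in 𝓝 b, liftField T z e (fun y ↦ diagonalCov e T z r Z y (Y y)) a =
      leftDeriv n (liftField T z e Z) a (liftField T z e Y a) +
        nomizuMap e r (liftField T z e Y a) (liftField T z e Z a) := by
    have hd := (contMDiffAt_iff_contMDiffAt_nhds (by simp)).1 hZ
    filter_upwards [(Q.submersion.contMDiff.continuous.tendsto b).eventually hd] with a ha
    exact Q.horizontalLift_diagonalCov r (ha.mdifferentiableAt (by simp)) rfl _
  have h2 := leftDeriv_leftDeriv hZ2 hY'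
  have h3 := hY'.bilinear hZ' (nomizuMap e r)
  have h4 := dualDeriv_bilinear hY' hZ' (nomizuMap e r) (leftTranslation b (liftField T z e X b))
  have h5 := dualDeriv_add h2.1 h3 (leftTranslation b (liftField T z e X b))
  have h6 : leftDeriv n (liftField T z e (fun y ↦ diagonalCov e T z r Z y (Y y))) b
      (liftField T z e X b) =
      leftDeriv n (fun a ↦ leftDeriv n (liftField T z e Z) a (liftField T z e Y b)) b
          (liftField T z e X b) +
        leftDeriv n (liftField T z e Z) b (leftDeriv n (liftField T z e Y) b
          (liftField T z e X b)) +
        (nomizuMap e r (leftDeriv n (liftField T z e Y) b (liftField T z e X b))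
          (liftField T z e Z b) + nomizuMap e r (liftField T z e Y b)
          (leftDeriv n (liftField T z e Z) b (liftField T z e X b))) := by
    rw [← h2.2, leftDeriv_apply, dualDeriv_congr h1, h5, h4]
    rfl
  rw [liftCov_apply, liftCov_apply, h6, h1.self_of_nhds, map_add]
  abel

/-- The curvature of the Levi-Civita connection.  On functions on `G`, the second derivatives along
left-invariant fields combine to the derivative along `⁅X, Y⁆`; its component in `m` is absorbed by
the covariant derivative along the Lie bracket of the fields, and its component in `h` is computed
by `leftDeriv_of_equivariant`. -/
lemma curvature_diagonalConnection {r : Fin 3 → ℝ} {X Y Z : Π x : G ⧸ H, TangentSpace (𝓡 k) x}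
    {x : G ⧸ H}
    (hX : MDifferentiableAt (𝓡 k) (𝓡 k).tangent
      (fun y ↦ (⟨y, X y⟩ : TangentBundle (𝓡 k) (G ⧸ H))) x)
    (hY : MDifferentiableAt (𝓡 k) (𝓡 k).tangent
      (fun y ↦ (⟨y, Y y⟩ : TangentBundle (𝓡 k) (G ⧸ H))) x)
    (hZ : ContMDiffAt (𝓡 k) (𝓡 k).tangent 2
      (fun y ↦ (⟨y, Z y⟩ : TangentBundle (𝓡 k) (G ⧸ H))) x) :
    curvature (Q.diagonalConnection r) X Y Z x =
      projFrame x x.out (nomizuCurvature e r (horizontalLift T z e x x.out (X x))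
        (horizontalLift T z e x x.out (Y x)) (horizontalLift T z e x x.out (Z x))) := by
  have hx : ((x.out : G) : G ⧸ H) = x := Quotient.out_eq x
  rw [curvature]
  change diagonalCov e T z r (fun y ↦ diagonalCov e T z r Z y (Y y)) x (X x) -
    diagonalCov e T z r (fun y ↦ diagonalCov e T z r Z y (X y)) x (Y x) -
    diagonalCov e T z r Z x (mlieBracket (𝓡 k) X Y x) = _
  have key : ∀ b : G, (hb : (b : G ⧸ H) = x) →
      liftCov e T z r (fun y ↦ diagonalCov e T z r Z y (Y y)) b (horizontalLift T z e x b (X x)) -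
      liftCov e T z r (fun y ↦ diagonalCov e T z r Z y (X y)) b (horizontalLift T z e x b (Y x)) -
      liftCov e T z r Z b (horizontalLift T z e x b (mlieBracket (𝓡 k) X Y x)) =
      nomizuCurvature e r (horizontalLift T z e x b (X x)) (horizontalLift T z e x b (Y x))
        (horizontalLift T z e x b (Z x)) := by
    rintro b rfl
    have h1 := Q.liftCov_diagonalCov r (X := X) hY hZ
    have h2 := Q.liftCov_diagonalCov r (X := Y) hX hZ
    have hZ' := hZ.mdifferentiableAt (by simp)
    have hZ2 : DualContMDiffAt n 2 (liftField T z e Z) b :=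
      Q.dualContMDiffAt_liftField ENat.LEInfty.out hZ
    have h3 := leftDeriv_lie hZ2 (liftField T z e X b) (liftField T z e Y b)
    have h4 := leftDeriv_of_equivariant Q.submersion (Q.dualMDifferentiableAt_liftField hZ')
      (fun a ha ↦ Q.liftField_mul_right Z b ha)
      (Q.decomposition.sub_projM_mem ⁅liftField T z e X b, liftField T z e Y b⁆)
    have h5 := Q.decomposition.projM_of_mem (sub_mem (Q.leftDeriv_liftField_mem hY
      (liftField T z e X b)) (Q.leftDeriv_liftField_mem hX (liftField T z e Y b)))
    rw [Q.mlieBracket_eq hX hY, Q.horizontalLift_projFrame rfl, map_add, h5]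
    change liftCov e T z r (fun y ↦ diagonalCov e T z r Z y (Y y)) b (liftField T z e X b) -
      liftCov e T z r (fun y ↦ diagonalCov e T z r Z y (X y)) b (liftField T z e Y b) - _ =
      nomizuCurvature e r (liftField T z e X b) (liftField T z e Y b) (liftField T z e Z b)
    rw [map_sub, h3] at h4
    rw [h1, h2, nomizuCurvature, map_add, map_sub, liftCov_apply r Z b (wallachProjM e _)]
    linear_combination (norm := module) h4
  rw [diagonalCov_apply, diagonalCov_apply, diagonalCov_apply, ← map_sub, ← map_sub, key _ hx]

end IsWallachQuotient

end DiagonalCurvature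

/-! ### The Ricci tensor and the trace of a diagonal metric -/

section DiagonalRicci

set_option linter.unusedSectionVars false

open Set Filter VectorField
open scoped Topology

variable {n k : ℕ} {G : Type*} [TopologicalSpace G] [ChartedSpace (EuclideanSpace ℝ (Fin n)) G]
  [Group G] [LieGroup (𝓡 n) ∞ G] {H : Subgroup G}
  [ChartedSpace (EuclideanSpace ℝ (Fin k)) (G ⧸ H)] [IsManifold (𝓡 k) ∞ (G ⧸ H)]
  {m : Fin 3 → Submodule ℝ (GroupLieAlgebra (𝓡 n) G)} {d : Fin 3 → ℕ}
  {e : ∀ i, Fin (d i) → GroupLieAlgebra (𝓡 n) G} {T : SmoothMetric k (G ⧸ H)} {z : Fin 3 → ℝ}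

/-- The trace as the sum of the diagonal entries. -/
lemma trace_eq_sum_repr {V ι : Type*} [AddCommGroup V] [Module ℝ V] [Fintype ι]
    (B : Module.Basis ι ℝ V) (f : V →ₗ[ℝ] V) : LinearMap.trace ℝ V f = ∑ i, B.repr (f (B i)) i := by
  classical
  rw [LinearMap.trace_eq_matrix_trace ℝ B, Matrix.trace]
  exact Finset.sum_congr rfl fun i _ ↦ by rw [Matrix.diag_apply, LinearMap.toMatrix_apply]

/-- The curvature operator `X ↦ R(X, Y) Z`. -/
noncomputable def nomizuCurvatureLinear {L : Type*} [LieRing L] [LieAlgebra ℝ L]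
    (e : ∀ i, Fin (d i) → L) (r : Fin 3 → ℝ) (Y Z : L) : L →ₗ[ℝ] L where
  toFun X := nomizuCurvature e r X Y Z
  map_add' X X' := by
    simp only [nomizuCurvature, map_add, LinearMap.add_apply, add_lie, sub_lie]
    abel
  map_smul' c X := by
    simp only [nomizuCurvature, map_smul, LinearMap.smul_apply, smul_lie, sub_lie, smul_sub,
      RingHom.id_apply]

namespace IsWallachQuotient

variable (Q : IsWallachQuotient H m e T z)

include Q

/-- The trace of an endomorphism of the tangent space, computed on the Lie algebra in the
orthonormal bases `e i`. -/
lemma trace_projFrame_comp (x : G ⧸ H)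
    (f : GroupLieAlgebra (𝓡 n) G →ₗ[ℝ] GroupLieAlgebra (𝓡 n) G) :
    LinearMap.trace ℝ (TangentSpace (𝓡 k) x)
        (projFrame x x.out ∘ₗ f ∘ₗ horizontalLift T z e x x.out) =
      ∑ i, ∑ a, negKilling _ (e i a) (f (e i a)) := by
  have hx : ((x.out : G) : G ⧸ H) = x := Quotient.out_eq x
  have h1 : (f ∘ₗ horizontalLift T z e x x.out) ∘ₗ projFrame x x.out =
      ∑ i, f ∘ₗ wallachProj e i := by
    ext1 X
    rw [LinearMap.comp_apply, LinearMap.comp_apply, Q.horizontalLift_projFrame hx,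
      wallachProjM_apply, map_sum, LinearMap.sum_apply]
    rfl
  rw [LinearMap.trace_comp_comm', h1, map_sum]
  exact Finset.sum_congr rfl fun i _ ↦ IsWallachDecomposition.trace_comp_wallachProj f i

/-- The Ricci tensor is the trace of the curvature operator, which is tensorial by
`curvature_diagonalConnection`, so that the extensions to vector fields do not matter. -/
lemma ricci_diagonalConnection (r : Fin 3 → ℝ) (x : G ⧸ H) (v w : TangentSpace (𝓡 k) x) :
    ricci (Q.diagonalConnection r) x v w =
      nomizuRicci e r (horizontalLift T z e x x.out v) (horizontalLift T z e x x.out w) := by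
  refine Eq.trans ?_ ((Q.trace_projFrame_comp x (nomizuCurvatureLinear e r
    (horizontalLift T z e x x.out v) (horizontalLift T z e x x.out w))).trans
    (Finset.sum_congr rfl fun i _ ↦ Finset.sum_congr rfl fun a _ ↦ negKilling_comm _ _))
  rw [trace_eq_sum_repr (tangentBasis x)]
  refine Finset.sum_congr rfl fun i _ ↦ ?_
  have hs : ∀ u : TangentSpace (𝓡 k) x, ContMDiffAt (𝓡 k) (𝓡 k).tangent 2
      (fun y ↦ (⟨y, extendVector u y⟩ : TangentBundle (𝓡 k) (G ⧸ H))) x := fun u ↦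
    FiberBundle.contMDiffAt_extend (𝓡 k) (EuclideanSpace ℝ (Fin k)) u
  have he : ∀ u : TangentSpace (𝓡 k) x, extendVector u x = u := fun u ↦
    FiberBundle.extend_apply_self (EuclideanSpace ℝ (Fin k)) u
  rw [Q.curvature_diagonalConnection ((hs _).mdifferentiableAt (by simp))
    ((hs _).mdifferentiableAt (by simp)) (hs _), he, he, he]
  rfl

/-- The metric `T` is obtained from the metric with parameters `r` by the operator which is
`z i / r i` on the `i`-th summand. -/
lemma diagonalMetric_metricOperator {r : Fin 3 → ℝ} (hr : ∀ i, 0 < r i) (x : G ⧸ H)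
    (v w : TangentSpace (𝓡 k) x) :
    (Q.diagonalMetric r hr).inner x v ((projFrame x x.out ∘ₗ
      (∑ i, (z i / r i) • wallachProj e i) ∘ₗ horizontalLift T z e x x.out) w) =
      T.inner x v w := by
  have hx : ((x.out : G) : G ⧸ H) = x := Quotient.out_eq x
  obtain ⟨X, rfl⟩ := surjective_projFrame Q.submersion hx v
  obtain ⟨Y, rfl⟩ := surjective_projFrame Q.submersion hx w
  have hp : ∀ j Y, wallachProj e j (wallachProjM e Y) = wallachProj e j Y := fun j Y ↦ by
    have := Q.decomposition.proj_of_mem_h (i := j) (Q.decomposition.sub_projM_mem Y)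
    rw [map_sub, sub_eq_zero] at this
    exact this.symm
  have hpp : ∀ i j Y, wallachProj e i (wallachProj e j Y) =
      if i = j then wallachProj e i Y else 0 := fun i j Y ↦ by
    split_ifs with h
    · subst h
      exact Q.decomposition.proj_of_mem (Q.decomposition.proj_mem i Y)
    · exact Q.decomposition.proj_of_mem_ne h (Q.decomposition.proj_mem j Y)
  rw [LinearMap.comp_apply, LinearMap.comp_apply, Q.diagonalMetric_inner hr hx,
    Q.horizontalLift_projFrame hx, Q.horizontalLift_projFrame hx, Q.horizontalLift_projFrame hx,
    Q.metric x _ hx, diagForm_apply, diagForm_apply]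
  refine Finset.sum_congr rfl fun i _ ↦ ?_
  have h1 : wallachProj e i ((∑ j, (z j / r j) • wallachProj e j) (wallachProjM e Y)) =
      (z i / r i) • wallachProj e i Y := by
    rw [LinearMap.sum_apply, map_sum, Finset.sum_eq_single i]
    · rw [LinearMap.smul_apply, map_smul, hpp, if_pos rfl, hp]
    · intro j _ hj
      rw [LinearMap.smul_apply, map_smul, hpp, if_neg hj.symm, smul_zero]
    · simp
  rw [hp, hp, h1, map_smul, smul_eq_mul, ← mul_assoc, mul_div_cancel₀ _ (hr i).ne']

end IsWallachQuotient

/-- If `T = g (·, A ·)`, then `tr_g T` is the trace of `A`. -/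
lemma metricTrace_eq_trace {M : Type*} [TopologicalSpace M]
    [ChartedSpace (EuclideanSpace ℝ (Fin k)) M] [IsManifold (𝓡 k) ∞ M] (g T : SmoothMetric k M)
    (x : M) (A : TangentSpace (𝓡 k) x →ₗ[ℝ] TangentSpace (𝓡 k) x)
    (hA : ∀ v w, g.inner x v (A w) = T.inner x v w) :
    metricTrace g T x = LinearMap.trace ℝ _ A := by
  classical
  set B := tangentBasis (k := k) (M := M) x
  set Mg := Matrix.of fun i j ↦ g.inner x (B i) (B j) with hMg
  have h1 : (Matrix.of fun i j ↦ T.inner x (B i) (B j)) = Mg * LinearMap.toMatrix B B A := by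
    ext i j
    rw [Matrix.of_apply, ← hA, Matrix.mul_apply]
    conv_lhs => rw [← B.sum_repr (A (B j)), map_sum]
    refine Finset.sum_congr rfl fun l _ ↦ ?_
    rw [map_smul, hMg, Matrix.of_apply, LinearMap.toMatrix_apply, smul_eq_mul, mul_comm]
  have h2 : Mg.det ≠ 0 := by
    intro h0
    obtain ⟨v, hv, hv0⟩ := Matrix.exists_mulVec_eq_zero_iff.2 h0
    have h3 : ∑ j, v j • B j ≠ 0 := fun h ↦ hv (by
      ext j
      exact Fintype.linearIndependent_iff.1 B.linearIndependent v h j)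
    have h4 : ∀ i, g.inner x (B i) (∑ j, v j • B j) = 0 := fun i ↦ by
      rw [map_sum, ← Pi.zero_apply (M := fun _ ↦ ℝ) i, ← hv0, Matrix.mulVec, dotProduct]
      exact Finset.sum_congr rfl fun j _ ↦ by rw [map_smul, hMg, Matrix.of_apply, smul_eq_mul,
        mul_comm]
    have h5 := g.pos x _ h3
    rw [g.symm, map_sum, Finset.sum_eq_zero] at h5
    · exact lt_irrefl _ h5
    · intro j _
      rw [map_smul, g.symm, h4, smul_zero]
  rw [metricTrace, h1, ← mul_assoc, Matrix.nonsing_inv_mul _ (isUnit_iff_ne_zero.2 h2), one_mul,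
    ← LinearMap.trace_eq_matrix_trace ℝ B]

lemma IsWallachQuotient.metricTrace_diagonalMetric (Q : IsWallachQuotient H m e T z)
    {r : Fin 3 → ℝ} (hr : ∀ i, 0 < r i) (x : G ⧸ H) :
    metricTrace (Q.diagonalMetric r hr) T x = ∑ i, d i * (z i / r i) := by
  rw [metricTrace_eq_trace _ _ x _ (Q.diagonalMetric_metricOperator hr x), Q.trace_projFrame_comp]
  refine Finset.sum_congr rfl fun i _ ↦ ?_
  have h : ∀ a, negKilling _ (e i a) ((∑ j, (z j / r j) • wallachProj e j) (e i a)) =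
      z i / r i := fun a ↦ by
    have hea := Q.decomposition.mem_basis i a
    have h1 := (Q.decomposition.basis i).2 a a
    rw [if_pos rfl, ← negKilling_apply] at h1
    rw [LinearMap.sum_apply, Finset.sum_eq_single i]
    · rw [LinearMap.smul_apply, Q.decomposition.proj_of_mem hea, map_smul, h1, smul_eq_mul, mul_one]
    · intro j _ hj
      rw [LinearMap.smul_apply, Q.decomposition.proj_of_mem_ne hj hea, smul_zero]
    · simp
  rw [Finset.sum_congr rfl fun a _ ↦ h a]
  simp

end DiagonalRicci

/-! ### Prescribing the Ricci curvature -/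

section Existence

set_option linter.unusedSectionVars false

open Set Filter VectorField
open scoped Topology

variable {n k : ℕ} {G : Type*} [TopologicalSpace G] [ChartedSpace (EuclideanSpace ℝ (Fin n)) G]
  [Group G] [LieGroup (𝓡 n) ∞ G] {H : Subgroup G}
  [ChartedSpace (EuclideanSpace ℝ (Fin k)) (G ⧸ H)] [IsManifold (𝓡 k) ∞ (G ⧸ H)]
  {m : Fin 3 → Submodule ℝ (GroupLieAlgebra (𝓡 n) G)} {d : Fin 3 → ℕ}
  {e : ∀ i, Fin (d i) → GroupLieAlgebra (𝓡 n) G} {T : SmoothMetric k (G ⧸ H)} {z : Fin 3 → ℝ}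

/-- An `Ad(H)`-invariant subspace is invariant under the Lie algebra of `H`. -/
lemma lie_mem_of_isAdInvariant
    (hπ : Manifold.IsSubmersion (𝓡 n) (𝓡 k) ∞ (fun a : G ↦ (a : G ⧸ H)))
    {U : Submodule ℝ (GroupLieAlgebra (𝓡 n) G)} (hU : IsAdInvariant H U)
    {X Y : GroupLieAlgebra (𝓡 n) G} (hX : X ∈ subgroupLieAlgebra k H) (hY : Y ∈ U) :
    ⁅X, Y⁆ ∈ U := by
  by_contra h
  obtain ⟨ℓ, hℓ, hℓU⟩ := Submodule.exists_le_ker_of_notMem h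
  have h1 := dualMDifferentiableAt_adjointRep (1 : G) Y
  have h2 := mvfderiv_eq_of_eqOn_subgroup hπ (h1 ℓ)
    (dualMDifferentiableAt_const (0 : GroupLieAlgebra (𝓡 n) G) 1 ℓ) (fun a ha ↦ by
      beta_reduce
      rw [map_zero]
      exact hℓU (hU a ha Y hY)) hX
  rw [← h1.dual_dualDeriv, dualDeriv_adjointRep_one,
    ← (dualMDifferentiableAt_const (0 : GroupLieAlgebra (𝓡 n) G) 1).dual_dualDeriv,
    dualDeriv_const, map_zero] at h2
  exact hℓ h2

lemma IsGeneralisedWallachSpace.isWallachDecomposition (hM : IsGeneralisedWallachSpace (k := k) H m)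
    (he : ∀ i, IsOrthonormalBasisOf (m i) (e i)) :
    IsWallachDecomposition (subgroupLieAlgebra k H) m e where
  pos X hX := by
    have := hM.compact
    have := hM.hausdorff
    exact negKilling_pos hM.semisimple hX
  basis := he
  orthogonal i j hij X hX Y hY := by
    rw [negKilling_apply, hM.orthogonal i j hij X hX Y hY, neg_zero]
  mem_iSup X := by
    simp only [hM.iSup_eq X, negKilling_apply, neg_eq_zero]
  lie_mem := hM.lie_mem
  lie_h_mem i X hX Y hY := lie_mem_of_isAdInvariant hM.submersion (hM.irreducible i).1 hX hY

lemma IsGeneralisedWallachSpace.preservesSummands (hM : IsGeneralisedWallachSpace (k := k) H m)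
    {a : G} (ha : a ∈ H) : PreservesSummands m (adjointLieEquiv (n := n) a) :=
  fun i X hX ↦ ⟨(hM.irreducible i).1 a ha X hX, (hM.irreducible i).1 a⁻¹ (inv_mem ha) X hX⟩

/-- By invariance, the form of `T` at the base point determines `T` at every point in the frames
`projFrame x b`. -/
lemma IsGeneralisedWallachSpace.isWallachQuotient (hM : IsGeneralisedWallachSpace (k := k) H m)
    (he : ∀ i, IsOrthonormalBasisOf (m i) (e i)) (hTinv : IsInvariantMetric G T)
    (hz : ∀ i, 0 < z i)
    (hT : ∀ X Y : Fin 3 → GroupLieAlgebra (𝓡 n) G, (∀ i, X i ∈ m i) → (∀ i, Y i ∈ m i) →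
      T.inner ((1 : G) : G ⧸ H) (dproj H (∑ i, X i)) (dproj H (∑ i, Y i)) =
        ∑ i, z i * -killingForm ℝ (GroupLieAlgebra (𝓡 n) G) (X i) (Y i)) :
    IsWallachQuotient H m e T z where
  submersion := hM.submersion
  decomposition := hM.isWallachDecomposition he
  preserves a ha := hM.preservesSummands ha
  pos := hz
  metric := by
    rintro x b rfl X Y
    have W := hM.isWallachDecomposition he
    obtain ⟨c, rfl⟩ : ∃ c, c * 1 = b := ⟨b, mul_one b⟩
    have h1 : ∀ X : GroupLieAlgebra (𝓡 n) G,
        projFrame (k := k) ((1 : G) : G ⧸ H) 1 X = dproj H (∑ i, wallachProj e i X) := fun X ↦ by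
      have h := (projFrame_eq_zero_iff hM.submersion (b := (1 : G)) rfl _).2 (W.sub_projM_mem X)
      rw [map_sub, sub_eq_zero, wallachProjM_apply] at h
      rw [h, projFrame_one hM.submersion]
    have h2 := mfderiv_smul_projFrame hM.submersion (b := (1 : G)) rfl c X
    have h3 := mfderiv_smul_projFrame hM.submersion (b := (1 : G)) rfl c Y
    have h4 := hTinv c ((1 : G) : G ⧸ H) (projFrame _ 1 X) (projFrame _ 1 Y)
    rw [h2, h3, h1, h1, hT _ _ (fun i ↦ W.proj_mem i X) fun i ↦ W.proj_mem i Y] at h4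
    rw [diagForm_apply]
    exact h4

end Existence

theorem theorem4p1 {n k : ℕ}
    {G : Type*} [TopologicalSpace G] [ChartedSpace (EuclideanSpace ℝ (Fin n)) G] [Group G]
    [LieGroup (𝓡 n) ∞ G] (H : Subgroup G)
    [ChartedSpace (EuclideanSpace ℝ (Fin k)) (G ⧸ H)] [IsManifold (𝓡 k) ∞ (G ⧸ H)]
    (𝔪 : Fin 3 → Submodule ℝ (GroupLieAlgebra (𝓡 n) G))
    (hM : IsGeneralisedWallachSpace (k := k) H 𝔪)
    -- the three isotropy summands are pairwise inequivalent
    (hineq : ∀ i j, i ≠ j → ¬ AreAdEquivalent H (𝔪 i) (𝔪 j))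
    -- `d i` is the dimension of `𝔪 i`, and `[123]` is computed in orthonormal bases `e i`
    (d : Fin 3 → ℕ) (hd : ∀ i, d i = Module.finrank ℝ (𝔪 i))
    (e : ∀ i, Fin (d i) → GroupLieAlgebra (𝓡 n) G)
    (he : ∀ i, IsOrthonormalBasisOf (𝔪 i) (e i))
    (hpos : 0 < structureConstant123 e)
    -- `T = -z 0 π₀^* B - z 1 π₁^* B - z 2 π₂^* B` is an invariant metric
    (T : SmoothMetric k (G ⧸ H)) (hTinv : IsInvariantMetric G T)
    (z : Fin 3 → ℝ) (hz : ∀ i, 0 < z i)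
    (hT : ∀ X Y : Fin 3 → GroupLieAlgebra (𝓡 n) G, (∀ i, X i ∈ 𝔪 i) → (∀ i, Y i ∈ 𝔪 i) →
      T.inner ((1 : G) : G ⧸ H) (dproj H (∑ i, X i)) (dproj H (∑ i, Y i)) =
        ∑ i, z i * -killingForm ℝ (GroupLieAlgebra (𝓡 n) G) (X i) (Y i))
    (p : Fin 3)
    (hp : ∀ i, ((d i : ℝ) - 2 * structureConstant123 e) / (2 * d i * z i) ≤
      ((d p : ℝ) - 2 * structureConstant123 e) / (2 * d p * z p))
    (hcond : ((d p : ℝ) - 2 * structureConstant123 e) *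
        ∑ i ∈ Finset.univ.erase p, (d i : ℝ) * z i <
      ((∑ i, (d i : ℝ)) - d p) * (d p * z p)) :
    ∃ g : SmoothMetric k (G ⧸ H), IsInvariantMetric G g ∧ (∀ x, metricTrace g T x = 1) ∧
      ∃ c : ℝ, 0 < c ∧ HasRicciCurvature g (fun x v w ↦ c * T.inner x v w) := by
  have W := hM.isWallachDecomposition he
  have Q := hM.isWallachQuotient he hTinv hz hT
  have hd0 : ∀ i, 0 < d i := fun i ↦ by
    rw [hd i, Module.finrank_pos_iff_exists_ne_zero]
    obtain ⟨X, hX, hX0⟩ := Submodule.exists_mem_ne_zero_of_ne_bot (hM.irreducible i).2.1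
    exact ⟨⟨X, hX⟩, fun h ↦ hX0 (congrArg Subtype.val h)⟩
  have hd0' : ∀ i, (0 : ℝ) < d i := fun i ↦ Nat.cast_pos.2 (hd0 i)
  obtain ⟨r, hr, htr, c, hc, hric⟩ := exists_wallach_parameters (d := fun i ↦ (d i : ℝ)) hd0' hz
    hpos W.two_mul_structureConstant_le p hp hcond
  refine ⟨Q.diagonalMetric r hr, Q.isInvariantMetric_diagonalMetric hr, fun x ↦ ?_, c, hc,
    Q.diagonalConnection r, Q.isLeviCivita_diagonalConnection hr, fun x v w ↦ ?_⟩
  · rw [Q.metricTrace_diagonalMetric hr, htr]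
  have hx : ((x.out : G) : G ⧸ H) = x := Quotient.out_eq x
  -- irreducibility enters through Schur's lemma
  have hschur : ∀ i, ∃ s : ℝ, ∀ Y ∈ 𝔪 i, ∀ Z ∈ 𝔪 i,
      casimirForm e (i + 1) Y Z = s * negKilling _ Y Z := fun i ↦
    W.casimirForm_schur (S := {A | ∃ a ∈ H, A = adjointLieEquiv a})
      (by
        rintro _ ⟨a, ha, rfl⟩
        exact Q.preserves a ha) i (i + 1) (hd0 i)
      fun V hV hinv ↦ (hM.irreducible i).2.2 V hV fun a ha X hX ↦ hinv _ ⟨a, ha, rfl⟩ X hX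
  rw [Q.ricci_diagonalConnection, W.nomizuRicci_eq hr hschur hd0 (Q.horizontalLift_mem hx v)
    (Q.horizontalLift_mem hx w), funext hric]
  have h := Q.metric x x.out hx (horizontalLift T z e x x.out v) (horizontalLift T z e x x.out w)
  rw [Q.projFrame_horizontalLift hx, Q.projFrame_horizontalLift hx] at h
  beta_reduce
  rw [h, diagForm_apply, diagForm_apply, Finset.mul_sum]
  exact Finset.sum_congr rfl fun i _ ↦ mul_assoc _ _ _
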